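/- Let $k\in\mathbb Z$, $l\in\{1,-1\}$, $T>0$, and let $V\in C^1(\mathbb R)$ be real-valued and $T$-periodic. For $\varepsilon\in\mathbb R$ consider the reaction-diffusion equation $\partial_t u=\partial_x^2u+\varepsilon V(x)u-\sin u$ on the real line and its stationary equation $$u''+\varepsilon V u-\sin u=0. \tag{1}$$ For $u\in L^\infty(\mathbb R)$ let $L_\varepsilon(u)=\partial_x^2+\varepsilon V-\cos u$, regarded as an operator on $L^2(\mathbb R)$ (complex-valued functions) with domain $H^2(\mathbb R)$; $u$ is called nondegenerate if $L_\varepsilon(u)$ is invertible, with bounded inverse. For $\varepsilon=0$, equation (1) has the front solution $$u_0(x)=4\arctan(e^{lx})+2\pi\min\{k,k+l\},$$ which connects $2\pi k$ at $-\infty$ to $2\pi(k+l)$ at $+\infty$. Define the effective potential $$V_{\rm eff}(\varsigma)=\int_{\mathbb R}V(x+\varsigma)\,u_0(x)\,u_0'(x)\,dx .$$ **Theorem.** Assume that $V_{\rm eff}$ has a simple zero at $\varsigma_0\in\mathbb R$, that is, $V_{\rm eff}(\varsigma_0)=0$ and $V_{\rm eff}'(\varsigma_0)\neq0$. Then there are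 constants $C,\varepsilon_0,\varrho>0$ such that for every $\varepsilon\in(-\varepsilon_0,\varepsilon_0)$ there exist a twice continuously differentiable solution $u(\varepsilon)$ of (1), twice continuously differentiable $T$-periodic solutions $v_-(\varepsilon),v_+(\varepsilon)$ of (1), and a real number $\lambda_0(\varepsilon)$ with the following properties. 1. $u(\varepsilon)$ is nondegenerate if $\varepsilon\neq0$. 2. $\|u(\varepsilon)-u_0(\cdot-\varsigma_0)\|_{L^\infty}\le C|\varepsilon|$ (so $u(0)=u_0(\cdot-\varsigma_0)$). 3. $\|v_-(\varepsilon)-2\pi k\|_{H^2_{\rm per}(0,T)}\le C|\varepsilon|$ and $\|v_+(\varepsilon)-2\pi(k+l)\|_{H^2_{\rm per}(0,T)}\le C|\varepsilon|$. 4. $\chi_\pm\,(u(\varepsilon)-v_\pm(\varepsilon))\in H^2(\mathbb R)$ for every smooth partition of unity $\chi_\pm:\mathbb R\to[0,1]$, $\chi_-+\chi_+=1$, with $\chi_+$ supported on $(-1,\infty)$ and $\chi_-$ supported on $(-\infty,1)$. 5. The spectrum satisfies $\sigma(L_\varepsilon(u(\varepsilon)))\subset(-\infty,-\varrho]\cup\{\lambda_0(\varepsilon)\}$,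 where $\lambda_0(\varepsilon)$ is an (algebraically) simple eigenvalue of $L_\varepsilon(u(\varepsilon))$, and $$\left|\lambda_0(\varepsilon)+\varepsilon\,\frac{V_{\rm eff}'(\varsigma_0)}{\|u_0'\|_{L^2}^2}\right|\le C\varepsilon^2 .$$ -/

import Mathlib

open MeasureTheory Set Filter
open scoped ENNReal SchwartzMap LineDeriv

namespace PeriodicFront

noncomputable section

/-! ### Closed-operator vocabulary for unbounded operators -/

section Operators

variable {E : Type*} [NormedAddCommGroup E] [NormedSpace ℂ E]

/-- An unbounded operator is invertible if it is a bijection from its domain onto the whole space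
with bounded inverse `B`. -/
def IsInvertible (A : E →ₗ.[ℂ] E) : Prop :=
  ∃ B : E →L[ℂ] E, (∀ y : E, ∃ x : A.domain, (x : E) = B y ∧ A x = y) ∧
    ∀ x : A.domain, B (A x) = x

/-- The operator `A - z`, with the same domain as `A`. -/
def shift (A : E →ₗ.[ℂ] E) (z : ℂ) : E →ₗ.[ℂ] E :=
  (-(z • (LinearMap.id : E →ₗ[ℂ] E))) +ᵥ A

/-- The spectrum of an unbounded operator. -/
def opSpectrum (A : E →ₗ.[ℂ] E) : Set ℂ :=
  {z | ¬ IsInvertible (shift A z)}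

/-- `z` is a(n algebraically) simple eigenvalue of `A`: the kernel of `A - z` is one-dimensional
and the space is the direct sum of the kernel and the range of `A - z`. -/
def IsSimpleEigenvalue (A : E →ₗ.[ℂ] E) (z : ℂ) : Prop :=
  Module.finrank ℂ (LinearMap.ker (shift A z).toFun) = 1 ∧
    IsCompl ((LinearMap.ker (shift A z).toFun).map (shift A z).domain.subtype)
      (LinearMap.range (shift A z).toFun)

end Operators

/-! ### The Sobolev space `H²(ℝ)` and the operators `∂ₓ²` and multiplication on `L²(ℝ)` -/

/-- The complex Hilbert space `L²(ℝ)`. -/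
abbrev L2 : Type := Lp ℂ 2 (volume : Measure ℝ)

/-- The Sobolev space `H²(ℝ)` as a subspace of `L²(ℝ)`. -/
def H2 : Submodule ℂ L2 where
  carrier := {f | TemperedDistribution.MemSobolev 2 2 (f : 𝓢'(ℝ, ℂ))}
  add_mem' {f g} hf hg := by
    have h := TemperedDistribution.MemSobolev.add hf hg
    simpa only [mem_ofPred_eq, ← Lp.toTemperedDistributionCLM_apply, map_add] using h
  zero_mem' := by
    simp only [mem_ofPred_eq, ← Lp.toTemperedDistributionCLM_apply, map_zero]
    exact TemperedDistribution.memSobolev_fun_zero ℝ ℂ 2 2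
  smul_mem' c f hf := by
    have h := TemperedDistribution.MemSobolev.smul c hf
    simpa only [mem_ofPred_eq, ← Lp.toTemperedDistributionCLM_apply, map_smul] using h

theorem toTemperedDistribution_injective {f g : L2}
    (h : (f : 𝓢'(ℝ, ℂ)) = (g : 𝓢'(ℝ, ℂ))) : f = g := by
  have hk := Lp.ker_toTemperedDistributionCLM_eq_bot (F := ℂ) (μ := (volume : Measure ℝ)) (p := 2)
  exact LinearMap.ker_eq_bot.mp hk h

theorem exists_secondDeriv (f : H2) :
    ∃ g : L2, (g : 𝓢'(ℝ, ℂ)) = ∂_{(1 : ℝ)} (∂_{(1 : ℝ)} ((f : L2) : 𝓢'(ℝ, ℂ))) := by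
  have h : TemperedDistribution.MemSobolev 2 2 ((f : L2) : 𝓢'(ℝ, ℂ)) := f.2
  have h2 := (h.lineDerivOp (m := (1 : ℝ))).lineDerivOp (m := (1 : ℝ))
  rw [show (2 - 1 - 1 : ℝ) = 0 by norm_num, TemperedDistribution.memSobolev_zero_iff] at h2
  obtain ⟨g, hg⟩ := h2
  exact ⟨g, hg.symm⟩

/-- The operator `∂ₓ²` on `L²(ℝ)` with domain `H²(ℝ)`, in the sense of distributions. -/
def secondDeriv : L2 →ₗ.[ℂ] L2 where
  domain := H2
  toFun :=
    { toFun := fun f => (exists_secondDeriv f).choose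
      map_add' := by
        intro f g
        apply toTemperedDistribution_injective
        rw [(exists_secondDeriv (f + g)).choose_spec]
        have hf := (exists_secondDeriv f).choose_spec
        have hg := (exists_secondDeriv g).choose_spec
        simp only [← Lp.toTemperedDistributionCLM_apply, map_add, Submodule.coe_add,
          LineDeriv.lineDerivOp_add] at hf hg ⊢
        rw [hf, hg]
      map_smul' := by
        intro c f
        apply toTemperedDistribution_injective
        rw [(exists_secondDeriv (c • f)).choose_spec]
        have hf := (exists_secondDeriv f).choose_spec
        simp only [← Lp.toTemperedDistributionCLM_apply, map_smul, Submodule.coe_smul,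
          LineDeriv.lineDerivOp_smul, RingHom.id_apply] at hf ⊢
        rw [hf] }

/-- Multiplication by a real function `q` on `L²(ℝ)`, on its maximal domain. -/
def mulOp (q : ℝ → ℝ) : L2 →ₗ.[ℂ] L2 where
  domain :=
    { carrier := {f | MemLp (fun x => (q x : ℂ) * f x) 2 volume}
      add_mem' := by
        intro f g hf hg
        refine (MemLp.add hf hg).ae_eq ?_
        filter_upwards [Lp.coeFn_add f g] with x hx
        rw [hx, Pi.add_apply, Pi.add_apply, mul_add]
      zero_mem' := by
        refine (MemLp.zero (ε := ℂ) (μ := (volume : Measure ℝ)) (p := 2)).ae_eq ?_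
        filter_upwards [Lp.coeFn_zero ℂ 2 (volume : Measure ℝ)] with x hx
        simp
      smul_mem' := by
        intro c f hf
        refine (MemLp.const_smul hf c).ae_eq ?_
        filter_upwards [Lp.coeFn_smul c f] with x hx
        rw [hx, Pi.smul_apply, Pi.smul_apply, mul_smul_comm] }
  toFun :=
    { toFun := fun f => MemLp.toLp (fun x => (q x : ℂ) * (f : L2) x) f.2
      map_add' := by
        intro f g
        rw [← MemLp.toLp_add, MemLp.toLp_eq_toLp_iff]
        filter_upwards [Lp.coeFn_add (f : L2) (g : L2)] with x hx
        rw [Submodule.coe_add, hx, Pi.add_apply, Pi.add_apply, mul_add]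
      map_smul' := by
        intro c f
        rw [RingHom.id_apply, ← MemLp.toLp_const_smul, MemLp.toLp_eq_toLp_iff]
        filter_upwards [Lp.coeFn_smul c (f : L2)] with x hx
        rw [Submodule.coe_smul, hx, Pi.smul_apply, Pi.smul_apply, mul_smul_comm] }

theorem mulOp_domain_eq_top {q : ℝ → ℝ} (hq : Measurable q) {M : ℝ} (hM : ∀ x, |q x| ≤ M) :
    (mulOp q).domain = ⊤ := by
  refine eq_top_iff.mpr fun f _ => ?_
  have h := Lp.memLp f
  refine MemLp.of_le_mul (c := M) h
    ((Complex.measurable_ofReal.comp hq).aestronglyMeasurable.mul h.1) ?_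
  filter_upwards with x
  rw [norm_mul, Complex.norm_real, Real.norm_eq_abs]
  exact mul_le_mul_of_nonneg_right (hM x) (norm_nonneg _)

/-- A real function on the line belongs to `H²(ℝ)`. -/
def MemH2 (f : ℝ → ℝ) : Prop :=
  ∃ g : L2, g ∈ H2 ∧ (g : ℝ → ℂ) =ᵐ[volume] fun x => (f x : ℂ)

/-- The norm of `H²_per(0,T)`, for a twice continuously differentiable `T`-periodic function. -/
def h2PerNorm (T : ℝ) (v : ℝ → ℝ) : ℝ :=
  √(∫ x in (0 : ℝ)..T, (v x ^ 2 + deriv v x ^ 2 + deriv (deriv v) x ^ 2))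

/-! ### The equation `∂ₜu = ∂ₓ²u + ε V(x) u - sin u` -/

/-- `u` is a (classical) stationary solution: `u'' + ε V u - sin u = 0`. -/
def IsStationarySolution (ε : ℝ) (V u : ℝ → ℝ) : Prop :=
  ContDiff ℝ 2 u ∧ ∀ x, deriv (deriv u) x + ε * V x * u x - Real.sin (u x) = 0

/-- The linearization `L_ε(u) = ∂ₓ² + ε V - cos u` on `L²(ℝ)`. Its domain is `H²(ℝ)`, see
`linearization_domain`. -/
def linearization (ε : ℝ) (V u : ℝ → ℝ) : L2 →ₗ.[ℂ] L2 :=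
  secondDeriv + mulOp (fun x => ε * V x - Real.cos (u x))

theorem linearization_domain {V : ℝ → ℝ} (hV : Measurable V) {M : ℝ} (hM : ∀ x, |V x| ≤ M)
    (ε : ℝ) {u : ℝ → ℝ} (hu : Measurable u) : (linearization ε V u).domain = H2 := by
  have h : (mulOp (fun x => ε * V x - Real.cos (u x))).domain = ⊤ := by
    refine mulOp_domain_eq_top (M := |ε| * M + 1)
      ((hV.const_mul ε).sub (Real.measurable_cos.comp hu)) fun x => ?_
    refine (abs_sub _ _).trans (add_le_add ?_ (Real.abs_cos_le_one _))
    rw [abs_mul]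
    exact mul_le_mul_of_nonneg_left (hM x) (abs_nonneg _)
  rw [linearization, LinearPMap.add_domain, h, inf_top_eq]
  rfl

/-- `u` is nondegenerate if the linearization about `u` is invertible. -/
def IsNondegenerate (ε : ℝ) (V u : ℝ → ℝ) : Prop :=
  IsInvertible (linearization ε V u)

/-- The front `u_{0,k,l}(x) = 4 arctan(e^{l x}) + 2π min{k, k + l}` (for `l = ± 1`), which connects
`2πk` at `-∞` to `2π(k+l)` at `+∞`. -/
def kink (k l : ℤ) (x : ℝ) : ℝ :=
  4 * Real.arctan (Real.exp (l * x)) + 2 * Real.pi * (min k (k + l) : ℤ)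

/-- The effective potential `V_eff(ς) = ∫ V(x + ς) u_{0,k,l}(x) u_{0,k,l}'(x) dx`. -/
def effectivePotential (V : ℝ → ℝ) (k l : ℤ) (s : ℝ) : ℝ :=
  ∫ x, V (x + s) * kink k l x * deriv (kink k l) x

/-- `χm, χp : ℝ → [0,1]` form a smooth partition of unity with `χp` supported on `(-1,∞)` and
`χm` supported on `(-∞,1)`. -/
structure IsFrontPartition (χm χp : ℝ → ℝ) : Prop where
  smooth_minus : ContDiff ℝ (⊤ : ℕ∞) χm
  smooth_plus : ContDiff ℝ (⊤ : ℕ∞) χp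
  mem_minus : ∀ x, χm x ∈ Icc (0 : ℝ) 1
  mem_plus : ∀ x, χp x ∈ Icc (0 : ℝ) 1
  add_eq_one : ∀ x, χm x + χp x = 1
  support_minus : Function.support χm ⊆ Iio 1
  support_plus : Function.support χp ⊆ Ioi (-1)

end

end PeriodicFront

namespace PeriodicFront

/-! ### Spectrum of a symmetric operator with one isolated top eigenvalue -/

section AbstractSpectral

variable {H : Type*} [NormedAddCommGroup H] [InnerProductSpace ℂ H]

local notation "⟪" x ", " y "⟫" => inner ℂ x y

/-! Write `q` for the front at `ε = 0`. Existence is a Lyapunov–Schmidt reduction. For a shift `s`,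
put `u(x) = q(x - s) + w(x - s)`. Since `cos q = 1 - 2 sech²`, the equation becomes `(∂² - 1 + 2
sech²) w = f`, where `f` collects `-ε V(· + s)(q + w)` and the quadratic remainder of the sine. The
operator on the left equals `(∂ - tanh)(∂ + tanh)` and annihilates `sech`, a multiple of `q'`. Two
first-order integrations invert it, modulo `sech`, on bounded continuous functions
(`exists_bounded_inverse_kink`), and a contraction gives `w = O(ε)` for every `s`
(`exists_perturbation`). What is left is one scalar equation, the vanishing of the pairing of `f`
with `sech`. Up to the factor `2l` it reads `-ε V_eff(s) + O(ε²) = 0`. Near a simple zero of `V_eff`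
the left side changes sign, so the intermediate value theorem yields `s = s₀ + O(ε)`
(`exists_zero_near`, `exists_front`). Continuity in `s` suffices; no derivative of `w` in `s` is
needed.

For the spectrum, the form of `-∂² + 1 - 2 sech²` is `∫ |f' + tanh f|²`. A Hardy inequality bounds
it below by a quarter of the squared distance to the span of `sech` (`coercive_H2`). Thus `0` is a
simple eigenvalue of the unperturbed linearization and the rest lies below `-1/4`. A bounded
perturbation of size `δ = O(ε)` keeps this picture, and the moved eigenvalue is the first-order
value `⟨L e, e⟩`, with `e` the normalized `sech`, up to `8 δ²` (`exists_simple_eigenvalue_near`).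
That value still contains `w`. Testing the equation of `w` against `sech' = -tanh sech` eliminates
it and leaves `-ε V_eff'(s₀)/8`, where `8 = ‖q'‖²` (`abs_sechPairing_potentialDiff_le`). It is
nonzero for small `ε ≠ 0`, which is nondegeneracy.

The end states come from the same contraction around `2πm` with `(∂² - 1)⁻¹`. The difference `d` of
two solutions staying near `2πm` satisfies `d d'' ≥ d²/2`. If this holds on the whole line, a
bounded `d` vanishes, which makes the end states periodic; on a half line `d` decays exponentially,
which puts the tails of `u - v_±` in `H²` (`sq_le_exp_of_mul_deriv_ge`). -/

theorem shift_apply (A : H →ₗ.[ℂ] H) (z : ℂ) (x : A.domain) :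
    shift A z x = A x - z • (x : H) := by
  have h := LinearPMap.vadd_apply (-(z • (LinearMap.id : H →ₗ[ℂ] H))) A x
  rw [sub_eq_neg_add]
  exact h

theorem isInvertible_shift_iff (A : H →ₗ.[ℂ] H) (z : ℂ) :
    IsInvertible (shift A z) ↔ ∃ B : H →L[ℂ] H,
      (∀ y, ∃ x : A.domain, (x : H) = B y ∧ A x - z • (x : H) = y) ∧
        ∀ x : A.domain, B (A x - z • (x : H)) = x := by
  have h : ∀ x : A.domain, shift A z x = A x - z • (x : H) := shift_apply A z
  simp only [← h]
  exact Iff.rfl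

theorem mem_ker_shift (A : H →ₗ.[ℂ] H) (z : ℂ) (x : A.domain) :
    (show (shift A z).domain from x) ∈ LinearMap.ker (shift A z).toFun ↔ A x - z • (x : H) = 0 := by
  rw [← shift_apply]
  exact Iff.rfl

/-- Cauchy–Schwarz. With `y` the image of `x` under an operator, it turns an upper bound on the form
into an a priori lower bound on the operator. -/
theorem mul_norm_le_of_re_inner_le {x y : H} {c : ℝ} (h : (⟪y, x⟫).re ≤ -c * ‖x‖ ^ 2) :
    c * ‖x‖ ≤ ‖y‖ := by
  have h1 : -(⟪y, x⟫).re ≤ ‖y‖ * ‖x‖ :=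
    (neg_le_abs _).trans ((Complex.abs_re_le_norm _).trans (norm_inner_le_norm y x))
  rcases (norm_nonneg x).eq_or_lt with h0 | h0
  · rw [← h0]; simp
  · nlinarith

theorem inner_sub_proj_eq_zero {φ : H} (hφ : φ ≠ 0) (x : H) :
    ⟪φ, x - (⟪φ, x⟫ / (‖φ‖ : ℂ) ^ 2) • φ⟫ = 0 := by
  have hnC : (‖φ‖ : ℂ) ≠ 0 := by exact_mod_cast norm_ne_zero_iff.mpr hφ
  rw [inner_sub_right, inner_smul_right, inner_self_eq_norm_sq_to_K]
  simp only [Complex.coe_algebraMap]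
  field_simp
  ring

/-- The rank-one operator `x ↦ s ⟪φ, x⟫ φ`. -/
noncomputable def rankOneOp (s : ℝ) (φ : H) : H →L[ℂ] H :=
  (s : ℂ) • (innerSL ℂ φ).smulRight φ

theorem rankOneOp_apply (s : ℝ) (φ x : H) : rankOneOp s φ x = ((s : ℂ) * ⟪φ, x⟫) • φ := by
  simp only [rankOneOp, _root_.smul_apply, ContinuousLinearMap.smulRight_apply,
    innerSL_apply_apply, smul_smul]

theorem rankOneOp_symm (s : ℝ) (φ x y : H) :
    ⟪rankOneOp s φ x, y⟫ = ⟪x, rankOneOp s φ y⟫ := by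
  rw [rankOneOp_apply, rankOneOp_apply, inner_smul_left, inner_smul_right, map_mul,
    Complex.conj_ofReal, inner_conj_symm]
  ring

/-- Lower bound for a symmetric operator with an eigenvector `φ`, modified along `φ`, when the
form is bounded above by `-ρ` on the complement of `φ`. -/
theorem mul_norm_le_of_gap (A : H →ₗ.[ℂ] H)
    (hsym : ∀ x y : A.domain, ⟪A x, (y : H)⟫ = ⟪(x : H), A y⟫) (φ : A.domain)
    (hφ0 : (φ : H) ≠ 0) (ev ρ : ℝ) (hφ : A φ = (ev : ℂ) • (φ : H))
    (hgap : ∀ x : A.domain, ⟪(φ : H), (x : H)⟫ = 0 → (⟪A x, (x : H)⟫).re ≤ -ρ * ‖(x : H)‖ ^ 2)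
    (s z c : ℝ) (hc0 : 0 ≤ c) (hc₁ : c ≤ |ev + s * ‖(φ : H)‖ ^ 2 - z|) (hc₂ : c ≤ z + ρ)
    (x : A.domain) :
    c * ‖(x : H)‖ ≤ ‖A x + rankOneOp s (φ : H) x - (z : ℂ) • (x : H)‖ := by
  have hn : ‖(φ : H)‖ ^ 2 ≠ 0 := by positivity
  have hnC : (‖(φ : H)‖ : ℂ) ≠ 0 := by exact_mod_cast norm_ne_zero_iff.mpr hφ0
  -- The modified operator respects the splitting `x = a φ + g` with `g ⊥ φ`, because `A g ⊥ φ` by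
  -- symmetry. On `φ` it is the scalar `ev + s ‖φ‖² - z`; on the complement the form bound applies.
  -- Pythagoras combines the two.
  set a : ℂ := ⟪(φ : H), (x : H)⟫ / (‖(φ : H)‖ : ℂ) ^ 2 with ha
  set g : A.domain := x - a • φ with hg
  have hgx : x = a • φ + g := by rw [hg]; abel
  have horth : ⟪(φ : H), (g : H)⟫ = 0 := inner_sub_proj_eq_zero hφ0 _
  have hAg : ⟪(φ : H), A g⟫ = 0 := by
    rw [← hsym, hφ, inner_smul_left, horth, mul_zero]
  set b : ℂ := a * ((ev + s * ‖(φ : H)‖ ^ 2 - z : ℝ) : ℂ) with hb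
  have hval : A x + rankOneOp s (φ : H) x - (z : ℂ) • (x : H)
      = b • (φ : H) + (A g - (z : ℂ) • (g : H)) := by
    rw [rankOneOp_apply]
    have : ⟪(φ : H), (x : H)⟫ = a * (‖(φ : H)‖ : ℂ) ^ 2 := by rw [ha]; field_simp
    rw [this]
    conv_lhs => rw [hgx]
    rw [LinearPMap.map_add, LinearPMap.map_smul, hφ, Submodule.coe_add, Submodule.coe_smul, hb]
    push_cast
    module
  have hAgz : c * ‖(g : H)‖ ≤ ‖A g - (z : ℂ) • (g : H)‖ := by
    apply mul_norm_le_of_re_inner_le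
    rw [inner_sub_left, inner_smul_left, Complex.conj_ofReal, inner_self_eq_norm_sq_to_K]
    have h1 := hgap g horth
    have h2 : ((z : ℂ) * ((‖(g : H)‖ : ℂ)) ^ 2).re = z * ‖(g : H)‖ ^ 2 := by
      norm_cast
    simp only [Complex.coe_algebraMap, Complex.sub_re, h2]
    nlinarith [sq_nonneg ‖(g : H)‖]
  have hpy1 : ‖b • (φ : H) + (A g - (z : ℂ) • (g : H))‖ ^ 2
      = ‖b • (φ : H)‖ ^ 2 + ‖A g - (z : ℂ) • (g : H)‖ ^ 2 := by
    have := norm_add_sq_eq_norm_sq_add_norm_sq_of_inner_eq_zero (𝕜 := ℂ)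
      (b • (φ : H)) (A g - (z : ℂ) • (g : H)) (by
        rw [inner_smul_left, inner_sub_right, hAg, inner_smul_right, horth]; simp)
    simpa only [sq] using this
  have hpy2 : ‖(x : H)‖ ^ 2 = ‖a • (φ : H)‖ ^ 2 + ‖(g : H)‖ ^ 2 := by
    have := norm_add_sq_eq_norm_sq_add_norm_sq_of_inner_eq_zero (𝕜 := ℂ)
      (a • (φ : H)) (g : H) (by rw [inner_smul_left, horth, mul_zero])
    conv_lhs => rw [hgx]
    rw [Submodule.coe_add, Submodule.coe_smul]
    simpa only [sq] using this
  have hb' : c * ‖a • (φ : H)‖ ≤ ‖b • (φ : H)‖ := by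
    rw [norm_smul, norm_smul, hb, norm_mul, Complex.norm_real, Real.norm_eq_abs]
    have : 0 ≤ ‖a‖ * ‖(φ : H)‖ := by positivity
    nlinarith
  rw [hval]
  refine le_of_sq_le_sq ?_ (norm_nonneg _)
  rw [hpy1, mul_pow, hpy2]
  have e1 := pow_le_pow_left₀ (by positivity) hb' 2
  have e2 := pow_le_pow_left₀ (by positivity) hAgz 2
  nlinarith

variable [CompleteSpace H]

/-- A bounded operator that is bounded below and has dense range has a bounded right inverse. -/
theorem exists_rightInverse_of_bounded_below (Q : H →L[ℂ] H) {c : ℝ} (hc : 0 < c)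
    (hQ : ∀ y, c * ‖y‖ ≤ ‖Q y‖) (hadj : ∀ y, (∀ w, ⟪y, Q w⟫ = 0) → y = 0) :
    ∃ R : H →L[ℂ] H, ∀ y, Q (R y) = y := by
  have hanti : AntilipschitzWith (Real.toNNReal c⁻¹) Q := by
    refine ContinuousLinearMap.antilipschitz_of_bound Q fun y => ?_
    rw [Real.coe_toNNReal _ (by positivity), inv_mul_eq_div, le_div_iff₀ hc, mul_comm]
    exact hQ y
  have hcl : IsClosed (Q.range : Set H) := by
    have := hanti.isClosed_range Q.uniformContinuous
    exact this
  have htop : Q.range = ⊤ := by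
    have : Submodule.HasOrthogonalProjection Q.range :=
      @Submodule.HasOrthogonalProjection.ofCompleteSpace ℂ H _ _ _ _
        (hcl.completeSpace_coe)
    rw [← Submodule.orthogonal_eq_bot_iff]
    refine (Submodule.eq_bot_iff _).mpr fun y hy => hadj y fun w => ?_
    exact (Submodule.mem_orthogonal' _ _).mp hy _ ⟨w, rfl⟩
  let Φ := ContinuousLinearEquiv.ofBijective Q
    (LinearMap.ker_eq_bot.mpr hanti.injective) htop
  exact ⟨Φ.symm, fun y => ContinuousLinearEquiv.ofBijective_apply_symm_apply Q _ _ y⟩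

/-- Two-sided a priori bounds make a bounded symmetric perturbation of a self-adjoint operator
boundedly invertible. -/
theorem exists_inverse_of_bounds (A : H →ₗ.[ℂ] H)
    (hsym : ∀ x y : A.domain, ⟪A x, (y : H)⟫ = ⟪(x : H), A y⟫) (z₀ : ℝ)
    (hK : IsInvertible (shift A z₀)) (B : H →L[ℂ] H) (hB : ∀ x y, ⟪B x, y⟫ = ⟪x, B y⟫)
    (z : ℂ) {c : ℝ} (hc : 0 < c)
    (h₁ : ∀ x : A.domain, c * ‖(x : H)‖ ≤ ‖A x + B x - z • (x : H)‖)
    (h₂ : ∀ x : A.domain, c * ‖(x : H)‖ ≤ ‖A x + B x - (starRingEnd ℂ z) • (x : H)‖) :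
    ∃ G : H →L[ℂ] H, (∀ y, ∃ x : A.domain, (x : H) = G y ∧ A x + B x - z • (x : H) = y) ∧
      ∀ x : A.domain, G (A x + B x - z • (x : H)) = x := by
  obtain ⟨K, hK₁', -⟩ := (isInvertible_shift_iff A z₀).mp hK
  have hKsym : ∀ x y, ⟪K x, y⟫ = ⟪x, K y⟫ := by
    intro x y
    obtain ⟨a, ha, ha'⟩ := hK₁' x
    obtain ⟨b, hb, hb'⟩ := hK₁' y
    rw [← ha, ← hb, ← ha', ← hb', inner_sub_left, inner_sub_right, hsym, inner_smul_left,
      inner_smul_right, Complex.conj_ofReal]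
  -- With `K = (A - z₀)⁻¹` one has `A + B - z = (1 + P K)(A - z₀)`, so the unbounded problem reduces
  -- to inverting the bounded operator `Q = 1 + P K`.
  let P : H →L[ℂ] H := B - (z - z₀) • ContinuousLinearMap.id ℂ H
  let Q : H →L[ℂ] H := ContinuousLinearMap.id ℂ H + P ∘L K
  have hPa : ∀ y, P y = B y - (z - z₀) • y := fun y => rfl
  have hQa : ∀ y, Q y = y + P (K y) := fun y => rfl
  have hQ : ∀ (y : H) (x : A.domain), (x : H) = K y → A x - (z₀ : ℂ) • (x : H) = y →
      Q y = A x + B x - z • (x : H) := by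
    intro y x hx hx'
    rw [hQa, hPa, ← hx, ← hx', sub_smul]
    abel
  have hinj : ∀ x : A.domain, A x + B x - z • (x : H) = 0 → (x : H) = 0 := by
    intro x hx
    have := h₁ x
    rw [hx, norm_zero] at this
    exact norm_le_zero_iff.mp (by nlinarith [norm_nonneg (x : H)])
  have hlow : ∀ y, (1 + ‖P‖ / c)⁻¹ * ‖y‖ ≤ ‖Q y‖ := by
    intro y
    obtain ⟨x, hx, hx'⟩ := hK₁' y
    have h3 := h₁ x
    rw [← hQ y x hx hx'] at h3
    have h4 : ‖y‖ ≤ ‖Q y‖ + ‖P‖ * ‖(x : H)‖ := by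
      calc ‖y‖ = ‖Q y - P (K y)‖ := by rw [hQa]; congr 1; abel
        _ ≤ ‖Q y‖ + ‖P (K y)‖ := norm_sub_le _ _
        _ ≤ _ := by rw [← hx]; gcongr; exact P.le_opNorm _
    have h5 : ‖(x : H)‖ ≤ ‖Q y‖ / c := by rw [le_div_iff₀ hc]; linarith
    rw [inv_mul_le_iff₀ (by positivity)]
    calc ‖y‖ ≤ ‖Q y‖ + ‖P‖ * (‖Q y‖ / c) := h4.trans (by gcongr)
      _ = _ := by ring
  obtain ⟨R, hR⟩ := exists_rightInverse_of_bounded_below Q (by positivity) hlow (by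
    intro y hy
    have hP : ∀ u v, ⟪u, P v⟫ = ⟪B u - (starRingEnd ℂ z - z₀) • u, v⟫ := by
      intro u v
      rw [hPa, inner_sub_left, inner_sub_right, hB, inner_smul_left, inner_smul_right]
      simp
    -- A vector orthogonal to the range of `Q` satisfies `y + K P* y = 0`. Hence it lies in the
    -- domain of `A` and solves the homogeneous equation at the conjugate point, where `h₂` applies.
    have h3 : y + K (B y - (starRingEnd ℂ z - z₀) • y) = 0 := by
      refine ext_inner_right ℂ fun w => ?_
      have := hy w
      rw [hQa, inner_add_right, hP] at this
      rw [inner_add_left, hKsym, this, inner_zero_left]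
    obtain ⟨x, hx, hx'⟩ := hK₁' (B y - (starRingEnd ℂ z - z₀) • y)
    have hxy : (x : H) = -y := by rw [hx]; exact (neg_eq_of_add_eq_zero_right h3).symm
    have h6 := h₂ x
    have : A x + B x - (starRingEnd ℂ z) • (x : H) = 0 := by
      rw [sub_eq_iff_eq_add] at hx'
      rw [hx', hxy, map_neg, sub_smul]
      simp only [smul_neg]
      abel
    rw [this, norm_zero, hxy, norm_neg] at h6
    exact norm_le_zero_iff.mp (by nlinarith [norm_nonneg y]))
  have hG : ∀ y, ∃ x : A.domain, (x : H) = (K ∘L R) y ∧ A x + B x - z • (x : H) = y := by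
    intro y
    obtain ⟨x, hx, hx'⟩ := hK₁' (R y)
    exact ⟨x, hx, by rw [← hQ _ x hx hx', hR]⟩
  refine ⟨K ∘L R, hG, fun x => ?_⟩
  obtain ⟨x', hx', hx''⟩ := hG (A x + B x - z • (x : H))
  rw [← hx']
  have := hinj (x' - x) (by
    rw [LinearPMap.map_sub, Submodule.coe_sub, map_sub, smul_sub]
    have := sub_eq_zero.mpr hx''
    rw [← this]; abel)
  rw [Submodule.coe_sub] at this
  exact sub_eq_zero.mp this

/-- A kernel vector orthogonal to `φ` would violate the gap since `ev > -ρ`, so the kernel is the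
span of `φ`. By symmetry kernel and range are orthogonal. They span because `A - ev` becomes
invertible once `⟨φ, ·⟩ φ` is subtracted, and solving that modified equation splits any given
vector. -/
theorem isSimpleEigenvalue_of_gap (A : H →ₗ.[ℂ] H)
    (hsym : ∀ x y : A.domain, ⟪A x, (y : H)⟫ = ⟪(x : H), A y⟫) (z₀ : ℝ)
    (hK : IsInvertible (shift A z₀)) (φ : A.domain)
    (hφ0 : (φ : H) ≠ 0) (ev ρ : ℝ) (hφ : A φ = (ev : ℂ) • (φ : H)) (hev : -ρ < ev)
    (hgap : ∀ x : A.domain, ⟪(φ : H), (x : H)⟫ = 0 → (⟪A x, (x : H)⟫).re ≤ -ρ * ‖(x : H)‖ ^ 2) :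
    IsSimpleEigenvalue A (ev : ℂ) := by
  have hn : 0 < ‖(φ : H)‖ ^ 2 := by positivity
  have hker : ∀ x : A.domain, A x - (ev : ℂ) • (x : H) = 0 → ∃ a : ℂ, x = a • φ := by
    intro x hx
    set a : ℂ := ⟪(φ : H), (x : H)⟫ / (‖(φ : H)‖ : ℂ) ^ 2 with ha
    refine ⟨a, ?_⟩
    have h0 : ⟪(φ : H), ((x - a • φ : A.domain) : H)⟫ = 0 := inner_sub_proj_eq_zero hφ0 _
    have h1 : A (x - a • φ) = (ev : ℂ) • ((x - a • φ : A.domain) : H) := by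
      rw [LinearPMap.map_sub, LinearPMap.map_smul, hφ, sub_eq_zero.mp hx, Submodule.coe_sub,
        Submodule.coe_smul]
      module
    have h2 := hgap _ h0
    rw [h1, inner_smul_left, Complex.conj_ofReal, inner_self_eq_norm_sq_to_K] at h2
    have h3 : ((ev : ℂ) * ((‖((x - a • φ : A.domain) : H)‖ : ℂ)) ^ 2).re
        = ev * ‖((x - a • φ : A.domain) : H)‖ ^ 2 := by norm_cast
    simp only [Complex.coe_algebraMap, h3] at h2
    have h4 : ‖((x - a • φ : A.domain) : H)‖ ^ 2 ≤ 0 := by nlinarith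
    have h5 : ((x - a • φ : A.domain) : H) = 0 := by
      rw [← norm_eq_zero]; exact pow_eq_zero_iff (two_ne_zero) |>.mp (le_antisymm h4 (by positivity))
    exact sub_eq_zero.mp (Subtype.ext h5)
  have hφker : (show (shift A (ev : ℂ)).domain from φ) ∈ LinearMap.ker (shift A (ev : ℂ)).toFun := by
    exact (mem_ker_shift A _ φ).mpr (by rw [hφ, sub_self])
  refine ⟨?_, ?_, ?_⟩
  · rw [finrank_eq_one_iff']
    refine ⟨⟨φ, hφker⟩, fun h => hφ0 ?_, ?_⟩
    · have := congrArg Subtype.val (congrArg Subtype.val h)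
      exact this
    · rintro ⟨w, hw⟩
      obtain ⟨a, ha⟩ := hker w ((mem_ker_shift A _ w).mp hw)
      exact ⟨a, Subtype.ext ha.symm⟩
  · rw [Submodule.disjoint_def]
    rintro y ⟨w, hw, rfl⟩ ⟨x, hx⟩
    have hinner : ∀ w x : A.domain, A w - (ev : ℂ) • (w : H) = 0 →
        A x - (ev : ℂ) • (x : H) = w → (w : H) = 0 := by
      intro w x hw' hx'
      have : ⟪(w : H), (w : H)⟫ = 0 := by
        nth_rewrite 1 [← hx']
        rw [inner_sub_left, hsym, sub_eq_zero.mp hw', inner_smul_left, inner_smul_right,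
          Complex.conj_ofReal, sub_self]
      exact inner_self_eq_zero.mp this
    exact hinner w x ((mem_ker_shift A _ w).mp hw) ((shift_apply A _ x).symm.trans hx)
  · rw [codisjoint_iff, eq_top_iff]
    intro y _
    -- Along `φ` the modified operator minus `ev` is the nonzero scalar `-‖φ‖²`.
    obtain ⟨c, hc, hc₁, hc₂⟩ : ∃ c : ℝ, 0 < c ∧ c ≤ |ev + (-1) * ‖(φ : H)‖ ^ 2 - ev| ∧
        c ≤ ev + ρ := by
      refine ⟨min (‖(φ : H)‖ ^ 2) (ev + ρ), lt_min hn (by linarith), ?_, min_le_right _ _⟩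
      refine (min_le_left _ _).trans (le_of_eq ?_)
      rw [show ev + (-1) * ‖(φ : H)‖ ^ 2 - ev = -‖(φ : H)‖ ^ 2 by ring, abs_neg,
        abs_of_pos hn]
    have hlow := mul_norm_le_of_gap A hsym φ hφ0 ev ρ hφ hgap (-1) ev c hc.le hc₁ hc₂
    obtain ⟨G, hG, -⟩ := exists_inverse_of_bounds A hsym z₀ hK (rankOneOp (-1) (φ : H))
      (rankOneOp_symm _ _) (ev : ℂ) hc hlow (by rw [Complex.conj_ofReal]; exact hlow)
    obtain ⟨x, -, hx⟩ := hG y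
    rw [Submodule.mem_sup]
    refine ⟨(((-1 : ℝ) : ℂ) * ⟪(φ : H), (x : H)⟫) • (φ : H),
      ⟨(((-1 : ℝ) : ℂ) * ⟪(φ : H), (x : H)⟫) • φ, Submodule.smul_mem _ _ hφker, rfl⟩,
      A x - (ev : ℂ) • (x : H), ⟨x, shift_apply A _ x⟩, ?_⟩
    rw [← rankOneOp_apply]
    refine Eq.trans ?_ hx
    abel

/-- Off the real axis the imaginary part of the form gives `|Im z| ‖x‖ ≤ ‖(A - z) x‖`; at real
points the gap estimate does the work. The operator `rankOneOp 0` is zero and serves only to fit the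
statements about modified operators. -/
theorem opSpectrum_subset_of_gap (A : H →ₗ.[ℂ] H)
    (hsym : ∀ x y : A.domain, ⟪A x, (y : H)⟫ = ⟪(x : H), A y⟫) (z₀ : ℝ)
    (hK : IsInvertible (shift A z₀)) (φ : A.domain)
    (hφ0 : (φ : H) ≠ 0) (ev ρ : ℝ) (hφ : A φ = (ev : ℂ) • (φ : H))
    (hgap : ∀ x : A.domain, ⟪(φ : H), (x : H)⟫ = 0 → (⟪A x, (x : H)⟫).re ≤ -ρ * ‖(x : H)‖ ^ 2) :
    opSpectrum A ⊆ {z : ℂ | ∃ x : ℝ, x ≤ -ρ ∧ z = (x : ℂ)} ∪ {(ev : ℂ)} := by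
  intro z hz
  by_contra hcon
  apply hz
  obtain ⟨c, hc, h₁, h₂⟩ : ∃ c : ℝ, 0 < c ∧
      (∀ x : A.domain, c * ‖(x : H)‖ ≤ ‖A x + rankOneOp 0 (φ : H) x - z • (x : H)‖) ∧
      (∀ x : A.domain, c * ‖(x : H)‖ ≤
        ‖A x + rankOneOp 0 (φ : H) x - (starRingEnd ℂ z) • (x : H)‖) := by
    by_cases him : z.im = 0
    · obtain ⟨r, rfl⟩ : ∃ r : ℝ, z = (r : ℂ) := ⟨z.re, Complex.ext rfl (by simpa using him)⟩
      have hr₁ : -ρ < r := by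
        by_contra h
        exact hcon (Or.inl ⟨r, not_lt.mp h, rfl⟩)
      have hr₂ : r ≠ ev := fun h => hcon (Or.inr (by simp [h]))
      have hpos : 0 < |ev - r| := abs_pos.mpr (sub_ne_zero.mpr hr₂.symm)
      refine ⟨min |ev - r| (r + ρ), lt_min hpos (by linarith), ?_, ?_⟩
      · exact mul_norm_le_of_gap A hsym φ hφ0 ev ρ hφ hgap 0 r _
          (le_min hpos.le (by linarith)) (by simp) (min_le_right _ _)
      · rw [Complex.conj_ofReal]
        exact mul_norm_le_of_gap A hsym φ hφ0 ev ρ hφ hgap 0 r _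
          (le_min hpos.le (by linarith)) (by simp) (min_le_right _ _)
    · have key : ∀ w : ℂ, |w.im| = |z.im| → ∀ x : A.domain, |z.im| * ‖(x : H)‖ ≤
          ‖A x + rankOneOp 0 (φ : H) x - w • (x : H)‖ := by
        intro w hw x
        rw [rankOneOp_apply, Complex.ofReal_zero, zero_mul, zero_smul, add_zero]
        have hre : (⟪A x, (x : H)⟫).im = 0 := by
          rw [← Complex.conj_eq_iff_im, inner_conj_symm, hsym]
        have h1 : (⟪A x - w • (x : H), (x : H)⟫).im = w.im * ‖(x : H)‖ ^ 2 := by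
          rw [inner_sub_left, inner_smul_left, inner_self_eq_norm_sq_to_K, Complex.sub_im, hre]
          simp only [Complex.coe_algebraMap, ← Complex.ofReal_pow, Complex.im_mul_ofReal]
          simp
        have h2 : |w.im| * ‖(x : H)‖ ^ 2 ≤ ‖A x - w • (x : H)‖ * ‖(x : H)‖ := by
          calc |w.im| * ‖(x : H)‖ ^ 2 = |(⟪A x - w • (x : H), (x : H)⟫).im| := by
                rw [h1, abs_mul, abs_of_nonneg (sq_nonneg ‖(x : H)‖)]
            _ ≤ _ := (Complex.abs_im_le_norm _).trans (norm_inner_le_norm _ _)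
        rw [← hw]
        rcases (norm_nonneg (x : H)).eq_or_lt with h0 | h0
        · rw [← h0]; simp
        · nlinarith
      exact ⟨|z.im|, abs_pos.mpr him, key z rfl, key _ (by simp)⟩
  obtain ⟨G, hG₁, hG₂⟩ := exists_inverse_of_bounds A hsym z₀ hK (rankOneOp 0 (φ : H))
      (rankOneOp_symm _ _) z hc h₁ h₂
  have hz0 : ∀ x : H, rankOneOp 0 (φ : H) x = 0 := fun x => by simp [rankOneOp_apply]
  rw [isInvertible_shift_iff]
  simp only [hz0, add_zero] at hG₁ hG₂
  exact ⟨G, hG₁, hG₂⟩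

end AbstractSpectral

/-! ### Perturbation of the critical eigenvalue -/

section EigenvaluePerturbation

variable {H : Type*} [NormedAddCommGroup H] [InnerProductSpace ℂ H]

local notation "⟪" x ", " y "⟫" => inner ℂ x y

theorem re_inner_ofReal_smul_self (t : ℝ) (x : H) :
    (⟪(t : ℂ) • x, x⟫).re = t * ‖x‖ ^ 2 := by
  rw [inner_smul_left, Complex.conj_ofReal, inner_self_eq_norm_sq_to_K, Complex.re_ofReal_mul]
  simp only [Complex.coe_algebraMap, ← Complex.ofReal_pow, Complex.ofReal_re]

variable [CompleteSpace H]

/-- Near an approximate null vector `e` of a symmetric operator whose form is bounded above by a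
negative constant on the complement of `e`, there is an exact eigenvector. -/
theorem exists_eigenvector_near (A : H →ₗ.[ℂ] H)
    (hsym : ∀ x y : A.domain, ⟪A x, (y : H)⟫ = ⟪(x : H), A y⟫) (z₀ : ℝ)
    (hK : IsInvertible (shift A z₀)) (e : A.domain) (he : ‖(e : H)‖ = 1) (δ : ℝ)
    (hδ : δ ≤ 1 / 200) (hAe : ‖A e‖ ≤ δ)
    (hform : ∀ x : A.domain, (⟪A x, (x : H)⟫).re ≤
      -(1 / 4) * (‖(x : H)‖ ^ 2 - ‖⟪(e : H), (x : H)⟫‖ ^ 2) + δ * ‖(x : H)‖ ^ 2) :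
    ∃ (t : ℝ) (φ : A.domain), |t| ≤ 1 / 16 ∧ ⟪(e : H), (φ : H)⟫ = 1 ∧
      A φ = (t : ℂ) • (φ : H) := by
  have hδ0 : 0 ≤ δ := (norm_nonneg _).trans hAe
  have hee : ⟪(e : H), (e : H)⟫ = 1 := by rw [inner_self_eq_norm_sq_to_K, he]; simp
  -- Subtracting the projection onto `e` makes the form negative in all directions: `-1/4 + 1/200 +
  -- 1/16 ≤ -1/8`.
  have hlow : ∀ t : ℝ, |t| ≤ 1 / 16 → ∀ x : A.domain,
      1 / 8 * ‖(x : H)‖ ≤ ‖A x + rankOneOp (-1) (e : H) x - (t : ℂ) • (x : H)‖ := by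
    intro t ht x
    apply mul_norm_le_of_re_inner_le
    rw [inner_sub_left, inner_add_left, rankOneOp_apply, inner_smul_left, Complex.sub_re,
      Complex.add_re, re_inner_ofReal_smul_self, map_mul, Complex.conj_ofReal, mul_assoc,
      ← Complex.normSq_eq_conj_mul_self, Complex.normSq_eq_norm_sq]
    have h1 := hform x
    have h2 : ((((-1 : ℝ) : ℂ)) * ((‖⟪(e : H), (x : H)⟫‖ ^ 2 : ℝ) : ℂ)).re
        = -‖⟪(e : H), (x : H)⟫‖ ^ 2 := by
      rw [← Complex.ofReal_mul, Complex.ofReal_re]; ring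
    rw [h2]
    have := abs_le.mp ht
    nlinarith [sq_nonneg ‖⟪(e : H), (x : H)⟫‖, sq_nonneg ‖(x : H)‖]
  -- Bordering: if `x` solves `(A - ⟨e, ·⟩ e - t) x = -e`, then `(A - t) x = (⟨e, x⟩ - 1) e`, so `x`
  -- is an eigenvector exactly when `⟨e, x⟩ = 1`. It remains to find such a `t`.
  have hex : ∀ t : ℝ, ∃ x : A.domain, |t| ≤ 1 / 16 →
      A x + rankOneOp (-1) (e : H) x - (t : ℂ) • (x : H) = -(e : H) := by
    intro t
    by_cases ht : |t| ≤ 1 / 16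
    · obtain ⟨G, hG, -⟩ := exists_inverse_of_bounds A hsym z₀ hK (rankOneOp (-1) (e : H))
        (rankOneOp_symm _ _) (t : ℂ) (by norm_num : (0 : ℝ) < 1 / 8) (hlow t ht)
        (by rw [Complex.conj_ofReal]; exact hlow t ht)
      obtain ⟨x, -, hx⟩ := hG (-(e : H))
      exact ⟨x, fun _ => hx⟩
    · exact ⟨0, fun h => absurd h ht⟩
  choose x hx using hex
  have hxn : ∀ t, |t| ≤ 1 / 16 → ‖(x t : H)‖ ≤ 8 := by
    intro t ht
    have := hlow t ht (x t)
    rw [hx t ht, norm_neg, he] at this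
    linarith
  have hlip : ∀ t s, |t| ≤ 1 / 16 → |s| ≤ 1 / 16 →
      ‖((x t : H) - x s)‖ ≤ 64 * |t - s| := by
    intro t s ht hs
    have h1 := hlow t ht (x t - x s)
    have h2 : A (x t - x s) + rankOneOp (-1) (e : H) ((x t - x s : A.domain) : H)
        - (t : ℂ) • ((x t - x s : A.domain) : H) = ((t - s : ℝ) : ℂ) • (x s : H) := by
      have h3 := hx t ht
      have h4 := hx s hs
      rw [LinearPMap.map_sub, Submodule.coe_sub, map_sub]
      have : ((t - s : ℝ) : ℂ) • (x s : H) = -(e : H) - (-(e : H)) + ((t - s : ℝ) : ℂ) • (x s : H) := by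
        abel
      rw [this]
      nth_rewrite 1 [← h3]
      rw [← h4]
      push_cast
      module
    rw [h2, norm_smul, Complex.norm_real, Real.norm_eq_abs, Submodule.coe_sub] at h1
    nlinarith [hxn s hs, abs_nonneg (t - s)]
  set m : ℝ → ℝ := fun t => (⟪(e : H), (x t : H)⟫).re with hm
  have hcont : ContinuousOn m (Icc (-(1 / 16)) (1 / 16)) := by
    have : LipschitzOnWith 64 m (Icc (-(1 / 16)) (1 / 16)) := by
      refine LipschitzOnWith.of_dist_le_mul fun t ht s hs => ?_
      rw [Real.dist_eq, Real.dist_eq, hm]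
      simp only
      rw [← Complex.sub_re, ← inner_sub_right]
      refine (Complex.abs_re_le_norm _).trans ((norm_inner_le_norm _ _).trans ?_)
      rw [he, one_mul]
      exact hlip t s (abs_le.mpr ht) (abs_le.mpr hs)
    exact this.continuousOn
  have heq : ∀ t, |t| ≤ 1 / 16 →
      A (x t) - (t : ℂ) • (x t : H) = (⟪(e : H), (x t : H)⟫ - 1) • (e : H) := by
    intro t ht
    have := hx t ht
    rw [rankOneOp_apply] at this
    rw [sub_smul, one_smul]
    rw [sub_eq_add_neg _ (e : H), ← this]
    push_cast
    module
  have hscal : ∀ t, |t| ≤ 1 / 16 →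
      ⟪A e, (x t : H)⟫ - t * ⟪(e : H), (x t : H)⟫ = ⟪(e : H), (x t : H)⟫ - 1 := by
    intro t ht
    have := congrArg (fun w => ⟪(e : H), w⟫) (heq t ht)
    simp only [inner_sub_right, inner_smul_right, hee, mul_one] at this
    rw [← hsym] at this
    exact this
  -- Testing with `e` gives `(m - 1)(1 + t) + t = O(δ)`, with error at most `8 δ ≤ 1/25 < 1/16`. At
  -- the endpoints `t = ±1/16` this forces `m - 1` to have the sign opposite to `t`.
  have hscal' : ∀ t, |t| ≤ 1 / 16 → |(m t - 1) * (1 + t) + t| ≤ 1 / 25 := by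
    intro t ht
    have h1 := congrArg Complex.re (hscal t ht)
    simp only [Complex.sub_re, Complex.re_ofReal_mul, Complex.one_re] at h1
    have h2 : |(⟪A e, (x t : H)⟫).re| ≤ δ * 8 :=
      (Complex.abs_re_le_norm _).trans ((norm_inner_le_norm _ _).trans
        (mul_le_mul hAe (hxn t ht) (norm_nonneg _) hδ0))
    have h3 : (m t - 1) * (1 + t) + t = (⟪A e, (x t : H)⟫).re := by
      simp only [hm]; linarith
    rw [h3]; linarith
  have h16 : |(1 / 16 : ℝ)| ≤ 1 / 16 := by rw [abs_of_pos (by norm_num)]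
  have h16' : |(-(1 / 16) : ℝ)| ≤ 1 / 16 := by rw [abs_neg]; exact h16
  have hup : m (1 / 16) ≤ 1 := by
    have := (abs_le.mp (hscal' _ h16)).2
    linarith
  have hdn : 1 ≤ m (-(1 / 16)) := by
    have := (abs_le.mp (hscal' _ h16')).1
    linarith
  obtain ⟨t, ht, hmt⟩ := intermediate_value_Icc' (by norm_num) hcont ⟨hup, hdn⟩
  have ht' : |t| ≤ 1 / 16 := abs_le.mpr ht
  -- `m` is only a real part. The imaginary part vanishes because the modified operator is symmetric
  -- and `x t` is a solution with right side `-e`.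
  have hreal : ⟪(e : H), (x t : H)⟫ = 1 := by
    have h1 : ⟪(x t : H), (e : H)⟫ = ⟪(e : H), (x t : H)⟫ := by
      have h2 : ⟪A (x t) + rankOneOp (-1) (e : H) (x t) - (t : ℂ) • (x t : H), (x t : H)⟫
          = ⟪(x t : H), A (x t) + rankOneOp (-1) (e : H) (x t) - (t : ℂ) • (x t : H)⟫ := by
        rw [inner_sub_left, inner_sub_right, inner_add_left, inner_add_right, hsym,
          rankOneOp_symm, inner_smul_left, inner_smul_right, Complex.conj_ofReal]
      rw [hx t ht', inner_neg_left, inner_neg_right, neg_inj] at h2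
      exact h2.symm
    rw [← inner_conj_symm, Complex.conj_eq_iff_im] at h1
    exact Complex.ext hmt (by simpa using h1)
  refine ⟨t, x t, ht', hreal, ?_⟩
  have := heq t ht'
  rw [hreal, sub_self, zero_smul] at this
  exact sub_eq_zero.mp this

/-- Perturbation of a simple isolated top eigenvalue, with a second-order estimate. -/
theorem exists_simple_eigenvalue_near (A : H →ₗ.[ℂ] H)
    (hsym : ∀ x y : A.domain, ⟪A x, (y : H)⟫ = ⟪(x : H), A y⟫) (z₀ : ℝ)
    (hK : IsInvertible (shift A z₀)) (e : A.domain) (he : ‖(e : H)‖ = 1) (δ : ℝ)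
    (hδ : δ ≤ 1 / 200) (hAe : ‖A e‖ ≤ δ)
    (hform : ∀ x : A.domain, (⟪A x, (x : H)⟫).re ≤
      -(1 / 4) * (‖(x : H)‖ ^ 2 - ‖⟪(e : H), (x : H)⟫‖ ^ 2) + δ * ‖(x : H)‖ ^ 2) :
    ∃ ev : ℝ, |ev - (⟪A e, (e : H)⟫).re| ≤ 8 * δ ^ 2 ∧ IsSimpleEigenvalue A (ev : ℂ) ∧
      opSpectrum A ⊆ {z : ℂ | ∃ x : ℝ, x ≤ -(1 / 8) ∧ z = (x : ℂ)} ∪ {(ev : ℂ)} := by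
  have hδ0 : 0 ≤ δ := (norm_nonneg _).trans hAe
  have hee : ⟪(e : H), (e : H)⟫ = 1 := by rw [inner_self_eq_norm_sq_to_K, he]; simp
  obtain ⟨t, φ, ht, heφ, hφ⟩ := exists_eigenvector_near A hsym z₀ hK e he δ hδ hAe hform
  have ht2 := abs_le.mp ht
  have hφ0 : (φ : H) ≠ 0 := by
    intro h
    rw [h, inner_zero_right] at heφ
    exact zero_ne_one heφ
  set ψ : A.domain := φ - e with hψ
  have hψc : (ψ : H) = φ - e := rfl
  have heψ : ⟪(e : H), (ψ : H)⟫ = 0 := by rw [hψc, inner_sub_right, heφ, hee, sub_self]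
  -- The correction `ψ` is orthogonal to `e`, where the form is coercive, and its equation has
  -- source `A e - t e`. The component along `e` drops out, so `ψ` has the size of `A e`.
  have hψn : ‖(ψ : H)‖ ≤ 8 * δ := by
    have h1 := hform ψ
    have h2 : A ψ = (t : ℂ) • (ψ : H) - (A e - (t : ℂ) • (e : H)) := by
      rw [hψ, LinearPMap.map_sub, hφ, Submodule.coe_sub]; module
    have h3 : (⟪A ψ, (ψ : H)⟫).re = t * ‖(ψ : H)‖ ^ 2 - (⟪A e, (ψ : H)⟫).re := by
      rw [h2, inner_sub_left, inner_sub_left, Complex.sub_re, re_inner_ofReal_smul_self,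
        inner_smul_left, heψ, mul_zero, sub_zero]
    have h4 : (⟪A e, (ψ : H)⟫).re ≤ δ * ‖(ψ : H)‖ :=
      (Complex.re_le_norm _).trans ((norm_inner_le_norm _ _).trans (by gcongr))
    rw [h3, heψ, norm_zero] at h1
    rcases (norm_nonneg (ψ : H)).eq_or_lt with h0 | h0
    · rw [← h0]; positivity
    · nlinarith
  -- For `x ⊥ φ` the component `⟨e, x⟩` equals `-⟨ψ, x⟩`, a fraction at most `8 δ ≤ 1/25` of `‖x‖`.
  have hgap : ∀ x : A.domain, ⟪(φ : H), (x : H)⟫ = 0 →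
      (⟪A x, (x : H)⟫).re ≤ -(1 / 8) * ‖(x : H)‖ ^ 2 := by
    intro x hx
    have h1 := hform x
    have h2 : ⟪(e : H), (x : H)⟫ = -⟪(ψ : H), (x : H)⟫ := by
      rw [hψc, inner_sub_left, hx]; ring
    have h3 : ‖⟪(e : H), (x : H)⟫‖ ≤ 1 / 25 * ‖(x : H)‖ := by
      rw [h2, norm_neg]
      refine (norm_inner_le_norm _ _).trans ?_
      gcongr
      linarith
    have h4 := pow_le_pow_left₀ (norm_nonneg _) h3 2
    nlinarith [sq_nonneg ‖(x : H)‖]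
  refine ⟨t, ?_, isSimpleEigenvalue_of_gap A hsym z₀ hK φ hφ0 t (1 / 8) hφ (by linarith) hgap,
    opSpectrum_subset_of_gap A hsym z₀ hK φ hφ0 t (1 / 8) hφ hgap⟩
  -- `t = ⟨e, A φ⟩ = ⟨A e, e⟩ + ⟨A e, ψ⟩`. Both entries of the last term are `O(δ)`, whence the
  -- second-order error.
  have h1 : (t : ℂ) = ⟪A e, (e : H)⟫ + ⟪A e, (ψ : H)⟫ := by
    rw [← inner_add_right, hψc, add_sub_cancel, hsym, hφ, inner_smul_right, heφ, mul_one]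
  have h2 := congrArg Complex.re h1
  rw [Complex.ofReal_re, Complex.add_re] at h2
  rw [h2, add_sub_cancel_left]
  refine (Complex.abs_re_le_norm _).trans ((norm_inner_le_norm _ _).trans ?_)
  calc ‖A e‖ * ‖(ψ : H)‖ ≤ δ * (8 * δ) := by gcongr
    _ = _ := by ring

end EigenvaluePerturbation

open scoped FourierTransform Laplacian
open TemperedDistribution

/-! ### Bounded multiplication operators on `L²` -/

section MulCLM

/-- Multiplication by an essentially bounded function on `L²(ℝ)`. -/
noncomputable def mulCLM {g : ℝ → ℂ} (hg : MemLp g ∞ volume) : L2 →L[ℂ] L2 :=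
  LinearMap.mkContinuous
    { toFun := fun f => ((hg.toLp g) • f : L2)
      map_add' := fun f₁ f₂ => Lp.add_smul _ _ _
      map_smul' := fun c f => by
        apply Lp.ext
        rw [RingHom.id_apply]
        filter_upwards [Lp.coeFn_lpSMul (r := 2) (hg.toLp g) (c • f),
          Lp.coeFn_lpSMul (r := 2) (hg.toLp g) f, Lp.coeFn_smul c f,
          Lp.coeFn_smul c ((hg.toLp g) • f : L2)] with x h1 h2 h3 h4
        rw [h1, h4, Pi.smul_apply, h2, Pi.smul_apply', Pi.smul_apply', h3, Pi.smul_apply,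
          smul_comm] }
    ‖hg.toLp g‖ (fun f => Lp.norm_smul_le _ _)

theorem coeFn_mulCLM {g : ℝ → ℂ} (hg : MemLp g ∞ volume) (f : L2) :
    mulCLM hg f =ᵐ[volume] fun x => g x * f x := by
  have h0 : mulCLM hg f = ((hg.toLp g) • f : L2) := rfl
  rw [h0]
  filter_upwards [Lp.coeFn_lpSMul (r := 2) (hg.toLp g) f, hg.coeFn_toLp] with x h1 h2
  rw [h1, Pi.smul_apply', h2, smul_eq_mul]

theorem norm_mulCLM_apply_le {g : ℝ → ℂ} (hg : MemLp g ∞ volume) {M : ℝ}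
    (hM : ∀ x, ‖g x‖ ≤ M) (f : L2) : ‖mulCLM hg f‖ ≤ M * ‖f‖ := by
  refine Lp.norm_le_mul_norm_of_ae_le_mul ?_
  filter_upwards [coeFn_mulCLM hg f] with x hx
  rw [hx, norm_mul]
  exact mul_le_mul_of_nonneg_right (hM x) (norm_nonneg _)

theorem mulCLM_symm {q : ℝ → ℝ} (hq : MemLp (fun x => (q x : ℂ)) ∞ volume) (f g : L2) :
    inner ℂ (mulCLM hq f) g = inner ℂ f (mulCLM hq g) := by
  rw [L2.inner_def, L2.inner_def]
  refine integral_congr_ae ?_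
  filter_upwards [coeFn_mulCLM hq f, coeFn_mulCLM hq g] with x h1 h2
  rw [h1, h2]
  simp only [RCLike.inner_apply, map_mul, Complex.conj_ofReal]
  ring

end MulCLM

/-! ### `H²` and the resolvent of the second derivative -/

section BesselPotential

theorem laplacian_eq_lineDeriv (f : 𝓢'(ℝ, ℂ)) : Δ f = ∂_{(1 : ℝ)} (∂_{(1 : ℝ)} f) := by
  rw [TemperedDistribution.laplacian_eq_sum (OrthonormalBasis.singleton (Fin 1) ℝ)]
  simp

/-- The Fourier transform is normalized with `exp(2πixξ)`, so `1 + |ξ|²` is the symbol of `1 -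
(2π)⁻² ∂²`. This is the origin of `fourPiSq`. -/
theorem besselPotential_two_eq (f : 𝓢'(ℝ, ℂ)) :
    besselPotential ℝ ℂ 2 f =
      f - ((2 * Real.pi) ^ 2 : ℝ)⁻¹ • ∂_{(1 : ℝ)} (∂_{(1 : ℝ)} f) := by
  rw [← laplacian_eq_lineDeriv, laplacian_eq_fourierMultiplierCLM, neg_smul, smul_neg,
    inv_smul_smul₀ (by positivity), sub_neg_eq_add]
  have h : (fun x : ℝ => (((1 + ‖x‖ ^ 2) ^ ((2 : ℝ) / 2) : ℝ) : ℂ))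
      = (fun _ : ℝ => (1 : ℂ)) + (fun x : ℝ => ((‖x‖ ^ 2 : ℝ) : ℂ)) := by
    ext x; simp
  rw [besselPotential, h, fourierMultiplierCLM_apply, fourierMultiplierCLM_apply,
    smulLeftCLM_add (by fun_prop) (by fun_prop), _root_.add_apply, smulLeftCLM_const, one_smul,
    FourierTransform.fourierInv_add, FourierTransform.fourierInv_fourier_eq]

theorem coe_sub_L2 (f g : L2) : ((f - g : L2) : 𝓢'(ℝ, ℂ)) = (f : 𝓢'(ℝ, ℂ)) - g := by
  simp only [← Lp.toTemperedDistributionCLM_apply, map_sub]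

theorem coe_smul_L2 (c : ℂ) (f : L2) : ((c • f : L2) : 𝓢'(ℝ, ℂ)) = c • (f : 𝓢'(ℝ, ℂ)) := by
  simp only [← Lp.toTemperedDistributionCLM_apply, map_smul]

theorem secondDeriv_spec (f : H2) :
    ((secondDeriv f : L2) : 𝓢'(ℝ, ℂ)) = ∂_{(1 : ℝ)} (∂_{(1 : ℝ)} ((f : L2) : 𝓢'(ℝ, ℂ))) :=
  (exists_secondDeriv f).choose_spec

/-- The constant `(2π)²`. -/
noncomputable def fourPiSq : ℝ := (2 * Real.pi) ^ 2

theorem fourPiSq_pos : 0 < fourPiSq := by unfold fourPiSq; positivity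

/-- By the formula for the Bessel potential, membership asks only that `f - (2π)⁻² f''` be square
integrable; the first derivative need not be controlled. -/
theorem mem_H2_of_lineDeriv {f g : L2}
    (h : (g : 𝓢'(ℝ, ℂ)) = ∂_{(1 : ℝ)} (∂_{(1 : ℝ)} (f : 𝓢'(ℝ, ℂ)))) : f ∈ H2 := by
  refine ⟨f - ((fourPiSq⁻¹ : ℝ) : ℂ) • g, ?_⟩
  rw [besselPotential_two_eq, coe_sub_L2, coe_smul_L2, h, Complex.coe_smul]
  rfl

theorem secondDeriv_eq {f : H2} {g : L2}
    (h : (g : 𝓢'(ℝ, ℂ)) = ∂_{(1 : ℝ)} (∂_{(1 : ℝ)} ((f : L2) : 𝓢'(ℝ, ℂ)))) :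
    secondDeriv f = g := by
  apply toTemperedDistribution_injective
  rw [secondDeriv_spec, h]

/-- The symbol of `(1 - (2π)⁻² ∂²)⁻¹`. -/
noncomputable def resolventSymbol (x : ℝ) : ℂ := (((1 + ‖x‖ ^ 2) ^ ((-2 : ℝ) / 2) : ℝ) : ℂ)

theorem resolventSymbol_hasTemperateGrowth : resolventSymbol.HasTemperateGrowth := by
  unfold resolventSymbol
  fun_prop

theorem norm_resolventSymbol_le (x : ℝ) : ‖resolventSymbol x‖ ≤ 1 := by
  unfold resolventSymbol
  rw [Complex.norm_real, Real.norm_eq_abs, abs_of_nonneg (by positivity)]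
  exact Real.rpow_le_one_of_one_le_of_nonpos (by simp; positivity) (by norm_num)

theorem memLp_resolventSymbol : MemLp resolventSymbol ∞ volume :=
  memLp_top_of_bound resolventSymbol_hasTemperateGrowth.1.continuous.aestronglyMeasurable 1
    (Eventually.of_forall norm_resolventSymbol_le)

/-- The operator `(1 - (2π)⁻² ∂²)⁻¹` on `L²(ℝ)`. -/
noncomputable def resolventL2 : L2 →L[ℂ] L2 :=
  ((Lp.fourierTransformₗᵢ ℝ ℂ).symm.toContinuousLinearEquiv : L2 →L[ℂ] L2) ∘L
    mulCLM memLp_resolventSymbol ∘L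
      ((Lp.fourierTransformₗᵢ ℝ ℂ).toContinuousLinearEquiv : L2 →L[ℂ] L2)

theorem coe_resolventL2 (f : L2) :
    ((resolventL2 f : L2) : 𝓢'(ℝ, ℂ)) = besselPotential ℝ ℂ (-2) (f : 𝓢'(ℝ, ℂ)) := by
  have h0 : resolventL2 f = 𝓕⁻ ((memLp_resolventSymbol.toLp _) • (𝓕 f) : L2) := rfl
  rw [h0, ← Lp.fourierInv_toTemperedDistribution_eq,
    Lp.toTemperedDistribution_smul_eq resolventSymbol_hasTemperateGrowth,
    ← Lp.fourier_toTemperedDistribution_eq]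
  rfl

theorem besselPotential_two_resolventL2 (f : L2) :
    besselPotential ℝ ℂ 2 ((resolventL2 f : L2) : 𝓢'(ℝ, ℂ)) = f := by
  rw [coe_resolventL2]
  exact (besselPotential_neg_apply_eq_iff 2 _ _).mp rfl

theorem resolventL2_mem (f : L2) : resolventL2 f ∈ H2 :=
  ⟨f, besselPotential_two_resolventL2 f⟩

theorem secondDeriv_of_bessel {f : H2} {y : L2}
    (h : besselPotential ℝ ℂ 2 ((f : L2) : 𝓢'(ℝ, ℂ)) = y) :
    secondDeriv f = (fourPiSq : ℂ) • ((f : L2) - y) := by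
  apply toTemperedDistribution_injective
  rw [besselPotential_two_eq] at h
  rw [secondDeriv_spec, coe_smul_L2, coe_sub_L2, ← h, sub_sub_cancel, Complex.coe_smul]
  exact (smul_inv_smul₀ fourPiSq_pos.ne' _).symm

theorem secondDeriv_resolventL2 (f : L2) :
    secondDeriv (⟨resolventL2 f, resolventL2_mem f⟩ : H2) = (fourPiSq : ℂ) • (resolventL2 f - f) :=
  secondDeriv_of_bessel (f := ⟨resolventL2 f, resolventL2_mem f⟩)
    (besselPotential_two_resolventL2 f)

/-- `H²` is the range of the resolvent, with `∂²` explicit in the parameter `y`. Density statements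
in `L²` thereby pass to the graph of `∂²`. -/
theorem exists_eq_resolventL2 (x : H2) : ∃ y : L2, (x : L2) = resolventL2 y ∧
    secondDeriv x = (fourPiSq : ℂ) • (resolventL2 y - y) := by
  obtain ⟨y, hy⟩ : TemperedDistribution.MemSobolev 2 2 ((x : L2) : 𝓢'(ℝ, ℂ)) := x.2
  have hx : (x : L2) = resolventL2 y := by
    apply toTemperedDistribution_injective
    rw [coe_resolventL2, ← hy, besselPotential_besselPotential_apply]
    simp
  exact ⟨y, hx, by rw [← hx]; exact secondDeriv_of_bessel hy⟩

/-- One real point in the resolvent set, together with symmetry, is the form in which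
self-adjointness enters the abstract lemmas. -/
theorem isInvertible_shift_secondDeriv : IsInvertible (shift secondDeriv (fourPiSq : ℝ)) := by
  have hne : (fourPiSq : ℂ) ≠ 0 := by exact_mod_cast fourPiSq_pos.ne'
  rw [isInvertible_shift_iff]
  refine ⟨(-(fourPiSq : ℂ)⁻¹) • resolventL2, fun y => ?_, fun x => ?_⟩
  · refine ⟨(⟨resolventL2 ((-(fourPiSq : ℂ)⁻¹) • y), resolventL2_mem _⟩ : H2), ?_, ?_⟩
    · exact map_smul resolventL2 _ _
    · rw [secondDeriv_resolventL2]
      simp only [smul_sub, smul_smul]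
      rw [mul_neg, mul_inv_cancel₀ hne]
      module
  · obtain ⟨y, hy, hy'⟩ := exists_eq_resolventL2 x
    have : secondDeriv x - (fourPiSq : ℂ) • (x : L2) = -(fourPiSq : ℂ) • y := by
      rw [hy', hy]; module
    rw [this, hy, _root_.smul_apply, map_smul, smul_smul, neg_mul_neg,
      inv_mul_cancel₀ hne, one_smul]

end BesselPotential

/-! ### Schwartz functions as a core, and symmetry of the second derivative -/

section Schwartz

theorem lineDeriv_schwartz (f : 𝓢(ℝ, ℂ)) : ∂_{(1 : ℝ)} f = SchwartzMap.derivCLM ℂ ℂ f := by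
  ext x
  rw [SchwartzMap.lineDerivOp_apply_eq_fderiv, SchwartzMap.derivCLM_apply, fderiv_apply_one_eq_deriv]

theorem coe_derivCLM_derivCLM (f : 𝓢(ℝ, ℂ)) :
    (((SchwartzMap.derivCLM ℂ ℂ (SchwartzMap.derivCLM ℂ ℂ f)).toLp 2 : L2) : 𝓢'(ℝ, ℂ)) =
      ∂_{(1 : ℝ)} (∂_{(1 : ℝ)} ((f.toLp 2 : L2) : 𝓢'(ℝ, ℂ))) := by
  rw [Lp.toTemperedDistribution_toLp_eq, Lp.toTemperedDistribution_toLp_eq,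
    lineDerivOp_toTemperedDistributionCLM_eq, lineDerivOp_toTemperedDistributionCLM_eq,
    lineDeriv_schwartz, lineDeriv_schwartz]

theorem toLp_schwartz_mem_H2 (f : 𝓢(ℝ, ℂ)) : (f.toLp 2 : L2) ∈ H2 :=
  mem_H2_of_lineDeriv (coe_derivCLM_derivCLM f)

/-- A Schwartz function as an element of `H²(ℝ)`. -/
noncomputable def schwartzH2 (f : 𝓢(ℝ, ℂ)) : H2 := ⟨_, toLp_schwartz_mem_H2 f⟩

theorem coe_schwartzH2 (f : 𝓢(ℝ, ℂ)) : (schwartzH2 f : L2) = f.toLp 2 := rfl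

theorem secondDeriv_schwartz (f : 𝓢(ℝ, ℂ)) : secondDeriv (schwartzH2 f) =
      (SchwartzMap.derivCLM ℂ ℂ (SchwartzMap.derivCLM ℂ ℂ f)).toLp 2 := by
  apply secondDeriv_eq
  rw [coe_derivCLM_derivCLM, coe_schwartzH2]

/-- The resolvent preserves Schwartz functions since its symbol has temperate growth. With density
in `L²` this makes them a core for `∂²`. -/
theorem resolventL2_schwartz (f : 𝓢(ℝ, ℂ)) :
    resolventL2 (f.toLp 2) = (SchwartzMap.fourierMultiplierCLM ℂ resolventSymbol f).toLp 2 := by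
  apply toTemperedDistribution_injective
  rw [coe_resolventL2, Lp.toTemperedDistribution_toLp_eq, Lp.toTemperedDistribution_toLp_eq,
    ← fourierMultiplierCLM_toTemperedDistributionCLM_eq resolventSymbol_hasTemperateGrowth]
  rfl

/-- A closed property of pairs `(x, ∂²x)` that holds for Schwartz functions holds on `H²(ℝ)`. -/
theorem H2_induction {p : L2 → L2 → Prop} (hp : IsClosed {z : L2 × L2 | p z.1 z.2})
    (hs : ∀ f : 𝓢(ℝ, ℂ), p (f.toLp 2)
      ((SchwartzMap.derivCLM ℂ ℂ (SchwartzMap.derivCLM ℂ ℂ f)).toLp 2)) (x : H2) :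
    p x (secondDeriv x) := by
  obtain ⟨y, hy, hy'⟩ := exists_eq_resolventL2 x
  rw [hy, hy']
  have hd : DenseRange (SchwartzMap.toLpCLM ℝ ℂ 2 (volume : Measure ℝ)) :=
    SchwartzMap.denseRange_toLpCLM ENNReal.ofNat_ne_top
  -- The point `(x, ∂²x)` of the graph depends continuously on `y ∈ L²`, so it is enough to treat
  -- Schwartz `y`.
  refine hd.induction_on (p := fun y => p (resolventL2 y)
    ((fourPiSq : ℂ) • (resolventL2 y - y))) y ?_ ?_
  · exact hp.preimage (f := fun y : L2 => (resolventL2 y, (fourPiSq : ℂ) • (resolventL2 y - y)))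
      (by fun_prop)
  · intro f
    rw [SchwartzMap.toLpCLM_apply]
    have h1 := hs (SchwartzMap.fourierMultiplierCLM ℂ resolventSymbol f)
    rw [← secondDeriv_schwartz, ← coe_schwartzH2] at h1
    have h3 : schwartzH2 (SchwartzMap.fourierMultiplierCLM ℂ resolventSymbol f) =
        ⟨resolventL2 (f.toLp 2), resolventL2_mem _⟩ :=
      Subtype.ext (resolventL2_schwartz f).symm
    rw [h3, secondDeriv_resolventL2] at h1
    exact h1

theorem inner_toLp_schwartz (f g : 𝓢(ℝ, ℂ)) :
    inner ℂ (f.toLp 2 : L2) (g.toLp 2) = ∫ x, g x * (starRingEnd ℂ) (f x) := by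
  rw [L2.inner_def]
  refine integral_congr_ae ?_
  filter_upwards [f.coeFn_toLp 2 volume, g.coeFn_toLp 2 volume] with x h1 h2
  rw [h1, h2, RCLike.inner_apply]

theorem secondDeriv_symm (x y : H2) :
    inner ℂ (secondDeriv x) (y : L2) = inner ℂ (x : L2) (secondDeriv y) := by
  refine H2_induction (p := fun a b => inner ℂ b (y : L2) = inner ℂ a (secondDeriv y)) ?_ ?_ x
  · exact isClosed_eq (by fun_prop) (by fun_prop)
  intro f
  refine H2_induction (p := fun a b => inner ℂ _ a = inner ℂ _ b) ?_ ?_ y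
  · exact isClosed_eq (by fun_prop) (by fun_prop)
  intro g
  rw [inner_toLp_schwartz, inner_toLp_schwartz]
  -- Conjugation is only real-linear, so integration by parts is applied to the real-bilinear map
  -- `(a, b) ↦ a * conj b`.
  have hi := SchwartzMap.integral_bilinear_deriv_right_eq_neg_left (V := ℂ) (E := ℂ) (F := ℂ)
    (L := (ContinuousLinearMap.mul ℝ ℂ).bilinearComp (ContinuousLinearMap.id ℝ ℂ)
      (Complex.conjCLE : ℂ →L[ℝ] ℂ))
  simp only [ContinuousLinearMap.bilinearComp_apply, ContinuousLinearMap.mul_apply',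
    ContinuousLinearMap.id_apply] at hi
  have h1 := hi g (SchwartzMap.derivCLM ℂ ℂ f)
  have h2 := hi (SchwartzMap.derivCLM ℂ ℂ g) f
  simp only [SchwartzMap.derivCLM_apply] at h1 h2 ⊢
  refine h1.trans ?_
  refine Eq.trans (neg_eq_iff_eq_neg.mpr ?_) rfl
  exact h2

end Schwartz

/-! ### Classical derivatives and membership in `H²` -/

section ClassicalCriterion

/-- Two integrations by parts against a Schwartz function. Boundedness of `f'` is enough, because
`f'` occurs only multiplied by a Schwartz function. -/
theorem coe_toLp_of_hasDerivAt {f f' f'' : ℝ → ℂ} (hf : ∀ x, HasDerivAt f (f' x) x)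
    (hf' : ∀ x, HasDerivAt f' (f'' x) x) (h2 : MemLp f 2 volume) (h2'' : MemLp f'' 2 volume)
    {M : ℝ} (hM : ∀ x, ‖f' x‖ ≤ M) :
    ((h2''.toLp f'' : L2) : 𝓢'(ℝ, ℂ)) =
      ∂_{(1 : ℝ)} (∂_{(1 : ℝ)} ((h2.toLp f : L2) : 𝓢'(ℝ, ℂ))) := by
  have hcf' : Continuous f' := continuous_iff_continuousAt.mpr fun x => (hf' x).continuousAt
  ext g
  rw [TemperedDistribution.lineDerivOp_apply_apply, TemperedDistribution.lineDerivOp_apply_apply]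
  simp only [neg_neg, LineDeriv.lineDerivOp_neg]
  rw [Lp.toTemperedDistribution_apply, Lp.toTemperedDistribution_apply, lineDeriv_schwartz,
    lineDeriv_schwartz]
  have e1 : ∫ x, g x • (h2''.toLp f'' : L2) x = ∫ x, g x * f'' x := by
    refine integral_congr_ae ?_
    filter_upwards [h2''.coeFn_toLp] with x hx
    rw [hx, smul_eq_mul]
  have e2 : ∫ x, (SchwartzMap.derivCLM ℂ ℂ (SchwartzMap.derivCLM ℂ ℂ g)) x • (h2.toLp f : L2) x
      = ∫ x, f x * (SchwartzMap.derivCLM ℂ ℂ (SchwartzMap.derivCLM ℂ ℂ g)) x := by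
    refine integral_congr_ae ?_
    filter_upwards [h2.coeFn_toLp] with x hx
    rw [hx, smul_eq_mul, mul_comm]
  rw [e1, e2]
  have hb : ∀ h : 𝓢(ℝ, ℂ), Integrable (f' * (h : ℝ → ℂ)) := fun h =>
    h.integrable.bdd_mul (c := M) hcf'.aestronglyMeasurable (Eventually.of_forall hM)
  have hb2 : ∀ {k : ℝ → ℂ} (hk : MemLp k 2 volume) (h : 𝓢(ℝ, ℂ)), Integrable (k * (h : ℝ → ℂ)) :=
    fun hk h => hk.integrable_mul (h.memLp 2)
  have i1 := integral_mul_deriv_eq_deriv_mul_of_integrable (u := f)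
    (v := SchwartzMap.derivCLM ℂ ℂ g) (u' := f')
    (v' := SchwartzMap.derivCLM ℂ ℂ (SchwartzMap.derivCLM ℂ ℂ g))
    (fun x _ => hf x) (fun x _ => (SchwartzMap.derivCLM ℂ ℂ g).hasDerivAt x)
    (hb2 h2 _) (hb _) (hb2 h2 _)
  have i2 := integral_mul_deriv_eq_deriv_mul_of_integrable (u := f')
    (v := g) (u' := f'') (v' := SchwartzMap.derivCLM ℂ ℂ g)
    (fun x _ => hf' x) (fun x _ => g.hasDerivAt x)
    (hb _) (hb2 h2'' _) (hb _)
  rw [i1, i2, neg_neg]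
  exact integral_congr_ae (Eventually.of_forall fun x => mul_comm _ _)

theorem toLp_mem_H2_of_hasDerivAt {f f' f'' : ℝ → ℂ} (hf : ∀ x, HasDerivAt f (f' x) x)
    (hf' : ∀ x, HasDerivAt f' (f'' x) x) (h2 : MemLp f 2 volume) (h2'' : MemLp f'' 2 volume)
    {M : ℝ} (hM : ∀ x, ‖f' x‖ ≤ M) : h2.toLp f ∈ H2 :=
  mem_H2_of_lineDeriv (coe_toLp_of_hasDerivAt hf hf' h2 h2'' hM)

theorem secondDeriv_toLp_of_hasDerivAt {f f' f'' : ℝ → ℂ} (hf : ∀ x, HasDerivAt f (f' x) x)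
    (hf' : ∀ x, HasDerivAt f' (f'' x) x) (h2 : MemLp f 2 volume) (h2'' : MemLp f'' 2 volume)
    {M : ℝ} (hM : ∀ x, ‖f' x‖ ≤ M) :
    secondDeriv (⟨h2.toLp f, toLp_mem_H2_of_hasDerivAt hf hf' h2 h2'' hM⟩ : H2) =
      h2''.toLp f'' :=
  secondDeriv_eq (f := ⟨h2.toLp f, toLp_mem_H2_of_hasDerivAt hf hf' h2 h2'' hM⟩)
    (coe_toLp_of_hasDerivAt hf hf' h2 h2'' hM)

end ClassicalCriterion

open scoped Topology

/-! ### The functions `sech` and `tanh` -/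

section Sech

/-- The hyperbolic secant. -/
noncomputable def sech (x : ℝ) : ℝ := (Real.cosh x)⁻¹

theorem sech_pos (x : ℝ) : 0 < sech x := inv_pos.mpr (Real.cosh_pos x)

theorem sech_le_one (x : ℝ) : sech x ≤ 1 := inv_le_one_of_one_le₀ (Real.one_le_cosh x)

theorem sech_neg (x : ℝ) : sech (-x) = sech x := by rw [sech, Real.cosh_neg, sech]

theorem sech_mul_cosh (x : ℝ) : sech x * Real.cosh x = 1 :=
  inv_mul_cancel₀ (Real.cosh_pos x).ne'

theorem tanh_sq (x : ℝ) : Real.tanh x ^ 2 = 1 - sech x ^ 2 := by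
  have h := Real.cosh_sq x
  have hc := (Real.cosh_pos x).ne'
  rw [Real.tanh_eq_sinh_div_cosh, sech]
  field_simp
  linarith

theorem abs_tanh_le_one (x : ℝ) : |Real.tanh x| ≤ 1 := by
  rw [← sq_le_one_iff_abs_le_one, tanh_sq]
  nlinarith [sech_pos x]

theorem hasDerivAt_sech (x : ℝ) : HasDerivAt sech (-(Real.tanh x * sech x)) x := by
  have h := (Real.hasDerivAt_cosh x).inv (Real.cosh_pos x).ne'
  refine h.congr_deriv ?_
  rw [Real.tanh_eq_sinh_div_cosh, sech]
  field_simp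

theorem hasDerivAt_tanh (x : ℝ) : HasDerivAt Real.tanh (sech x ^ 2) x := by
  have h := (Real.hasDerivAt_sinh x).div (Real.hasDerivAt_cosh x) (Real.cosh_pos x).ne'
  have h2 : (Real.sinh / Real.cosh) = Real.tanh := by
    ext y; exact (Real.tanh_eq_sinh_div_cosh y).symm
  rw [h2] at h
  refine h.congr_deriv ?_
  have h3 := Real.cosh_sq x
  rw [sech, inv_pow, div_eq_iff (by positivity), inv_mul_cancel₀ (by positivity)]
  nlinarith

theorem continuous_sech : Continuous sech :=
  continuous_iff_continuousAt.mpr fun x => (hasDerivAt_sech x).continuousAt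

theorem continuous_tanh : Continuous Real.tanh :=
  continuous_iff_continuousAt.mpr fun x => (hasDerivAt_tanh x).continuousAt

theorem sech_le_two_exp_neg (x : ℝ) : sech x ≤ 2 * Real.exp (-x) := by
  rw [sech, inv_le_iff_one_le_mul₀ (Real.cosh_pos x), Real.cosh_eq]
  have h : Real.exp x * Real.exp (-x) = 1 := by rw [← Real.exp_add]; simp
  nlinarith [Real.exp_pos (-x)]

theorem sech_le_two_exp (x : ℝ) : sech x ≤ 2 * Real.exp x := by
  have := sech_le_two_exp_neg (-x)
  rwa [sech_neg, neg_neg] at this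

theorem integrable_sech : Integrable sech := by
  rw [← integrableOn_univ, ← Set.Iic_union_Ioi (a := (0 : ℝ))]
  refine IntegrableOn.union ?_ ?_
  · refine Integrable.mono' ((integrableOn_exp_Iic 0).const_mul 2)
      continuous_sech.aestronglyMeasurable (Eventually.of_forall fun x => ?_)
    rw [Real.norm_eq_abs, abs_of_pos (sech_pos x)]
    exact sech_le_two_exp x
  · refine Integrable.mono' ((integrableOn_exp_neg_Ioi 0).const_mul 2)
      continuous_sech.aestronglyMeasurable (Eventually.of_forall fun x => ?_)
    rw [Real.norm_eq_abs, abs_of_pos (sech_pos x)]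
    exact sech_le_two_exp_neg x

theorem integrable_sech_mul {f : ℝ → ℝ} (hf : Continuous f) {M : ℝ} (hM : ∀ x, |f x| ≤ M) :
    Integrable fun x => f x * sech x :=
  integrable_sech.bdd_mul hf.aestronglyMeasurable (Eventually.of_forall hM)

theorem abs_sech_le_one (x : ℝ) : |sech x| ≤ 1 := by
  rw [abs_of_pos (sech_pos x)]; exact sech_le_one x

theorem integrable_sech_sq : Integrable fun x => sech x ^ 2 := by
  simpa only [sq] using integrable_sech_mul continuous_sech abs_sech_le_one

theorem tendsto_sech_atTop : Tendsto sech atTop (𝓝 0) := by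
  refine squeeze_zero (fun x => (sech_pos x).le) sech_le_two_exp_neg ?_
  simpa using (Real.tendsto_exp_neg_atTop_nhds_zero).const_mul 2

theorem tendsto_sech_atBot : Tendsto sech atBot (𝓝 0) := by
  refine squeeze_zero (fun x => (sech_pos x).le) sech_le_two_exp ?_
  simpa using (Real.tendsto_exp_atBot).const_mul 2

theorem tendsto_tanh_atTop : Tendsto Real.tanh atTop (𝓝 1) := by
  have h : ∀ x, 1 - Real.tanh x = Real.exp (-x) * sech x := by
    intro x
    rw [Real.tanh_eq_sinh_div_cosh, sech, ← Real.cosh_sub_sinh]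
    have := (Real.cosh_pos x).ne'
    field_simp
  have h2 : Tendsto (fun x => 1 - Real.exp (-x) * sech x) atTop (𝓝 (1 - 0 * 0)) :=
    tendsto_const_nhds.sub (Real.tendsto_exp_neg_atTop_nhds_zero.mul tendsto_sech_atTop)
  rw [mul_zero, sub_zero] at h2
  refine h2.congr fun x => ?_
  rw [← h]; ring

theorem tendsto_tanh_atBot : Tendsto Real.tanh atBot (𝓝 (-1)) := by
  have h := (tendsto_tanh_atTop.comp tendsto_neg_atBot_atTop).neg
  refine h.congr fun x => ?_
  simp [Real.tanh_neg]

theorem integral_sech_sq : ∫ x, sech x ^ 2 = 2 := by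
  rw [integral_of_hasDerivAt_of_tendsto hasDerivAt_tanh integrable_sech_sq tendsto_tanh_atBot
    tendsto_tanh_atTop]
  norm_num

end Sech

/-! ### The unperturbed front -/

section Kink

variable {k l : ℤ}

theorem cosh_sign_mul (hl : l = 1 ∨ l = -1) (x : ℝ) : Real.cosh (l * x) = Real.cosh x := by
  rcases hl with rfl | rfl <;> simp

theorem tanh_sign_mul (hl : l = 1 ∨ l = -1) (x : ℝ) : Real.tanh (l * x) = l * Real.tanh x := by
  rcases hl with rfl | rfl <;> simp [Real.tanh_neg]

theorem sign_mul_self (hl : l = 1 ∨ l = -1) : (l : ℝ) * l = 1 := by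
  rcases hl with rfl | rfl <;> simp

theorem abs_sign (hl : l = 1 ∨ l = -1) : |(l : ℝ)| = 1 := by
  rcases hl with rfl | rfl <;> simp

/-- With `t = exp y`, this identity and the next are the double-angle formulas `sin (2 arctan t) =
sech y` and `cos (2 arctan t) = -tanh y`. -/
theorem exp_mul_sech (y : ℝ) : 2 * Real.exp y = sech y * (1 + Real.exp y ^ 2) := by
  have h : Real.exp y * Real.exp (-y) = 1 := by rw [← Real.exp_add]; simp
  have hc := (Real.cosh_pos y).ne'
  rw [sech, eq_comm, inv_mul_eq_iff_eq_mul₀ hc, Real.cosh_eq]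
  nlinarith

theorem exp_mul_tanh (y : ℝ) : Real.exp y ^ 2 - 1 = Real.tanh y * (1 + Real.exp y ^ 2) := by
  have h : Real.exp y * Real.exp (-y) = 1 := by rw [← Real.exp_add]; simp
  have hc : Real.exp y + Real.exp (-y) ≠ 0 := by positivity
  rw [Real.tanh_eq, div_mul_eq_mul_div, eq_div_iff hc]
  linear_combination 2 * Real.exp y * h

theorem sech_sign_mul (hl : l = 1 ∨ l = -1) (x : ℝ) : sech (l * x) = sech x := by
  rw [sech, cosh_sign_mul hl, sech]

theorem hasDerivAt_kink (hl : l = 1 ∨ l = -1) (x : ℝ) :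
    HasDerivAt (kink k l) (2 * l * sech x) x := by
  have h1 : HasDerivAt (fun x : ℝ => Real.exp (l * x)) (Real.exp (l * x) * l) x := by
    simpa using ((hasDerivAt_id x).const_mul (l : ℝ)).exp
  have h2 := (h1.arctan.const_mul 4).add_const (2 * Real.pi * ((min k (k + l) : ℤ) : ℝ))
  refine h2.congr_deriv ?_
  have h3 := exp_mul_sech (l * x)
  rw [sech_sign_mul hl] at h3
  have h4 : (1 + Real.exp (l * x) ^ 2) ≠ 0 := by positivity
  field_simp
  linear_combination 2 * (l : ℝ) * h3

/-- Modulo `2π` the front is `4θ` with `θ = arctan (exp (l x))`, so the angle is doubled twice. The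
first part gives the potential `-cos q = 2 sech² - 1` of the linearization; the second is `q'' = sin
q` in disguise. -/
theorem cos_kink (hl : l = 1 ∨ l = -1) (x : ℝ) :
    Real.cos (kink k l x) = 1 - 2 * sech x ^ 2 ∧
      Real.sin (kink k l x) = -(2 * l * (Real.tanh x * sech x)) := by
  set t := Real.exp (l * x) with ht
  set θ := Real.arctan t with hθ
  have h0 : (1 + t ^ 2) ≠ 0 := by positivity
  have hk : kink k l x = 2 * (2 * θ) + ((min k (k + l) : ℤ) : ℝ) * (2 * Real.pi) := by
    rw [kink, hθ, ht]; ring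
  have hs : Real.sin (2 * θ) = sech x := by
    have h3 := exp_mul_sech (l * x)
    rw [sech_sign_mul hl, ← ht] at h3
    have hsq : √(1 + t ^ 2) * √(1 + t ^ 2) = 1 + t ^ 2 := Real.mul_self_sqrt (by positivity)
    rw [Real.sin_two_mul, hθ, Real.sin_arctan, Real.cos_arctan, mul_assoc, div_mul_div_comm,
      hsq, ← mul_div_assoc, mul_one, div_eq_iff h0]
    exact h3
  have hc : Real.cos (2 * θ) = -(l * Real.tanh x) := by
    have h3 := exp_mul_tanh (l * x)
    rw [tanh_sign_mul hl, ← ht] at h3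
    rw [Real.cos_two_mul, hθ, Real.cos_sq_arctan]
    field_simp
    linear_combination -h3
  rw [hk, Real.cos_add_int_mul_two_pi, Real.sin_add_int_mul_two_pi, Real.sin_two_mul,
    Real.cos_two_mul, hs, hc]
  constructor
  · rw [neg_sq, mul_pow, tanh_sq, sq (l : ℝ), sign_mul_self hl]; ring
  · ring

theorem kink_bound (k l : ℤ) (x : ℝ) :
    |kink k l x| ≤ 2 * Real.pi * (1 + |((min k (k + l) : ℤ) : ℝ)|) := by
  have h1 := Real.arctan_lt_pi_div_two (Real.exp (l * x))
  have h2 := Real.neg_pi_div_two_lt_arctan (Real.exp (l * x))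
  rw [kink]
  have h3 : |4 * Real.arctan (Real.exp (l * x))| ≤ 2 * Real.pi := by
    rw [abs_le]; constructor <;> linarith
  refine (abs_add_le _ _).trans ?_
  rw [abs_mul (2 * Real.pi), abs_of_pos (show 0 < 2 * Real.pi by positivity)]
  linarith

theorem tendsto_kink_atTop (hl : l = 1 ∨ l = -1) :
    Tendsto (kink k l) atTop (𝓝 (2 * Real.pi * (k + l))) := by
  rcases hl with rfl | rfl
  · have h : Tendsto (fun x : ℝ => Real.arctan (Real.exp (((1 : ℤ) : ℝ) * x))) atTop
        (𝓝 (Real.pi / 2)) := by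
      refine (Real.tendsto_arctan_atTop.mono_right nhdsWithin_le_nhds).comp ?_
      simpa using Real.tendsto_exp_atTop
    have h2 : Tendsto (kink k 1) atTop
        (𝓝 (4 * (Real.pi / 2) + 2 * Real.pi * ((min k (k + 1) : ℤ) : ℝ))) :=
      (h.const_mul 4).add_const (2 * Real.pi * ((min k (k + 1) : ℤ) : ℝ))
    convert h2 using 2
    rw [min_eq_left (by omega)]; push_cast; ring
  · have h : Tendsto (fun x : ℝ => Real.arctan (Real.exp (((-1 : ℤ) : ℝ) * x))) atTop
        (𝓝 (Real.arctan 0)) := by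
      refine (Real.continuous_arctan.tendsto 0).comp ?_
      simpa using Real.tendsto_exp_neg_atTop_nhds_zero
    have h2 : Tendsto (kink k (-1)) atTop
        (𝓝 (4 * Real.arctan 0 + 2 * Real.pi * ((min k (k + -1) : ℤ) : ℝ))) :=
      (h.const_mul 4).add_const (2 * Real.pi * ((min k (k + -1) : ℤ) : ℝ))
    convert h2 using 2
    rw [min_eq_right (by omega)]; push_cast; rw [Real.arctan_zero]; ring

theorem tendsto_kink_atBot (hl : l = 1 ∨ l = -1) :
    Tendsto (kink k l) atBot (𝓝 (2 * Real.pi * k)) := by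
  rcases hl with rfl | rfl
  · have h : Tendsto (fun x : ℝ => Real.arctan (Real.exp (((1 : ℤ) : ℝ) * x))) atBot
        (𝓝 (Real.arctan 0)) := by
      refine (Real.continuous_arctan.tendsto 0).comp ?_
      simpa using Real.tendsto_exp_atBot
    have h2 : Tendsto (kink k 1) atBot
        (𝓝 (4 * Real.arctan 0 + 2 * Real.pi * ((min k (k + 1) : ℤ) : ℝ))) :=
      (h.const_mul 4).add_const (2 * Real.pi * ((min k (k + 1) : ℤ) : ℝ))
    convert h2 using 2
    rw [min_eq_left (by omega), Real.arctan_zero]; ring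
  · have h : Tendsto (fun x : ℝ => Real.arctan (Real.exp (((-1 : ℤ) : ℝ) * x))) atBot
        (𝓝 (Real.pi / 2)) := by
      refine (Real.tendsto_arctan_atTop.mono_right nhdsWithin_le_nhds).comp ?_
      have : Tendsto (fun x : ℝ => Real.exp (-x)) atBot atTop :=
        Real.tendsto_exp_atTop.comp tendsto_neg_atBot_atTop
      simpa using this
    have h2 : Tendsto (kink k (-1)) atBot
        (𝓝 (4 * (Real.pi / 2) + 2 * Real.pi * ((min k (k + -1) : ℤ) : ℝ))) :=
      (h.const_mul 4).add_const (2 * Real.pi * ((min k (k + -1) : ℤ) : ℝ))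
    convert h2 using 2
    rw [min_eq_right (by omega)]; push_cast; ring

theorem deriv_kink (hl : l = 1 ∨ l = -1) : deriv (kink k l) = fun x => 2 * l * sech x :=
  funext fun x => (hasDerivAt_kink hl x).deriv

theorem continuous_kink (hl : l = 1 ∨ l = -1) : Continuous (kink k l) :=
  continuous_iff_continuousAt.mpr fun x => (hasDerivAt_kink hl x).continuousAt

theorem integral_deriv_kink_sq (hl : l = 1 ∨ l = -1) : ∫ x, deriv (kink k l) x ^ 2 = 8 := by
  have : ∀ x, deriv (kink k l) x ^ 2 = 4 * sech x ^ 2 := by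
    intro x
    rw [deriv_kink hl, mul_pow, mul_pow, sq (l : ℝ), sign_mul_self hl]; ring
  simp only [this, integral_const_mul, integral_sech_sq]
  norm_num

end Kink

/-! ### Coercivity of `-∂² + 1 - 2 sech²` modulo `sech` -/

section Coercivity

theorem one_add_tanh_pos (x : ℝ) : 0 < 1 + Real.tanh x := by
  have h := tanh_sq x
  have h2 := abs_le.mp (abs_tanh_le_one x)
  have h3 := sech_pos x
  have h4 : (1 + Real.tanh x) * (1 - Real.tanh x) = sech x ^ 2 := by linear_combination -h
  rcases lt_or_eq_of_le (show 0 ≤ 1 + Real.tanh x by linarith) with h5 | h5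
  · exact h5
  · rw [← h5, zero_mul] at h4
    nlinarith

theorem tanh_nonneg_of_nonneg {x : ℝ} (hx : 0 ≤ x) : 0 ≤ Real.tanh x := by
  rw [Real.tanh_eq_sinh_div_cosh]
  exact div_nonneg (Real.sinh_nonneg_iff.mpr hx) (Real.cosh_pos x).le

/-- A Hardy-type inequality on the half line for the operator `∂ + tanh`. -/
theorem hardy_tanh_Ioi {g p : ℝ → ℂ} (hg : ∀ x, HasDerivAt g (p x - Real.tanh x * g x) x)
    (h0 : g 0 = 0) (hp : Continuous p) (ig : Integrable fun x => ‖g x‖ ^ 2)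
    (ip : Integrable fun x => ‖p x‖ ^ 2) (ht : Tendsto g atTop (𝓝 0)) :
    1 / 4 * ∫ x in Ioi (0 : ℝ), ‖g x‖ ^ 2 ≤ ∫ x in Ioi (0 : ℝ), ‖p x‖ ^ 2 := by
  have hgc : Continuous g := continuous_iff_continuousAt.mpr fun x => (hg x).continuousAt
  -- The weight solves `2 tanh B - B' = 1`, so `-(B |g|²)' = |g|² - 2 B ⟨g, p⟩`, and it is at most
  -- `1` on the half line. Both boundary terms vanish, and `2 B |⟨g, p⟩| ≤ |g|²/2 + 2 |p|²` leaves
  -- the constant `1/4`.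
  set B : ℝ → ℝ := fun x => (1 + Real.tanh x)⁻¹ with hB
  have hBc : Continuous B :=
    (continuous_const.add continuous_tanh).inv₀ fun x => (one_add_tanh_pos x).ne'
  have hB1 : ∀ x, 0 ≤ x → B x ≤ 1 := fun x hx =>
    inv_le_one_of_one_le₀ (by linarith [tanh_nonneg_of_nonneg hx])
  have hB0 : ∀ x, 0 ≤ B x := fun x => inv_nonneg.mpr (one_add_tanh_pos x).le
  set φ' : ℝ → ℝ := fun x => ‖g x‖ ^ 2 - 2 * B x * inner ℝ (g x) (p x) with hφ'
  have hφ : ∀ x, HasDerivAt (fun x => -(B x * ‖g x‖ ^ 2)) (φ' x) x := by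
    intro x
    have h1 : HasDerivAt B (-(sech x ^ 2) / (1 + Real.tanh x) ^ 2) x :=
      ((hasDerivAt_tanh x).const_add 1).inv (one_add_tanh_pos x).ne'
    have h2 := (h1.mul (hg x).norm_sq).neg
    refine h2.congr_deriv ?_
    have h3 := tanh_sq x
    have h4 := (one_add_tanh_pos x).ne'
    have h5 : inner ℝ (g x) (p x - Real.tanh x * g x) =
        inner ℝ (g x) (p x) - Real.tanh x * ‖g x‖ ^ 2 := by
      rw [inner_sub_right, ← Complex.real_smul, inner_smul_right, real_inner_self_eq_norm_sq]
    rw [h5, hφ']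
    simp only [hB]
    have h6 : sech x ^ 2 = 1 - Real.tanh x ^ 2 := by linarith
    rw [h6]
    field_simp
    ring
  have hbound : ∀ x, 0 ≤ x → |2 * B x * inner ℝ (g x) (p x)| ≤ 1 / 2 * ‖g x‖ ^ 2 + 2 * ‖p x‖ ^ 2 := by
    intro x hx
    have h1 := abs_real_inner_le_norm (g x) (p x)
    rw [abs_mul, abs_mul, abs_of_nonneg (hB0 x), abs_two]
    have h2 : 2 * B x * |inner ℝ (g x) (p x)| ≤ 2 * 1 * (‖g x‖ * ‖p x‖) := by
      gcongr; exact hB1 x hx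
    nlinarith [sq_nonneg (‖g x‖ - 2 * ‖p x‖)]
  have hint : IntegrableOn φ' (Ioi 0) := by
    refine Integrable.mono' (((ig.integrableOn.const_mul (3 / 2)).add (ip.integrableOn.const_mul 2)))
      ?_ ?_
    · have : Continuous φ' := by
        have : Continuous fun x => inner ℝ (g x) (p x) := hgc.inner hp
        fun_prop
      exact this.aestronglyMeasurable
    · refine (ae_restrict_iff' measurableSet_Ioi).mpr (Eventually.of_forall fun x hx => ?_)
      have h1 := abs_le.mp (hbound x (le_of_lt hx))
      simp only [Pi.add_apply]
      rw [Real.norm_eq_abs, abs_le]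
      constructor <;> simp only [hφ'] <;> nlinarith [sq_nonneg ‖g x‖]
  have htend : Tendsto (fun x => -(B x * ‖g x‖ ^ 2)) atTop (𝓝 0) := by
    have h1 : Tendsto B atTop (𝓝 (1 + 1)⁻¹) :=
      (tendsto_tanh_atTop.const_add 1).inv₀ (by norm_num)
    have h2 := (h1.mul (ht.norm.pow 2)).neg
    simpa using h2
  have hmain := integral_Ioi_of_hasDerivAt_of_tendsto' (a := 0) (fun x _ => hφ x) hint htend
  rw [h0, norm_zero] at hmain
  have hle : ∫ x in Ioi (0 : ℝ), (1 / 2 * ‖g x‖ ^ 2 - 2 * ‖p x‖ ^ 2) ≤ ∫ x in Ioi (0 : ℝ), φ' x := by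
    refine setIntegral_mono_on ((ig.integrableOn.const_mul _).sub (ip.integrableOn.const_mul _))
      hint measurableSet_Ioi fun x hx => ?_
    have h1 := abs_le.mp (hbound x (le_of_lt hx))
    simp only [hφ']
    linarith
  rw [hmain, integral_sub (ig.integrableOn.const_mul _) (ip.integrableOn.const_mul _),
    integral_const_mul, integral_const_mul] at hle
  linarith

/-- Reflection sends `∂ + tanh` to its negative, so the half-line inequality applies to `g` and to
its reflection. The condition at `0` serves both halves. -/
theorem hardy_tanh {g p : ℝ → ℂ} (hg : ∀ x, HasDerivAt g (p x - Real.tanh x * g x) x)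
    (h0 : g 0 = 0) (hp : Continuous p) (ig : Integrable fun x => ‖g x‖ ^ 2)
    (ip : Integrable fun x => ‖p x‖ ^ 2) (ht : Tendsto g atTop (𝓝 0))
    (hb : Tendsto g atBot (𝓝 0)) :
    1 / 4 * ∫ x, ‖g x‖ ^ 2 ≤ ∫ x, ‖p x‖ ^ 2 := by
  have h1 := hardy_tanh_Ioi hg h0 hp ig ip ht
  have h2 := hardy_tanh_Ioi (g := fun x => g (-x)) (p := fun x => -p (-x)) (by
      intro x
      have := (hg (-x)).scomp x (hasDerivAt_neg x)
      refine this.congr_deriv ?_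
      rw [Real.tanh_neg]
      push_cast
      simp only [neg_smul, one_smul]
      ring) (by simpa using h0) (by fun_prop) ig.comp_neg
      (by simpa using ip.comp_neg) (hb.comp tendsto_neg_atTop_atBot)
  simp only [norm_neg] at h2
  rw [integral_comp_neg_Ioi (0 : ℝ) (fun x => ‖g x‖ ^ 2),
    integral_comp_neg_Ioi (0 : ℝ) (fun x => ‖p x‖ ^ 2), neg_zero] at h2
  have e : ∀ {h : ℝ → ℝ}, Integrable h → ∫ x, h x = (∫ x in Iic (0 : ℝ), h x) + ∫ x in Ioi (0 : ℝ), h x :=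
    fun hh => (intervalIntegral.integral_Iic_add_Ioi hh.integrableOn hh.integrableOn).symm
  rw [e ig, e ip]
  linarith

theorem tendsto_schwartz_atTop (f : 𝓢(ℝ, ℂ)) : Tendsto f atTop (𝓝 0) :=
  (f.toZeroAtInfty.zero_at_infty').mono_left atTop_le_cocompact

theorem tendsto_schwartz_atBot (f : 𝓢(ℝ, ℂ)) : Tendsto f atBot (𝓝 0) :=
  (f.toZeroAtInfty.zero_at_infty').mono_left atBot_le_cocompact

theorem memLp_sech : MemLp (fun x => (sech x : ℂ)) 2 volume := by
  have h : MemLp sech 2 volume := by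
    rw [memLp_two_iff_integrable_sq continuous_sech.aestronglyMeasurable]
    exact integrable_sech_sq
  exact h.ofReal

theorem norm_sq_mul_sech_le (a : ℂ) (x : ℝ) : ‖a * sech x‖ ^ 2 = ‖a‖ ^ 2 * sech x ^ 2 := by
  rw [norm_mul, Complex.norm_real, Real.norm_eq_abs, mul_pow, sq_abs]

theorem integrable_inner_of_memLp {f g : ℝ → ℂ} (hf : MemLp f 2 volume) (hg : MemLp g 2 volume) :
    Integrable fun x => inner ℝ (f x) (g x) := by
  refine (hf.norm.integrable_mul hg.norm).mono' (hf.1.inner hg.1)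
    (Eventually.of_forall fun x => ?_)
  exact norm_inner_le_norm _ _

/-- The form of `-∂² + 1 - 2 sech²` at a Schwartz function `f`, in factorized form. -/
theorem integral_form_schwartz (f : 𝓢(ℝ, ℂ)) :
    ∫ x, ‖deriv f x + Real.tanh x * f x‖ ^ 2 =
      -∫ x, inner ℝ (f x) (deriv (deriv f) x + ((2 * sech x ^ 2 - 1 : ℝ) : ℂ) * f x) := by
  set f₁ := SchwartzMap.derivCLM ℂ ℂ f
  set f₂ := SchwartzMap.derivCLM ℂ ℂ f₁
  have hf1 : ∀ x, HasDerivAt f (f₁ x) x := fun x => f.hasDerivAt x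
  have hf2 : ∀ x, HasDerivAt f₁ (f₂ x) x := fun x => f₁.hasDerivAt x
  have hcth : Continuous fun x => ((Real.tanh x : ℝ) : ℂ) :=
    Complex.continuous_ofReal.comp continuous_tanh
  have hcs : Continuous fun x => ((2 * sech x ^ 2 - 1 : ℝ) : ℂ) :=
    Complex.continuous_ofReal.comp (((continuous_sech.pow 2).const_mul 2).sub continuous_const)
  have mth : MemLp (fun x => ((Real.tanh x : ℝ) : ℂ) * f x) 2 volume := by
    refine (f.memLp 2).of_le_mul (c := 1) (hcth.mul f.continuous).aestronglyMeasurable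
      (Eventually.of_forall fun x => ?_)
    rw [norm_mul, Complex.norm_real, Real.norm_eq_abs]
    exact mul_le_mul_of_nonneg_right (abs_tanh_le_one x) (norm_nonneg _)
  have mp : MemLp (fun x => f₁ x + Real.tanh x * f x) 2 volume := (f₁.memLp 2).add mth
  have mc : MemLp (fun x => f₂ x + ((2 * sech x ^ 2 - 1 : ℝ) : ℂ) * f x) 2 volume := by
    refine (f₂.memLp 2).add ((f.memLp 2).of_le_mul (c := 1)
      (hcs.mul f.continuous).aestronglyMeasurable (Eventually.of_forall fun x => ?_))
    rw [Pi.mul_apply, norm_mul, Complex.norm_real, Real.norm_eq_abs]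
    refine mul_le_mul_of_nonneg_right ?_ (norm_nonneg _)
    have := sech_le_one x
    have := sech_pos x
    rw [abs_le]; constructor <;> nlinarith
  have i1 : Integrable fun x => ‖f₁ x + Real.tanh x * f x‖ ^ 2 :=
    (memLp_two_iff_integrable_sq_norm mp.1).mp mp
  have i2 : Integrable fun x => inner ℝ (f x) (f₂ x + ((2 * sech x ^ 2 - 1 : ℝ) : ℂ) * f x) :=
    integrable_inner_of_memLp (f.memLp 2) mc
  -- The boundary term of the factorization: with `tanh² = 1 - sech²`, its derivative is the sum of
  -- the two integrands.
  set φ : ℝ → ℝ := fun x => inner ℝ (f x) (f₁ x) + Real.tanh x * ‖f x‖ ^ 2 with hφ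
  have hd : ∀ x, HasDerivAt φ (‖f₁ x + Real.tanh x * f x‖ ^ 2 +
      inner ℝ (f x) (f₂ x + ((2 * sech x ^ 2 - 1 : ℝ) : ℂ) * f x)) x := by
    intro x
    have h1 := ((hf1 x).inner ℝ (hf2 x)).add ((hasDerivAt_tanh x).mul (hf1 x).norm_sq)
    refine h1.congr_deriv ?_
    have h3 := tanh_sq x
    simp only [← Complex.real_smul]
    rw [inner_add_right, inner_smul_right, real_inner_self_eq_norm_sq, norm_add_sq_real,
      inner_smul_right, norm_smul, Real.norm_eq_abs, mul_pow, sq_abs,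
      real_inner_self_eq_norm_sq, real_inner_comm (f x) (f₁ x), h3]
    ring
  have hlim : ∀ {F : Filter ℝ}, Tendsto f F (𝓝 0) → Tendsto f₁ F (𝓝 0) → Tendsto φ F (𝓝 0) := by
    intro F h1 h2
    have h3 : Tendsto (fun x => inner ℝ (f x) (f₁ x)) F (𝓝 0) := by
      have := h1.inner (𝕜 := ℝ) h2
      rwa [inner_zero_left] at this
    have h4 : Tendsto (fun x => Real.tanh x * ‖f x‖ ^ 2) F (𝓝 0) := by
      refine squeeze_zero_norm (a := fun x => ‖f x‖ ^ 2) (fun x => ?_) (by simpa using h1.norm.pow 2)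
      rw [norm_mul, norm_pow, norm_norm, Real.norm_eq_abs]
      have := abs_tanh_le_one x
      nlinarith [sq_nonneg ‖f x‖]
    have := h3.add h4
    rwa [add_zero] at this
  have := integral_of_hasDerivAt_of_tendsto hd (i1.add i2)
    (hlim (tendsto_schwartz_atBot f) (tendsto_schwartz_atBot f₁))
    (hlim (tendsto_schwartz_atTop f) (tendsto_schwartz_atTop f₁))
  rw [integral_add i1 i2, sub_zero] at this
  exact eq_neg_of_add_eq_zero_left this

/-- Coercivity of `-∂² + 1 - 2 sech²` modulo the span of `sech`, at Schwartz functions. -/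
theorem exists_coercive_schwartz (f : 𝓢(ℝ, ℂ)) : ∃ a : ℂ,
    1 / 4 * ∫ x, ‖f x - a * sech x‖ ^ 2 ≤
      -∫ x, inner ℝ (f x) (deriv (deriv f) x + ((2 * sech x ^ 2 - 1 : ℝ) : ℂ) * f x) := by
  -- Since `sech 0 = 1`, subtracting `f 0 * sech` produces a function vanishing at `0`, as the Hardy
  -- inequality requires, while `∂ + tanh` annihilates the subtracted part.
  refine ⟨f 0, ?_⟩
  rw [← integral_form_schwartz]
  have hs : ∀ x, HasDerivAt (fun x => (sech x : ℂ)) ((-(Real.tanh x * sech x) : ℝ) : ℂ) x :=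
    fun x => (hasDerivAt_sech x).ofReal_comp
  have hcs : Continuous fun x => (sech x : ℂ) := Complex.continuous_ofReal.comp continuous_sech
  have hcth : Continuous fun x => ((Real.tanh x : ℝ) : ℂ) :=
    Complex.continuous_ofReal.comp continuous_tanh
  set f₁ := SchwartzMap.derivCLM ℂ ℂ f
  have hp : MemLp (fun x => deriv f x + Real.tanh x * f x) 2 volume := by
    refine (f₁.memLp 2).add ((f.memLp 2).of_le_mul (c := 1)
      (hcth.mul f.continuous).aestronglyMeasurable (Eventually.of_forall fun x => ?_))
    rw [Pi.mul_apply, norm_mul, Complex.norm_real, Real.norm_eq_abs]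
    exact mul_le_mul_of_nonneg_right (abs_tanh_le_one x) (norm_nonneg _)
  have hgm : MemLp (fun x => f x - f 0 * sech x) 2 volume :=
    (f.memLp 2).sub (memLp_sech.const_mul (f 0))
  have hlim : ∀ {F : Filter ℝ}, Tendsto f F (𝓝 0) → Tendsto sech F (𝓝 0) →
      Tendsto (fun x => f x - f 0 * sech x) F (𝓝 0) := by
    intro F h1 h2
    have h3 : Tendsto (fun x => (sech x : ℂ)) F (𝓝 0) :=
      (Complex.continuous_ofReal.tendsto' 0 0 Complex.ofReal_zero).comp h2
    simpa using h1.sub (h3.const_mul (f 0))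
  refine hardy_tanh (g := fun x => f x - f 0 * sech x) (fun x => ?_) ?_ ?_ ?_ ?_ ?_ ?_
  · refine ((f.hasDerivAt x).sub ((hs x).const_mul (f 0))).congr_deriv ?_
    push_cast
    ring
  · simp [sech]
  · exact f₁.continuous.add (hcth.mul f.continuous)
  · exact (memLp_two_iff_integrable_sq_norm hgm.1).mp hgm
  · exact (memLp_two_iff_integrable_sq_norm hp.1).mp hp
  · exact hlim (tendsto_schwartz_atTop f) tendsto_sech_atTop
  · exact hlim (tendsto_schwartz_atBot f) tendsto_sech_atBot

end Coercivity

/-! ### The linearization about a translated front -/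

section KinkOperator

/-- The potential `2 sech² - 1` centred at `σ`. -/
noncomputable def kinkPotential (σ x : ℝ) : ℝ := 2 * sech (x - σ) ^ 2 - 1

theorem continuous_kinkPotential (σ : ℝ) : Continuous (kinkPotential σ) :=
  (((continuous_sech.comp (continuous_sub_right σ)).pow 2).const_mul 2).sub continuous_const

theorem abs_kinkPotential_le (σ x : ℝ) : |kinkPotential σ x| ≤ 1 := by
  have := sech_le_one (x - σ)
  have := sech_pos (x - σ)
  rw [kinkPotential, abs_le]; constructor <;> nlinarith

theorem memLp_top_ofReal {q : ℝ → ℝ} (hq : Continuous q) {M : ℝ} (hM : ∀ x, |q x| ≤ M) :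
    MemLp (fun x => (q x : ℂ)) ∞ volume :=
  memLp_top_of_bound (Complex.continuous_ofReal.comp hq).aestronglyMeasurable M
    (Eventually.of_forall fun x => by rw [Complex.norm_real]; exact hM x)

theorem memLp_kinkPotential (σ : ℝ) : MemLp (fun x => (kinkPotential σ x : ℂ)) ∞ volume :=
  memLp_top_ofReal (continuous_kinkPotential σ) (abs_kinkPotential_le σ)

/-- The normalized zero mode centred at `σ`. -/
noncomputable def zeroMode (σ x : ℝ) : ℂ := ((√2)⁻¹ : ℝ) * (sech (x - σ) : ℂ)

theorem memLp_zeroMode (σ : ℝ) : MemLp (zeroMode σ) 2 volume :=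
  (memLp_sech.comp_measurePreserving (measurePreserving_sub_right volume σ)).const_mul _

theorem norm_sq_toLp {f : ℝ → ℂ} (hf : MemLp f 2 volume) :
    ‖(hf.toLp f : L2)‖ ^ 2 = ∫ x, ‖f x‖ ^ 2 := by
  have h := inner_self_eq_norm_sq_to_K (𝕜 := ℂ) (hf.toLp f : L2)
  rw [L2.inner_def] at h
  have h2 : ∫ x, inner ℂ ((hf.toLp f : L2) x) ((hf.toLp f : L2) x) =
      ((∫ x, ‖f x‖ ^ 2 : ℝ) : ℂ) := by
    rw [← integral_complex_ofReal]
    refine integral_congr_ae ?_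
    filter_upwards [hf.coeFn_toLp] with x hx
    rw [hx, inner_self_eq_norm_sq_to_K]
    simp
  rw [h2] at h
  exact_mod_cast (Complex.ofReal_injective (by simpa using h)).symm

theorem re_inner_toLp {f g : ℝ → ℂ} (hf : MemLp f 2 volume) (hg : MemLp g 2 volume) :
    (inner ℂ (hf.toLp f : L2) (hg.toLp g)).re = ∫ x, inner ℝ (f x) (g x) := by
  rw [L2.inner_def]
  have h := integral_re (𝕜 := ℂ) (L2.integrable_inner (𝕜 := ℂ) (hf.toLp f : L2) (hg.toLp g))
  refine Eq.trans h.symm (integral_congr_ae ?_)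
  filter_upwards [hf.coeFn_toLp, hg.coeFn_toLp] with x h1 h2
  rw [h1, h2, RCLike.inner_apply]
  simp [Complex.inner]

theorem norm_toLp_zeroMode (σ : ℝ) : ‖((memLp_zeroMode σ).toLp _ : L2)‖ = 1 := by
  have h := norm_sq_toLp (memLp_zeroMode σ)
  have h2 : ∀ x, ‖zeroMode σ x‖ ^ 2 = 2⁻¹ * sech (x - σ) ^ 2 := by
    intro x
    rw [zeroMode, norm_sq_mul_sech_le, Complex.norm_real, Real.norm_eq_abs, sq_abs, inv_pow,
      Real.sq_sqrt (by norm_num)]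
  simp only [h2] at h
  rw [integral_const_mul, integral_sub_right_eq_self (fun x => sech x ^ 2), integral_sech_sq,
    inv_mul_cancel₀ (by norm_num)] at h
  exact (pow_eq_one_iff_of_nonneg (norm_nonneg _) two_ne_zero).mp h

/-- The left side is the squared distance to the span of `e`. It replaces the coefficient `f 0` from
the Hardy argument, which is not continuous in `L²`, by the orthogonal projection, so that the
inequality survives passage to limits. -/
theorem norm_sq_sub_smul_ge {H : Type*} [NormedAddCommGroup H] [InnerProductSpace ℂ H]
    {e : H} (he : ‖e‖ = 1) (x : H) (c : ℂ) :
    ‖x‖ ^ 2 - ‖inner ℂ e x‖ ^ 2 ≤ ‖x - c • e‖ ^ 2 := by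
  have h1 := inner_sub_proj_eq_zero (φ := e) (by rw [← norm_ne_zero_iff, he]; exact one_ne_zero) x
  rw [he] at h1
  simp only [Complex.ofReal_one, one_pow, div_one] at h1
  set w := inner ℂ e x with hw
  have h2 : ∀ d : ℂ, ‖(x - w • e) + d • e‖ ^ 2 = ‖x - w • e‖ ^ 2 + ‖d‖ ^ 2 := by
    intro d
    have := norm_add_sq_eq_norm_sq_add_norm_sq_of_inner_eq_zero (𝕜 := ℂ) (x - w • e) (d • e) (by
      rw [inner_smul_right, ← inner_conj_symm, h1]; simp)
    rw [sq, this, norm_smul, he]; ring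
  have h3 := h2 w
  rw [sub_add_cancel] at h3
  have h4 := h2 (w - c)
  rw [show x - w • e + (w - c) • e = x - c • e by module] at h4
  rw [h4, h3]
  nlinarith [sq_nonneg ‖w - c‖]

theorem hasDerivAt_sech_sub (σ x : ℝ) :
    HasDerivAt (fun x => sech (x - σ)) (-(Real.tanh (x - σ) * sech (x - σ))) x :=
  (hasDerivAt_sech (x - σ)).comp_sub_const x σ

/-- This says `sech'' + (2 sech² - 1) sech = 0`: the derivative of the front is a zero mode, by
translation invariance at `ε = 0`. -/
theorem hasDerivAt_tanh_mul_sech_sub (σ x : ℝ) :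
    HasDerivAt (fun x => -(Real.tanh (x - σ) * sech (x - σ)))
      (-(kinkPotential σ x * sech (x - σ))) x := by
  have h := (((hasDerivAt_tanh (x - σ)).mul (hasDerivAt_sech (x - σ))).neg).comp_sub_const x σ
  refine h.congr_deriv ?_
  have := tanh_sq (x - σ)
  rw [kinkPotential]
  linear_combination sech (x - σ) * this

theorem hasDerivAt_zeroMode (σ x : ℝ) : HasDerivAt (zeroMode σ)
    (((√2)⁻¹ : ℝ) * ((-(Real.tanh (x - σ) * sech (x - σ)) : ℝ) : ℂ)) x :=
  (hasDerivAt_sech_sub σ x).ofReal_comp.const_mul _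

theorem hasDerivAt_zeroMode_deriv (σ x : ℝ) :
    HasDerivAt (fun x => ((√2)⁻¹ : ℝ) * ((-(Real.tanh (x - σ) * sech (x - σ)) : ℝ) : ℂ))
      (-(kinkPotential σ x * zeroMode σ x)) x := by
  refine ((hasDerivAt_tanh_mul_sech_sub σ x).ofReal_comp.const_mul _).congr_deriv ?_
  rw [zeroMode]
  push_cast
  ring

theorem norm_deriv_zeroMode_le (σ x : ℝ) :
    ‖(((√2)⁻¹ : ℝ) : ℂ) * ((-(Real.tanh (x - σ) * sech (x - σ)) : ℝ) : ℂ)‖ ≤ (√2)⁻¹ := by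
  rw [norm_mul, Complex.norm_real, Complex.norm_real, Real.norm_eq_abs, Real.norm_eq_abs,
    abs_of_nonneg (by positivity), abs_neg, abs_mul]
  have h1 := abs_tanh_le_one (x - σ)
  have h2 := abs_sech_le_one (x - σ)
  have h3 : |Real.tanh (x - σ)| * |sech (x - σ)| ≤ 1 * 1 := by gcongr
  have h4 : (0 : ℝ) ≤ (√2)⁻¹ := by positivity
  nlinarith

theorem memLp_kinkPotential_mul_zeroMode (σ : ℝ) :
    MemLp (fun x => -(kinkPotential σ x * zeroMode σ x)) 2 volume := by
  refine ((memLp_zeroMode σ).of_le_mul (c := 1)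
    ((Complex.continuous_ofReal.comp (continuous_kinkPotential σ)).aestronglyMeasurable.mul
      (memLp_zeroMode σ).1) (Eventually.of_forall fun x => ?_)).neg
  rw [Pi.mul_apply, norm_mul]
  refine mul_le_mul_of_nonneg_right ?_ (norm_nonneg _)
  exact (Complex.norm_real _).trans_le (abs_kinkPotential_le σ x)

/-- The normalized zero mode centred at `σ`, as an element of `H²(ℝ)`. -/
noncomputable def zeroModeH2 (σ : ℝ) : H2 :=
  ⟨(memLp_zeroMode σ).toLp _, toLp_mem_H2_of_hasDerivAt (hasDerivAt_zeroMode σ)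
    (hasDerivAt_zeroMode_deriv σ) (memLp_zeroMode σ) (memLp_kinkPotential_mul_zeroMode σ)
    (norm_deriv_zeroMode_le σ)⟩

theorem coe_zeroModeH2 (σ : ℝ) : (zeroModeH2 σ : L2) = (memLp_zeroMode σ).toLp _ := rfl

theorem secondDeriv_zeroModeH2 (σ : ℝ) :
    secondDeriv (zeroModeH2 σ) = (memLp_kinkPotential_mul_zeroMode σ).toLp _ :=
  secondDeriv_toLp_of_hasDerivAt (hasDerivAt_zeroMode σ)
    (hasDerivAt_zeroMode_deriv σ) (memLp_zeroMode σ) (memLp_kinkPotential_mul_zeroMode σ)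
    (norm_deriv_zeroMode_le σ)

theorem memLp_schwartz_add_potential (σ : ℝ) (f g : 𝓢(ℝ, ℂ)) :
    MemLp (fun x => g x + (kinkPotential σ x : ℂ) * f x) 2 volume := by
  refine (g.memLp 2).add ((f.memLp 2).of_le_mul (c := 1)
    ((Complex.continuous_ofReal.comp (continuous_kinkPotential σ)).mul
      f.continuous).aestronglyMeasurable (Eventually.of_forall fun x => ?_))
  rw [Pi.mul_apply, norm_mul]
  refine mul_le_mul_of_nonneg_right ?_ (norm_nonneg _)
  exact (Complex.norm_real _).trans_le (abs_kinkPotential_le σ x)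

theorem memLp_schwartz_sub_zeroMode (σ : ℝ) (f : 𝓢(ℝ, ℂ)) (a : ℂ) :
    MemLp (fun x => f x - a * zeroMode σ x) 2 volume :=
  (f.memLp 2).sub ((memLp_zeroMode σ).const_mul _)

theorem exists_coercive_schwartz_centred (σ : ℝ) (f : 𝓢(ℝ, ℂ)) : ∃ a : ℂ,
    1 / 4 * ∫ x, ‖f x - a * zeroMode σ x‖ ^ 2 ≤
      -∫ x, inner ℝ (f x) (deriv (deriv f) x + (kinkPotential σ x : ℂ) * f x) := by
  set g : 𝓢(ℝ, ℂ) := f.compSubConstCLM ℂ (-σ) with hg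
  have hgf : ∀ x, g x = f (x + σ) := fun x => by
    rw [hg, SchwartzMap.compSubConstCLM_apply, sub_neg_eq_add]
  have hgf' : (g : ℝ → ℂ) = fun x => f (x + σ) := funext hgf
  obtain ⟨a, ha⟩ := exists_coercive_schwartz g
  have hd1 : deriv g = fun x => deriv f (x + σ) := by
    rw [hgf']; ext x; exact deriv_comp_add_const _ _ _
  have hd2 : deriv (deriv g) = fun x => deriv (deriv f) (x + σ) := by
    rw [hd1]; ext x; exact deriv_comp_add_const _ _ _
  -- The factor undoes the normalization `1/√2` of the zero mode.
  refine ⟨a * √2, ?_⟩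
  rw [← integral_add_right_eq_self (fun x => ‖f x - (a * √2) * zeroMode σ x‖ ^ 2) σ,
    ← integral_add_right_eq_self
      (fun x => inner ℝ (f x) (deriv (deriv f) x + (kinkPotential σ x : ℂ) * f x)) σ]
  have h2 : ((√2 : ℝ) : ℂ) ≠ 0 := by
    exact_mod_cast (Real.sqrt_pos.mpr (by norm_num : (0 : ℝ) < 2)).ne'
  have h3 : ∀ x, a * (√2 : ℝ) * zeroMode σ (x + σ) = a * sech x := by
    intro x
    rw [zeroMode, add_sub_cancel_right]
    push_cast
    rw [mul_assoc a, mul_inv_cancel_left₀ h2]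
  simp only [h3, kinkPotential, add_sub_cancel_right]
  simpa only [hd2, hgf] using ha

theorem toLp_schwartz_add_potential (σ : ℝ) (f g : 𝓢(ℝ, ℂ)) :
    (g.toLp 2 : L2) + mulCLM (memLp_kinkPotential σ) (f.toLp 2) =
      (memLp_schwartz_add_potential σ f g).toLp _ := by
  apply Lp.ext
  filter_upwards [(memLp_schwartz_add_potential σ f g).coeFn_toLp, g.coeFn_toLp 2 volume,
    f.coeFn_toLp 2 volume, coeFn_mulCLM (memLp_kinkPotential σ) (f.toLp 2),
    Lp.coeFn_add (g.toLp 2 : L2) (mulCLM (memLp_kinkPotential σ) (f.toLp 2))]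
    with x h1 h2 h3 h4 h5
  rw [h5, Pi.add_apply, h1, h2, h4, h3]

theorem toLp_schwartz_sub_zeroMode (σ : ℝ) (f : 𝓢(ℝ, ℂ)) (a : ℂ) :
    ((memLp_schwartz_sub_zeroMode σ f a).toLp _ : L2) = (f.toLp 2 : L2) - a • (zeroModeH2 σ : L2) := by
  rw [coe_zeroModeH2]
  apply Lp.ext
  filter_upwards [(memLp_schwartz_sub_zeroMode σ f a).coeFn_toLp, f.coeFn_toLp 2 volume,
    (memLp_zeroMode σ).coeFn_toLp, Lp.coeFn_smul a ((memLp_zeroMode σ).toLp _ : L2),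
    Lp.coeFn_sub (f.toLp 2 : L2) (a • ((memLp_zeroMode σ).toLp _ : L2))]
    with x h1 h2 h3 h4 h5
  rw [h5, h1, Pi.sub_apply, h4, h2, Pi.smul_apply, h3, smul_eq_mul]

theorem re_inner_toLp_schwartz {h : ℝ → ℂ} (hh : MemLp h 2 volume) (f : 𝓢(ℝ, ℂ)) :
    (inner ℂ (hh.toLp h : L2) (f.toLp 2)).re = ∫ x, inner ℝ (f x) (h x) := by
  refine (re_inner_toLp hh (f.memLp 2)).trans ?_
  simp only [real_inner_comm]

theorem coercive_schwartz (σ : ℝ) (f : 𝓢(ℝ, ℂ)) :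
    (inner ℂ (((SchwartzMap.derivCLM ℂ ℂ (SchwartzMap.derivCLM ℂ ℂ f)).toLp 2 : L2) +
      mulCLM (memLp_kinkPotential σ) (f.toLp 2)) (f.toLp 2)).re ≤
      -(1 / 4) * (‖(f.toLp 2 : L2)‖ ^ 2 - ‖inner ℂ (zeroModeH2 σ : L2) (f.toLp 2)‖ ^ 2) := by
  obtain ⟨a, ha⟩ := exists_coercive_schwartz_centred σ f
  rw [toLp_schwartz_add_potential, re_inner_toLp_schwartz]
  rw [← norm_sq_toLp (memLp_schwartz_sub_zeroMode σ f a), toLp_schwartz_sub_zeroMode] at ha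
  have h4 := norm_sq_sub_smul_ge (e := (zeroModeH2 σ : L2))
    (norm_toLp_zeroMode σ) (f.toLp 2 : L2) a
  simp only [SchwartzMap.derivCLM_apply]
  have h5 : deriv (SchwartzMap.derivCLM ℂ ℂ f) = deriv (deriv f) := rfl
  rw [h5]
  linarith

theorem coercive_H2 (σ : ℝ) (x : H2) :
    (inner ℂ (secondDeriv x + mulCLM (memLp_kinkPotential σ) x) (x : L2)).re ≤
      -(1 / 4) * (‖(x : L2)‖ ^ 2 - ‖inner ℂ (zeroModeH2 σ : L2) (x : L2)‖ ^ 2) :=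
  H2_induction (p := fun a b =>
    (inner ℂ (b + mulCLM (memLp_kinkPotential σ) a) a).re ≤
      -(1 / 4) * (‖a‖ ^ 2 - ‖inner ℂ (zeroModeH2 σ : L2) a‖ ^ 2))
    (isClosed_le (Complex.continuous_re.comp (by fun_prop)) (by fun_prop))
    (coercive_schwartz σ) x

end KinkOperator

/-! ### Spectrum of `∂² + q` for `q` close to the potential of the front -/

section Linearization

variable {q : ℝ → ℝ} {M : ℝ}

theorem domain_secondDeriv_add_mulOp (hq : Continuous q) (hM : ∀ x, |q x| ≤ M) :
    (secondDeriv + mulOp q).domain = H2 := by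
  rw [LinearPMap.add_domain, mulOp_domain_eq_top hq.measurable hM, inf_top_eq]
  rfl

theorem coeFn_mulOp (q : ℝ → ℝ) (x : (mulOp q).domain) :
    mulOp q x =ᵐ[volume] fun y => (q y : ℂ) * (x : L2) y :=
  MemLp.coeFn_toLp (f := fun y => (q y : ℂ) * (x : L2) y) x.2

theorem secondDeriv_add_mulOp_apply (hq : Continuous q) (hM : ∀ x, |q x| ≤ M)
    (x : (secondDeriv + mulOp q).domain) (y : H2) (hxy : (x : L2) = y) :
    (secondDeriv + mulOp q) x = secondDeriv y + mulCLM (memLp_top_ofReal hq hM) y := by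
  obtain ⟨x, hx⟩ := x
  obtain rfl : x = y := hxy
  rw [LinearPMap.add_apply]
  congr 1
  apply Lp.ext
  exact (coeFn_mulOp q _).trans (coeFn_mulCLM _ _).symm

theorem isInvertible_of_notMem_opSpectrum {E : Type*} [NormedAddCommGroup E] [NormedSpace ℂ E]
    {A : E →ₗ.[ℂ] E} (h : (0 : ℂ) ∉ opSpectrum A) : IsInvertible A := by
  have h1 : IsInvertible (shift A 0) := not_not.mp h
  have h2 : shift A 0 = A := by
    rw [shift, zero_smul, neg_zero, zero_vadd]
  rwa [h2] at h1

/-- Spectral picture for `∂² + q` when `q` is uniformly close to the kink potential. -/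
theorem exists_spectrum_near_kink (hq : Continuous q) (σ δ : ℝ) (hδ : δ ≤ 1 / 200)
    (hqδ : ∀ x, |q x - kinkPotential σ x| ≤ δ) :
    ∃ ev : ℝ, |ev - 1 / 2 * ∫ x, (q x - kinkPotential σ x) * sech (x - σ) ^ 2| ≤ 8 * δ ^ 2 ∧
      IsSimpleEigenvalue (secondDeriv + mulOp q) (ev : ℂ) ∧
      opSpectrum (secondDeriv + mulOp q) ⊆
        {z : ℂ | ∃ x : ℝ, x ≤ -(1 / 8) ∧ z = (x : ℂ)} ∪ {(ev : ℂ)} := by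
  have hδ0 : 0 ≤ δ := (abs_nonneg _).trans (hqδ 0)
  have hM : ∀ x, |q x| ≤ 1 + δ := fun x => by
    have h1 := abs_add_le (kinkPotential σ x) (q x - kinkPotential σ x)
    rw [add_sub_cancel] at h1
    linarith [abs_kinkPotential_le σ x, hqδ x]
  have hrc : Continuous fun x => q x - kinkPotential σ x := hq.sub (continuous_kinkPotential σ)
  set mq := memLp_top_ofReal hq hM
  set mr := memLp_top_ofReal hrc hqδ
  have hsplit : ∀ f : L2, mulCLM mq f = mulCLM (memLp_kinkPotential σ) f + mulCLM mr f := by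
    intro f
    apply Lp.ext
    filter_upwards [coeFn_mulCLM mq f, coeFn_mulCLM (memLp_kinkPotential σ) f, coeFn_mulCLM mr f,
      Lp.coeFn_add (mulCLM (memLp_kinkPotential σ) f) (mulCLM mr f)] with x h1 h2 h3 h4
    rw [h4, Pi.add_apply, h1, h2, h3]
    push_cast
    ring
  have hrn : ∀ f : L2, ‖mulCLM mr f‖ ≤ δ * ‖f‖ :=
    norm_mulCLM_apply_le mr (fun x => by rw [Complex.norm_real]; exact hqδ x)
  have hformH2 : ∀ x : H2, (inner ℂ (secondDeriv x + mulCLM mq x) (x : L2)).re ≤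
      -(1 / 4) * (‖(x : L2)‖ ^ 2 - ‖inner ℂ (zeroModeH2 σ : L2) (x : L2)‖ ^ 2)
        + δ * ‖(x : L2)‖ ^ 2 := by
    intro x
    rw [hsplit, ← add_assoc, inner_add_left, Complex.add_re]
    have h1 := coercive_H2 σ x
    have h2 : (inner ℂ (mulCLM mr x) (x : L2)).re ≤ δ * ‖(x : L2)‖ * ‖(x : L2)‖ :=
      (Complex.re_le_norm _).trans ((norm_inner_le_norm _ _).trans (by gcongr; exact hrn _))
    nlinarith
  set A := secondDeriv + mulOp q with hA
  -- The domain of `A` is `H²` only up to a proved equality, so elements are carried back and forth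
  -- by `hlift` and `hlift'`.
  have hdom : A.domain = H2 := domain_secondDeriv_add_mulOp hq hM
  have hAx : ∀ (x : A.domain) (y : H2), (x : L2) = y → A x = secondDeriv y + mulCLM mq y :=
    secondDeriv_add_mulOp_apply hq hM
  have hlift : ∀ x : A.domain, ∃ y : H2, (x : L2) = y := fun x => ⟨⟨x, hdom ▸ x.2⟩, rfl⟩
  have hlift' : ∀ y : H2, ∃ x : A.domain, (x : L2) = y := fun y => ⟨⟨y, hdom.symm ▸ y.2⟩, rfl⟩
  have hsym : ∀ x y : A.domain, inner ℂ (A x) (y : L2) = inner ℂ (x : L2) (A y) := by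
    intro x y
    obtain ⟨x', hx'⟩ := hlift x
    obtain ⟨y', hy'⟩ := hlift y
    rw [hAx x x' hx', hAx y y' hy', hx', hy', inner_add_left, inner_add_right, secondDeriv_symm,
      mulCLM_symm]
  have hinner1 : ∀ x : L2, ‖inner ℂ (zeroModeH2 σ : L2) x‖ ≤ ‖x‖ := by
    intro x
    have h3 := norm_inner_le_norm (𝕜 := ℂ) (zeroModeH2 σ : L2) x
    rw [coe_zeroModeH2, norm_toLp_zeroMode, one_mul] at h3
    exact h3
  -- The form of `A` is at most `δ`, so `A - 1` is bounded below by `1/2`; the point `1` serves as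
  -- the real resolvent point.
  have hinv : IsInvertible (shift A ((1 : ℝ) : ℂ)) := by
    have hlow : ∀ x : H2, 1 / 2 * ‖(x : L2)‖ ≤
        ‖secondDeriv x + mulCLM mq x - ((1 : ℝ) : ℂ) • (x : L2)‖ := by
      intro x
      apply mul_norm_le_of_re_inner_le
      rw [inner_sub_left, Complex.sub_re, re_inner_ofReal_smul_self]
      have h1 := hformH2 x
      have h2 := pow_le_pow_left₀ (norm_nonneg _) (hinner1 x) 2
      nlinarith [sq_nonneg ‖(x : L2)‖]
    obtain ⟨G, hG₁, hG₂⟩ := exists_inverse_of_bounds secondDeriv secondDeriv_symm fourPiSq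
      isInvertible_shift_secondDeriv (mulCLM mq) (mulCLM_symm mq) ((1 : ℝ) : ℂ)
      (by norm_num : (0 : ℝ) < 1 / 2) hlow (by rw [Complex.conj_ofReal]; exact hlow)
    rw [isInvertible_shift_iff]
    refine ⟨G, fun y => ?_, fun x => ?_⟩
    · obtain ⟨x, hx, hx'⟩ := hG₁ y
      obtain ⟨x', hx''⟩ := hlift' x
      exact ⟨x', hx''.trans hx, by rw [hAx x' x hx'', hx'']; exact hx'⟩
    · obtain ⟨x', hx'⟩ := hlift x
      rw [hAx x x' hx', hx']
      exact hG₂ x'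
  obtain ⟨e, he⟩ := hlift' (zeroModeH2 σ)
  -- The unperturbed operator annihilates the zero mode, so only the perturbation of size `δ` acts
  -- on it.
  have hAe : A e = mulCLM mr (zeroModeH2 σ) := by
    rw [hAx e _ he, hsplit, ← add_assoc, secondDeriv_zeroModeH2, add_eq_right, coe_zeroModeH2]
    apply Lp.ext
    filter_upwards [(memLp_kinkPotential_mul_zeroMode σ).coeFn_toLp,
      (memLp_zeroMode σ).coeFn_toLp,
      coeFn_mulCLM (memLp_kinkPotential σ) ((memLp_zeroMode σ).toLp _),
      Lp.coeFn_add ((memLp_kinkPotential_mul_zeroMode σ).toLp _ : L2)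
        (mulCLM (memLp_kinkPotential σ) ((memLp_zeroMode σ).toLp _)),
      Lp.coeFn_zero ℂ 2 (volume : Measure ℝ)] with x h1 h2 h3 h4 h5
    rw [h4, Pi.add_apply, h1, h3, h2, h5, Pi.zero_apply]
    ring
  obtain ⟨ev, hev, hs, hspec⟩ := exists_simple_eigenvalue_near A hsym 1 hinv e
    (by rw [he]; exact norm_toLp_zeroMode σ) δ hδ
    (by
      rw [hAe]
      refine (hrn _).trans (le_of_eq ?_)
      rw [coe_zeroModeH2, norm_toLp_zeroMode, mul_one])
    (fun x => by
      obtain ⟨x', hx'⟩ := hlift x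
      rw [hAx x x' hx', hx', he]
      exact hformH2 x')
  refine ⟨ev, ?_, hs, hspec⟩
  convert hev using 3
  rw [hAe, he, coe_zeroModeH2, L2.inner_def, ← integral_const_mul]
  have h : ∫ x, inner ℂ (mulCLM mr ((memLp_zeroMode σ).toLp _) x)
      (((memLp_zeroMode σ).toLp (zeroMode σ) : L2) x) =
      ((∫ x, 1 / 2 * ((q x - kinkPotential σ x) * sech (x - σ) ^ 2) : ℝ) : ℂ) := by
    rw [← integral_complex_ofReal]
    refine integral_congr_ae ?_
    filter_upwards [coeFn_mulCLM mr ((memLp_zeroMode σ).toLp _), (memLp_zeroMode σ).coeFn_toLp]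
      with x h1 h2
    rw [h1, h2, RCLike.inner_apply, zeroMode, map_mul, map_mul, Complex.conj_ofReal,
      Complex.conj_ofReal, Complex.conj_ofReal]
    have h3 : ((√2)⁻¹ : ℝ) * (√2)⁻¹ = 1 / 2 := by
      rw [← mul_inv, Real.mul_self_sqrt (by norm_num)]; norm_num
    have h4 := congrArg (fun r : ℝ => (r : ℂ)) h3
    push_cast at h4 ⊢
    linear_combination (((q x : ℂ) - kinkPotential σ x) * (sech (x - σ) : ℂ) ^ 2) * h4
  rw [h, Complex.ofReal_re]

end Linearization

open scoped Topology BoundedContinuousFunction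

/-! ### Inverting the linear operators on bounded continuous functions -/

section SolutionOperators

theorem hasDerivAt_integral_Iic {φ : ℝ → ℝ} (hφ : Continuous φ)
    (hi : ∀ a, IntegrableOn φ (Iic a)) (x : ℝ) :
    HasDerivAt (fun x => ∫ y in Iic x, φ y) (φ x) x := by
  have h1 : ∀ x, ∫ y in Iic x, φ y = (∫ y in Iic (0 : ℝ), φ y) + ∫ y in (0 : ℝ)..x, φ y := by
    intro x
    rw [← intervalIntegral.integral_Iic_sub_Iic (hi 0) (hi x)]; ring
  rw [funext h1]
  exact (intervalIntegral.integral_hasDerivAt_right (hφ.intervalIntegrable _ _)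
    (hφ.stronglyMeasurableAtFilter _ _) hφ.continuousAt).const_add _

theorem integrableOn_exp_mul (f : ℝ →ᵇ ℝ) (a : ℝ) :
    IntegrableOn (fun y => Real.exp y * f y) (Iic a) :=
  (integrableOn_exp_Iic a).mul_bdd (c := ‖f‖) f.continuous.aestronglyMeasurable
    (Eventually.of_forall f.norm_coe_le_norm)

/-- The bounded solution of `E' + E = f`. -/
noncomputable def expAverage (f : ℝ →ᵇ ℝ) (x : ℝ) : ℝ :=
  Real.exp (-x) * ∫ y in Iic x, Real.exp y * f y

theorem hasDerivAt_expAverage (f : ℝ →ᵇ ℝ) (x : ℝ) :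
    HasDerivAt (expAverage f) (f x - expAverage f x) x := by
  have h1 := hasDerivAt_integral_Iic (φ := fun y => Real.exp y * f y)
    (Real.continuous_exp.mul f.continuous) (integrableOn_exp_mul f) x
  have h2 := (hasDerivAt_neg x).exp.mul h1
  refine h2.congr_deriv ?_
  have h : Real.exp (-x) * Real.exp x = 1 := by rw [← Real.exp_add]; simp
  rw [expAverage]
  linear_combination f x * h

theorem abs_integral_Iic_exp_le {f : ℝ → ℝ} {C : ℝ} (hf : ∀ y, |f y| ≤ C) (x : ℝ) :
    |∫ y in Iic x, Real.exp y * f y| ≤ C * Real.exp x := by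
  have h1 := norm_integral_le_of_norm_le ((integrableOn_exp_Iic x).const_mul C)
    (f := fun y => Real.exp y * f y)
    (Eventually.of_forall fun y => by
      rw [norm_mul, Real.norm_eq_abs, Real.norm_eq_abs, Real.abs_exp, mul_comm]
      exact mul_le_mul_of_nonneg_right (hf y) (Real.exp_pos _).le)
  rwa [integral_const_mul, integral_exp_Iic] at h1

theorem abs_expAverage_le (f : ℝ →ᵇ ℝ) (x : ℝ) : |expAverage f x| ≤ ‖f‖ := by
  rw [expAverage, abs_mul, Real.abs_exp]
  have h : Real.exp (-x) * Real.exp x = 1 := by rw [← Real.exp_add]; simp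
  have h1 := abs_integral_Iic_exp_le (f := f) f.norm_coe_le_norm x
  calc _ ≤ Real.exp (-x) * (‖f‖ * Real.exp x) := by gcongr
    _ = ‖f‖ := by linear_combination ‖f‖ * h

theorem expAverage_add (f g : ℝ →ᵇ ℝ) (x : ℝ) :
    expAverage (f + g) x = expAverage f x + expAverage g x := by
  simp only [expAverage, BoundedContinuousFunction.coe_add, Pi.add_apply, mul_add]
  rw [integral_add (integrableOn_exp_mul f x) (integrableOn_exp_mul g x)]
  ring

theorem expAverage_smul (c : ℝ) (f : ℝ →ᵇ ℝ) (x : ℝ) :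
    expAverage (c • f) x = c * expAverage f x := by
  simp only [expAverage, BoundedContinuousFunction.coe_smul, smul_eq_mul, mul_left_comm _ c]
  rw [integral_const_mul]
  ring

/-- The reflection `f ↦ f (-·)` of a bounded continuous function. -/
noncomputable def reflect (f : ℝ →ᵇ ℝ) : ℝ →ᵇ ℝ :=
  f.compContinuous ⟨fun x => -x, continuous_neg⟩

theorem reflect_apply (f : ℝ →ᵇ ℝ) (x : ℝ) : reflect f x = f (-x) := rfl

theorem norm_reflect_le (f : ℝ →ᵇ ℝ) : ‖reflect f‖ ≤ ‖f‖ :=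
  (BoundedContinuousFunction.norm_le (norm_nonneg _)).mpr fun _ => f.norm_coe_le_norm _

theorem hasDerivAt_expAverage_reflect (f : ℝ →ᵇ ℝ) (x : ℝ) :
    HasDerivAt (fun x => expAverage (reflect f) (-x))
      (expAverage (reflect f) (-x) - f x) x := by
  have h := (hasDerivAt_expAverage (reflect f) (-x)).comp x (hasDerivAt_neg x)
  refine h.congr_deriv ?_
  rw [reflect_apply, neg_neg]
  ring

/-- The operator `(∂² - 1)⁻¹` on bounded continuous functions. -/
theorem exists_bounded_inverse_sub_one : ∃ G : (ℝ →ᵇ ℝ) →L[ℝ] (ℝ →ᵇ ℝ),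
    ∀ f : ℝ →ᵇ ℝ, ∃ w' : ℝ → ℝ, (∀ x, HasDerivAt (G f) (w' x) x) ∧
      (∀ x, HasDerivAt w' (G f x + f x) x) ∧ ∀ x, |w' x| ≤ ‖f‖ := by
  have hcont : ∀ f, Continuous (expAverage f) := fun f =>
    continuous_iff_continuousAt.mpr fun x => (hasDerivAt_expAverage f x).continuousAt
  have hb : ∀ (f : ℝ →ᵇ ℝ) x, |expAverage (reflect f) (-x)| ≤ ‖f‖ := fun f x =>
    (abs_expAverage_le _ _).trans (norm_reflect_le f)
  have hbd : ∀ (f : ℝ →ᵇ ℝ) x,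
      ‖-(1 / 2) * (expAverage f x + expAverage (reflect f) (-x))‖ ≤ ‖f‖ := by
    intro f x
    have h1 := abs_le.mp (abs_expAverage_le f x)
    have h2 := abs_le.mp (hb f x)
    rw [Real.norm_eq_abs, abs_le]
    constructor <;> linarith
  -- From `1 - ∂² = (1 + ∂)(1 - ∂)`, the inverse of `∂² - 1` is minus the half sum of the bounded
  -- solutions of `E' + E = f` and of its mirror image.
  let L : (ℝ →ᵇ ℝ) →ₗ[ℝ] (ℝ →ᵇ ℝ) :=
    { toFun := fun f => BoundedContinuousFunction.ofNormedAddCommGroup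
        (fun x => -(1 / 2) * (expAverage f x + expAverage (reflect f) (-x)))
        (by have := hcont f; have := hcont (reflect f); fun_prop) ‖f‖ (hbd f)
      map_add' := fun f g => by
        ext x
        have : reflect (f + g) = reflect f + reflect g := rfl
        simp only [BoundedContinuousFunction.coe_ofNormedAddCommGroup,
          BoundedContinuousFunction.coe_add, Pi.add_apply, this, expAverage_add]
        ring
      map_smul' := fun c f => by
        ext x
        have : reflect (c • f) = c • reflect f := rfl
        simp only [BoundedContinuousFunction.coe_ofNormedAddCommGroup,
          BoundedContinuousFunction.coe_smul, smul_eq_mul, this, expAverage_smul,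
          RingHom.id_apply]
        ring }
  have hL : ∀ f x, L f x = -(1 / 2) * (expAverage f x + expAverage (reflect f) (-x)) :=
    fun f x => rfl
  refine ⟨L.mkContinuous 1 fun f => ?_, fun f => ?_⟩
  · rw [one_mul]
    exact (BoundedContinuousFunction.norm_le (norm_nonneg _)).mpr (hbd f)
  · refine ⟨fun x => 1 / 2 * (expAverage f x - expAverage (reflect f) (-x)), fun x => ?_,
      fun x => ?_, fun x => ?_⟩
    · refine (((hasDerivAt_expAverage f x).add (hasDerivAt_expAverage_reflect f x)).const_mul
        (-(1 / 2))).congr_deriv ?_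
      ring
    · refine (((hasDerivAt_expAverage f x).sub (hasDerivAt_expAverage_reflect f x)).const_mul
        (1 / 2)).congr_deriv ?_
      rw [LinearMap.mkContinuous_apply, hL]
      ring
    · have h1 := abs_le.mp (abs_expAverage_le f x)
      have h2 := abs_le.mp (hb f x)
      rw [abs_le]
      constructor <;> linarith

theorem integrable_mul_sech (f : ℝ →ᵇ ℝ) : Integrable fun x => f x * sech x :=
  integrable_sech_mul f.continuous f.norm_coe_le_norm

/-- The bounded continuous function `sech`. -/
noncomputable def sechB : ℝ →ᵇ ℝ :=
  BoundedContinuousFunction.ofNormedAddCommGroup sech continuous_sech 1 abs_sech_le_one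

theorem sechB_apply (x : ℝ) : sechB x = sech x := rfl

/-- The pairing with `sech` as a linear functional on bounded continuous functions. -/
noncomputable def sechPairing (f : ℝ →ᵇ ℝ) : ℝ := ∫ x, f x * sech x

theorem sechPairing_add (f g : ℝ →ᵇ ℝ) :
    sechPairing (f + g) = sechPairing f + sechPairing g := by
  simp only [sechPairing, BoundedContinuousFunction.coe_add, Pi.add_apply, add_mul]
  exact integral_add (integrable_mul_sech f) (integrable_mul_sech g)

theorem sechPairing_smul (c : ℝ) (f : ℝ →ᵇ ℝ) : sechPairing (c • f) = c * sechPairing f := by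
  simp only [sechPairing, BoundedContinuousFunction.coe_smul, smul_eq_mul, mul_assoc]
  exact integral_const_mul _ _

theorem abs_sechPairing_le (f : ℝ →ᵇ ℝ) : |sechPairing f| ≤ (∫ x, sech x) * ‖f‖ := by
  have h := norm_integral_le_of_norm_le (f := fun x => f x * sech x)
    (integrable_sech.const_mul ‖f‖) (Eventually.of_forall fun x => by
      rw [norm_mul, Real.norm_of_nonneg (sech_pos x).le]
      exact mul_le_mul_of_nonneg_right (f.norm_coe_le_norm x) (sech_pos x).le)
  rwa [integral_const_mul, mul_comm] at h

theorem sechPairing_sechB : sechPairing sechB = 2 := by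
  rw [← integral_sech_sq, sechPairing]
  simp only [sechB_apply, sq]

/-- The projection onto functions with vanishing `sech` pairing. -/
noncomputable def sechProj (f : ℝ →ᵇ ℝ) : ℝ →ᵇ ℝ := f - (sechPairing f / 2) • sechB

theorem sechProj_apply (f : ℝ →ᵇ ℝ) (x : ℝ) :
    sechProj f x = f x - sechPairing f / 2 * sech x := rfl

theorem sechPairing_sechProj (f : ℝ →ᵇ ℝ) : sechPairing (sechProj f) = 0 := by
  have h : sechProj f = f + (-(sechPairing f / 2)) • sechB := by rw [sechProj]; module
  rw [h, sechPairing_add, sechPairing_smul, sechPairing_sechB]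
  ring

theorem sechProj_add (f g : ℝ →ᵇ ℝ) : sechProj (f + g) = sechProj f + sechProj g := by
  rw [sechProj, sechProj, sechProj, sechPairing_add]; module

theorem sechProj_smul (c : ℝ) (f : ℝ →ᵇ ℝ) : sechProj (c • f) = c • sechProj f := by
  rw [sechProj, sechProj, sechPairing_smul]; module

theorem norm_sechProj_le (f : ℝ →ᵇ ℝ) : ‖sechProj f‖ ≤ (1 + (∫ x, sech x) / 2) * ‖f‖ := by
  have h1 : ‖sechB‖ ≤ 1 := (BoundedContinuousFunction.norm_le zero_le_one).mpr abs_sech_le_one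
  have h2 := abs_sechPairing_le f
  refine (norm_sub_le _ _).trans ?_
  rw [norm_smul, Real.norm_eq_abs, abs_div, abs_two]
  have h3 : |sechPairing f| / 2 * ‖sechB‖ ≤ (∫ x, sech x) * ‖f‖ / 2 * 1 := by
    have : 0 ≤ ∫ x, sech x := integral_nonneg fun x => (sech_pos x).le
    gcongr
  linarith

/-- The solution of `g' - tanh g = h`, bounded if the `sech` pairing of `h` vanishes. -/
noncomputable def tanhSolve (h : ℝ →ᵇ ℝ) (x : ℝ) : ℝ :=
  Real.cosh x * ∫ y in Iic x, h y * sech y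

theorem hasDerivAt_tanhSolve (h : ℝ →ᵇ ℝ) (x : ℝ) :
    HasDerivAt (tanhSolve h) (h x + Real.tanh x * tanhSolve h x) x := by
  have h1 := hasDerivAt_integral_Iic (φ := fun y => h y * sech y)
    (h.continuous.mul continuous_sech) (fun a => (integrable_mul_sech h).integrableOn) x
  refine ((Real.hasDerivAt_cosh x).mul h1).congr_deriv ?_
  have h2 := sech_mul_cosh x
  have h3 : Real.tanh x * Real.cosh x = Real.sinh x := by
    rw [Real.tanh_eq_sinh_div_cosh, div_mul_cancel₀ _ (Real.cosh_pos x).ne']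
  rw [tanhSolve]
  linear_combination h x * h2 - (∫ y in Iic x, h y * sech y) * h3

theorem cosh_le_exp_neg {x : ℝ} (hx : x ≤ 0) : Real.cosh x ≤ Real.exp (-x) := by
  have : Real.exp x ≤ Real.exp (-x) := Real.exp_le_exp.mpr (by linarith)
  rw [Real.cosh_eq]; linarith

theorem abs_cosh_mul_integral_le {h : ℝ → ℝ} {C : ℝ} (hC : ∀ y, |h y| ≤ C)
    {x : ℝ} (hx : x ≤ 0) : |Real.cosh x * ∫ y in Iic x, h y * sech y| ≤ 2 * C := by
  have hC0 : 0 ≤ C := (abs_nonneg _).trans (hC 0)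
  have h1 : |∫ y in Iic x, h y * sech y| ≤ C * 2 * Real.exp x := by
    have h2 := norm_integral_le_of_norm_le ((integrableOn_exp_Iic x).const_mul (C * 2))
      (f := fun y => h y * sech y)
      (Eventually.of_forall fun y => by
        rw [norm_mul, Real.norm_eq_abs, Real.norm_of_nonneg (sech_pos y).le, mul_assoc]
        exact mul_le_mul (hC y) (sech_le_two_exp y) (sech_pos y).le hC0)
    rwa [integral_const_mul, integral_exp_Iic] at h2
  rw [abs_mul, abs_of_pos (Real.cosh_pos x)]
  have h3 : Real.exp (-x) * Real.exp x = 1 := by rw [← Real.exp_add]; simp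
  calc _ ≤ Real.exp (-x) * (C * 2 * Real.exp x) := by
        gcongr
        exact cosh_le_exp_neg hx
    _ = 2 * C := by linear_combination 2 * C * h3

/-- For `x ≤ 0` the tail integral of `sech` compensates the growth of `cosh`. For `x ≥ 0` the
vanishing total pairing replaces the integral up to `x` by minus the integral beyond `x`, which
reflection brings back to the first case. -/
theorem abs_tanhSolve_le {h : ℝ →ᵇ ℝ} (h0 : sechPairing h = 0) (x : ℝ) :
    |tanhSolve h x| ≤ 2 * ‖h‖ := by
  rcases le_total x 0 with hx | hx
  · exact abs_cosh_mul_integral_le h.norm_coe_le_norm hx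
  · have h1 : ∫ y in Iic x, h y * sech y = -∫ y in Iic (-x), reflect h y * sech y := by
      have h2 : (∫ y in Iic x, h y * sech y) + ∫ y in Ioi x, h y * sech y = 0 := by
        rw [intervalIntegral.integral_Iic_add_Ioi (integrable_mul_sech h).integrableOn
          (integrable_mul_sech h).integrableOn]
        exact h0
      rw [← integral_comp_neg_Ioi x (fun y => reflect h y * sech y)]
      simp only [reflect_apply, neg_neg, sech_neg]
      linarith
    rw [tanhSolve, h1, mul_neg, abs_neg, ← Real.cosh_neg]
    refine (abs_cosh_mul_integral_le (reflect h).norm_coe_le_norm (by linarith)).trans ?_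
    have := norm_reflect_le h
    linarith

/-- The solution of `w' + tanh w = g` with `w 0 = 0`. -/
noncomputable def sechSolve (g : ℝ → ℝ) (x : ℝ) : ℝ :=
  sech x * ∫ y in (0 : ℝ)..x, Real.cosh y * g y

theorem hasDerivAt_sechSolve {g : ℝ → ℝ} (hg : Continuous g) (x : ℝ) :
    HasDerivAt (sechSolve g) (g x - Real.tanh x * sechSolve g x) x := by
  have hc : Continuous fun y => Real.cosh y * g y := Real.continuous_cosh.mul hg
  have h1 := intervalIntegral.integral_hasDerivAt_right (hc.intervalIntegrable 0 x)
    (hc.stronglyMeasurableAtFilter _ _) hc.continuousAt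
  refine ((hasDerivAt_sech x).mul h1).congr_deriv ?_
  have h2 := sech_mul_cosh x
  rw [sechSolve]
  linear_combination g x * h2

/-- The integral of `cosh` from `0` is `sinh`, and `sech |sinh| = |tanh| ≤ 1`. -/
theorem abs_sechSolve_le {g : ℝ → ℝ} {C : ℝ} (hC : ∀ y, |g y| ≤ C) (x : ℝ) :
    |sechSolve g x| ≤ C := by
  have hC0 : 0 ≤ C := (abs_nonneg _).trans (hC 0)
  have h1 : |∫ y in (0 : ℝ)..x, Real.cosh y * g y| ≤ |∫ y in (0 : ℝ)..x, C * Real.cosh y| := by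
    refine intervalIntegral.norm_integral_le_abs_of_norm_le (f := fun y => Real.cosh y * g y)
      (g := fun y => C * Real.cosh y) (μ := volume) (Eventually.of_forall fun y => ?_)
      ((Real.continuous_cosh.const_mul C).intervalIntegrable (μ := volume) _ _)
    rw [norm_mul, Real.norm_of_nonneg (Real.cosh_pos y).le, mul_comm]
    exact mul_le_mul_of_nonneg_right (hC y) (Real.cosh_pos y).le
  have h2 : ∫ y in (0 : ℝ)..x, C * Real.cosh y = C * Real.sinh x := by
    rw [intervalIntegral.integral_const_mul, intervalIntegral.integral_eq_sub_of_hasDerivAt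
      (fun y _ => Real.hasDerivAt_sinh y) (Real.continuous_cosh.intervalIntegrable _ _), Real.sinh_zero, sub_zero]
  rw [h2, abs_mul, abs_of_nonneg hC0] at h1
  rw [sechSolve, abs_mul, abs_of_pos (sech_pos x)]
  have h3 : sech x * |Real.sinh x| ≤ 1 := by
    have := abs_tanh_le_one x
    rw [Real.tanh_eq_sinh_div_cosh, abs_div, abs_of_pos (Real.cosh_pos x)] at this
    rw [sech, inv_mul_eq_div]
    exact this
  calc _ ≤ sech x * (C * |Real.sinh x|) := mul_le_mul_of_nonneg_left h1 (sech_pos x).le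
    _ = C * (sech x * |Real.sinh x|) := by ring
    _ ≤ C * 1 := by gcongr
    _ = C := mul_one C

/-- A bounded right inverse of `∂² - 1 + 2 sech²` modulo `sech`, on bounded continuous
functions. -/
theorem exists_bounded_inverse_kink : ∃ G : (ℝ →ᵇ ℝ) →L[ℝ] (ℝ →ᵇ ℝ),
    ∀ f : ℝ →ᵇ ℝ, ∃ w' : ℝ → ℝ, (∀ x, HasDerivAt (G f) (w' x) x) ∧
      (∀ x, HasDerivAt w' ((1 - 2 * sech x ^ 2) * G f x + f x - sechPairing f / 2 * sech x) x) ∧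
      ∃ M, ∀ x, |w' x| ≤ M := by
  have hcg : ∀ h : ℝ →ᵇ ℝ, Continuous (tanhSolve h) := fun h =>
    continuous_iff_continuousAt.mpr fun x => (hasDerivAt_tanhSolve h x).continuousAt
  have hcw : ∀ h : ℝ →ᵇ ℝ, Continuous (sechSolve (tanhSolve h)) := fun h =>
    continuous_iff_continuousAt.mpr fun x => (hasDerivAt_sechSolve (hcg h) x).continuousAt
  have hbg : ∀ (f : ℝ →ᵇ ℝ) x, |tanhSolve (sechProj f) x| ≤ 2 * ‖sechProj f‖ := fun f x =>
    abs_tanhSolve_le (sechPairing_sechProj f) x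
  have hbw : ∀ (f : ℝ →ᵇ ℝ) x, |sechSolve (tanhSolve (sechProj f)) x| ≤ 2 * ‖sechProj f‖ :=
    fun f x => abs_sechSolve_le (hbg f) x
  have hadd : ∀ (f g : ℝ →ᵇ ℝ) x, tanhSolve (f + g) x = tanhSolve f x + tanhSolve g x := by
    intro f g x
    simp only [tanhSolve, BoundedContinuousFunction.coe_add, Pi.add_apply, add_mul]
    rw [integral_add (integrable_mul_sech f).integrableOn (integrable_mul_sech g).integrableOn]
    ring
  have hsmul : ∀ (c : ℝ) (f : ℝ →ᵇ ℝ) x, tanhSolve (c • f) x = c * tanhSolve f x := by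
    intro c f x
    simp only [tanhSolve, BoundedContinuousFunction.coe_smul, smul_eq_mul, mul_assoc]
    rw [integral_const_mul]
    ring
  -- Factorization `∂² - 1 + 2 sech² = (∂ - tanh)(∂ + tanh)`: project away the pairing with `sech`,
  -- solve `g' - tanh g = sechProj f`, then `w' + tanh w = g`. Only the first factor imposes a
  -- solvability condition; the kernel `sech` of the second is fixed by `w 0 = 0`.
  let L : (ℝ →ᵇ ℝ) →ₗ[ℝ] (ℝ →ᵇ ℝ) :=
    { toFun := fun f => BoundedContinuousFunction.ofNormedAddCommGroup
        (sechSolve (tanhSolve (sechProj f))) (hcw _) (2 * ‖sechProj f‖) (hbw f)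
      map_add' := fun f g => by
        ext x
        simp only [BoundedContinuousFunction.coe_ofNormedAddCommGroup,
          BoundedContinuousFunction.coe_add, Pi.add_apply, sechProj_add]
        simp only [sechSolve, hadd, mul_add]
        have hi : ∀ h : ℝ →ᵇ ℝ, IntervalIntegrable (fun y => Real.cosh y * tanhSolve h y)
            volume 0 x := fun h => (Real.continuous_cosh.mul (hcg h)).intervalIntegrable _ _
        rw [intervalIntegral.integral_add (hi _) (hi _)]
        ring
      map_smul' := fun c f => by
        ext x
        simp only [BoundedContinuousFunction.coe_ofNormedAddCommGroup,
          BoundedContinuousFunction.coe_smul, smul_eq_mul, sechProj_smul, RingHom.id_apply]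
        simp only [sechSolve, hsmul, mul_left_comm _ c]
        rw [intervalIntegral.integral_const_mul]
        ring }
  have hL : ∀ f x, L f x = sechSolve (tanhSolve (sechProj f)) x := fun f x => rfl
  refine ⟨L.mkContinuous (2 * (1 + (∫ x, sech x) / 2)) fun f => ?_, fun f => ?_⟩
  · refine (BoundedContinuousFunction.norm_le ?_).mpr fun x => ?_
    · have : 0 ≤ ∫ x, sech x := integral_nonneg fun x => (sech_pos x).le
      positivity
    · refine (hbw f x).trans ?_
      have := norm_sechProj_le f
      linarith
  · set g := tanhSolve (sechProj f) with hg
    have hd := hasDerivAt_sechSolve (hcg (sechProj f))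
    refine ⟨fun x => g x - Real.tanh x * sechSolve g x, hd, fun x => ?_,
      2 * ‖sechProj f‖ + 2 * ‖sechProj f‖, fun x => ?_⟩
    · refine ((hasDerivAt_tanhSolve (sechProj f) x).sub
        ((hasDerivAt_tanh x).mul (hd x))).congr_deriv ?_
      rw [LinearMap.mkContinuous_apply, hL, sechProj_apply, ← hg]
      have := tanh_sq x
      linear_combination sechSolve g x * this
    · refine (abs_sub _ _).trans (add_le_add (hbg f x) ?_)
      rw [abs_mul]
      calc _ ≤ 1 * (2 * ‖sechProj f‖) :=
            mul_le_mul (abs_tanh_le_one x) (hbw f x) (abs_nonneg _) zero_le_one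
        _ = _ := one_mul _

end SolutionOperators

/-! ### Contraction argument for the nonlinear equation -/

section Contraction

/-- The quadratic remainder of the sine. -/
noncomputable def sinRemainder (a w : ℝ) : ℝ := Real.sin (a + w) - Real.sin a - Real.cos a * w

theorem abs_cos_add_sub_cos_le (a t : ℝ) : |Real.cos (a + t) - Real.cos a| ≤ |t| := by
  have h := Real.abs_cos_sub_cos_le (a + t) a
  simpa using h

theorem abs_sinRemainder_sub_le {a w w' r : ℝ} (hw : |w| ≤ r) (hw' : |w'| ≤ r) :
    |sinRemainder a w - sinRemainder a w'| ≤ r * |w - w'| := by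
  have h := Convex.norm_image_sub_le_of_norm_hasDerivWithin_le (f := sinRemainder a)
    (f' := fun t => Real.cos (a + t) - Real.cos a) (s := Icc (-r) r) (C := r)
    (x := w') (y := w)
    (fun t _ => by
      have h1 := (((hasDerivAt_id t).const_add a).sin.sub_const (Real.sin a)).sub
        ((hasDerivAt_id t).const_mul (Real.cos a))
      exact (h1.congr_deriv (by simp)).hasDerivWithinAt)
    (fun t ht => (abs_cos_add_sub_cos_le a t).trans (abs_le.mpr ht)) (convex_Icc _ _)
    (abs_le.mp hw') (abs_le.mp hw)
  exact h

theorem sinRemainder_zero (a : ℝ) : sinRemainder a 0 = 0 := by simp [sinRemainder]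

theorem abs_sinRemainder_le {a w r : ℝ} (hw : |w| ≤ r) : |sinRemainder a w| ≤ r ^ 2 := by
  have h0 : 0 ≤ r := (abs_nonneg _).trans hw
  have h := abs_sinRemainder_sub_le (a := a) hw (w' := 0) (by simpa using h0)
  rw [sinRemainder_zero, sub_zero, sub_zero] at h
  nlinarith

/-- The quadratic remainder of the sine as an operation on bounded continuous functions. -/
noncomputable def sinRemainderB (q w : ℝ →ᵇ ℝ) : ℝ →ᵇ ℝ :=
  BoundedContinuousFunction.ofNormedAddCommGroup (fun x => sinRemainder (q x) (w x))
    (by unfold sinRemainder; fun_prop) (‖w‖ ^ 2) fun x => abs_sinRemainder_le (w.norm_coe_le_norm x)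

theorem sinRemainderB_apply (q w : ℝ →ᵇ ℝ) (x : ℝ) :
    sinRemainderB q w x = sinRemainder (q x) (w x) := rfl

theorem norm_sinRemainderB_le (q w : ℝ →ᵇ ℝ) : ‖sinRemainderB q w‖ ≤ ‖w‖ ^ 2 :=
  (BoundedContinuousFunction.norm_le (sq_nonneg _)).mpr fun x =>
    abs_sinRemainder_le (w.norm_coe_le_norm x)

theorem norm_sinRemainderB_sub_le {q w w' : ℝ →ᵇ ℝ} {r : ℝ} (hw : ‖w‖ ≤ r) (hw' : ‖w'‖ ≤ r) :
    ‖sinRemainderB q w - sinRemainderB q w'‖ ≤ r * ‖w - w'‖ := by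
  have h0 : 0 ≤ r := (norm_nonneg _).trans hw
  refine (BoundedContinuousFunction.norm_le (by positivity)).mpr fun x => ?_
  refine (abs_sinRemainder_sub_le ((w.norm_coe_le_norm x).trans hw)
    ((w'.norm_coe_le_norm x).trans hw')).trans ?_
  exact mul_le_mul_of_nonneg_left ((w - w').norm_coe_le_norm x) h0

/-- The right-hand side of the equation for the perturbation `w` of `q`, for the weight `W`. -/
noncomputable def sourceTerm (ε : ℝ) (q W w : ℝ →ᵇ ℝ) : ℝ →ᵇ ℝ :=
  (-ε) • (W * (q + w)) + sinRemainderB q w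

theorem sourceTerm_apply (ε : ℝ) (q W w : ℝ →ᵇ ℝ) (x : ℝ) :
    sourceTerm ε q W w x = -ε * (W x * (q x + w x)) + sinRemainder (q x) (w x) := rfl

theorem norm_sourceTerm_sub_le {ε M r : ℝ} {q W W' w w' : ℝ →ᵇ ℝ} (hW' : ‖W'‖ ≤ M)
    (hw : ‖w‖ ≤ r) (hw' : ‖w'‖ ≤ r) :
    ‖sourceTerm ε q W w - sourceTerm ε q W' w'‖ ≤
      |ε| * (‖q‖ + r) * ‖W - W'‖ + (|ε| * M + r) * ‖w - w'‖ := by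
  have h : sourceTerm ε q W w - sourceTerm ε q W' w' =
      (-ε) • ((W - W') * (q + w)) + (-ε) • (W' * (w - w')) +
        (sinRemainderB q w - sinRemainderB q w') := by
    ext x
    simp [sourceTerm]
    ring
  rw [h]
  refine (norm_add₃_le).trans ?_
  rw [norm_smul, norm_smul, norm_neg, Real.norm_eq_abs]
  have h1 : ‖(W - W') * (q + w)‖ ≤ ‖W - W'‖ * (‖q‖ + r) :=
    (norm_mul_le _ _).trans (mul_le_mul_of_nonneg_left
      ((norm_add_le _ _).trans (add_le_add_right hw _)) (norm_nonneg _))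
  have h2 : ‖W' * (w - w')‖ ≤ M * ‖w - w'‖ :=
    (norm_mul_le _ _).trans (mul_le_mul_of_nonneg_right hW' (norm_nonneg _))
  have h3 := norm_sinRemainderB_sub_le (q := q) hw hw'
  have h4 := mul_le_mul_of_nonneg_left h1 (abs_nonneg ε)
  have h5 := mul_le_mul_of_nonneg_left h2 (abs_nonneg ε)
  linarith

theorem norm_sourceTerm_zero_le {ε M : ℝ} {q W : ℝ →ᵇ ℝ} (hW : ‖W‖ ≤ M) :
    ‖sourceTerm ε q W 0‖ ≤ |ε| * (M * ‖q‖) := by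
  have h : sourceTerm ε q W 0 = (-ε) • (W * q) := by
    ext x
    simp [sourceTerm_apply, sinRemainder_zero]
  rw [h, norm_smul, norm_neg, Real.norm_eq_abs]
  exact mul_le_mul_of_nonneg_left ((norm_mul_le _ _).trans
    (mul_le_mul_of_nonneg_right hW (norm_nonneg _))) (abs_nonneg _)

theorem norm_sourceTerm_le {ε M r : ℝ} {q W w : ℝ →ᵇ ℝ} (hW : ‖W‖ ≤ M) (hw : ‖w‖ ≤ r) :
    ‖sourceTerm ε q W w‖ ≤ |ε| * (M * (‖q‖ + r)) + r ^ 2 := by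
  refine (norm_add_le _ _).trans (add_le_add ?_ ((norm_sinRemainderB_le q w).trans
    (pow_le_pow_left₀ (norm_nonneg _) hw 2)))
  rw [norm_smul, norm_neg, Real.norm_eq_abs]
  refine mul_le_mul_of_nonneg_left ((norm_mul_le _ _).trans ?_) (abs_nonneg _)
  exact mul_le_mul hW ((norm_add_le _ _).trans (add_le_add_right hw _)) (norm_nonneg _)
    ((norm_nonneg _).trans hW)

/-- Solutions of the perturbed equation by contraction, with Lipschitz dependence on the weight. -/
theorem exists_perturbation (G : (ℝ →ᵇ ℝ) →L[ℝ] (ℝ →ᵇ ℝ)) (q : ℝ →ᵇ ℝ) {M : ℝ} (hM : 0 ≤ M) :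
    ∃ ε₁ C : ℝ, 0 < ε₁ ∧ 0 < C ∧ ∀ ε, |ε| < ε₁ → ∃ w : (ℝ →ᵇ ℝ) → (ℝ →ᵇ ℝ),
      (∀ W, ‖W‖ ≤ M → ‖w W‖ ≤ C * |ε| ∧ w W = G (sourceTerm ε q W (w W))) ∧
      ∀ W W', ‖W‖ ≤ M → ‖W'‖ ≤ M → ‖w W - w W'‖ ≤ C * ‖W - W'‖ := by
  set g := ‖G‖ + 1 with hg
  have hg1 : 1 ≤ g := by have := norm_nonneg G; linarith
  have hG : ∀ f, ‖G f‖ ≤ g * ‖f‖ := fun f => (G.le_opNorm f).trans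
    (mul_le_mul_of_nonneg_right (by linarith) (norm_nonneg _))
  have hq := norm_nonneg q
  have hg0 : 0 < g := by linarith
  -- The quadratic remainder contributes `g r = 1/4` to the Lipschitz constant and, for `|ε| < ε₁`,
  -- the potential contributes at most `r/2 ≤ 1/8`. The map is then a `1/2`-contraction, and it
  -- preserves the ball because it sends `0` to a point of norm at most `r/2`.
  set r := 1 / (4 * g) with hr
  have hgr : g * r = 1 / 4 := by rw [hr]; field_simp
  have hr0 : 0 < r := by positivity
  set ε₁ := r / (2 * (g * ((M + 1) * (‖q‖ + 1)))) with hε₁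
  have hε₁0 : 0 < ε₁ := by positivity
  have hε₁e : ε₁ * (g * ((M + 1) * (‖q‖ + 1))) = r / 2 := by rw [hε₁]; field_simp
  have hr1 : r ≤ 1 / 4 := by nlinarith
  have hMq : M ≤ (M + 1) * (‖q‖ + 1) := by nlinarith
  have hMq' : M * ‖q‖ ≤ (M + 1) * (‖q‖ + 1) := by nlinarith
  -- The first summand bounds the fixed point, the second its dependence on the weight. The factor
  -- `2` absorbs the `1/2` of the contraction.
  refine ⟨ε₁, 2 * g * (M * ‖q‖) + 2 * g * ε₁ * (‖q‖ + r), hε₁0, by positivity, fun ε hε => ?_⟩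
  have hε0 := abs_nonneg ε
  have hεK : ∀ K, 0 ≤ K → K ≤ (M + 1) * (‖q‖ + 1) → g * (|ε| * K) ≤ r / 2 := by
    intro K hK0 hK
    calc g * (|ε| * K) ≤ g * (ε₁ * ((M + 1) * (‖q‖ + 1))) := by gcongr
      _ = r / 2 := by rw [← hε₁e]; ring
  have hlip : ∀ W W' w w' : ℝ →ᵇ ℝ, ‖W'‖ ≤ M → ‖w‖ ≤ r → ‖w'‖ ≤ r →
      ‖G (sourceTerm ε q W w) - G (sourceTerm ε q W' w')‖ ≤
        g * ε₁ * (‖q‖ + r) * ‖W - W'‖ + 1 / 2 * ‖w - w'‖ := by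
    intro W W' w w' hW' hw hw'
    rw [← map_sub]
    refine (hG _).trans ((mul_le_mul_of_nonneg_left
      (norm_sourceTerm_sub_le hW' hw hw') hg0.le).trans ?_)
    have h1 := hεK M hM hMq
    have h2 : (g * (|ε| * M) + g * r) * ‖w - w'‖ ≤ 1 / 2 * ‖w - w'‖ :=
      mul_le_mul_of_nonneg_right (by linarith) (norm_nonneg _)
    have h3 : g * |ε| * (‖q‖ + r) * ‖W - W'‖ ≤ g * ε₁ * (‖q‖ + r) * ‖W - W'‖ := by gcongr
    linarith
  have h0 : ∀ W : ℝ →ᵇ ℝ, ‖W‖ ≤ M → ‖G (sourceTerm ε q W 0)‖ ≤ g * (|ε| * (M * ‖q‖)) :=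
    fun W hW => (hG _).trans (mul_le_mul_of_nonneg_left (norm_sourceTerm_zero_le hW) hg0.le)
  have hself : ∀ W w : ℝ →ᵇ ℝ, ‖W‖ ≤ M → ‖w‖ ≤ r →
      ‖G (sourceTerm ε q W w)‖ ≤ g * (|ε| * (M * ‖q‖)) + 1 / 2 * ‖w‖ := by
    intro W w hW hw
    have h1 := hlip W W w 0 hW hw (by simpa using hr0.le)
    have h2 := norm_le_norm_add_norm_sub' (G (sourceTerm ε q W w)) (G (sourceTerm ε q W 0))
    have h3 := h0 W hW
    simp only [sub_self, norm_zero, mul_zero, zero_add, sub_zero] at h1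
    linarith
  have hex : ∀ W : ℝ →ᵇ ℝ, ∃ w : ℝ →ᵇ ℝ, ‖W‖ ≤ M →
      ‖w‖ ≤ r ∧ w = G (sourceTerm ε q W w) := by
    intro W
    by_cases hW : ‖W‖ ≤ M
    · have hmaps : MapsTo (fun w => G (sourceTerm ε q W w)) (Metric.closedBall 0 r)
          (Metric.closedBall 0 r) := by
        intro w hw
        rw [mem_closedBall_zero_iff] at hw ⊢
        have h1 := hself W w hW hw
        have h2 := hεK (M * ‖q‖) (by positivity) hMq'
        linarith
      have hcon : ContractingWith (1 / 2) (hmaps.restrict _ _ _) := by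
        refine ⟨by rw [← NNReal.coe_lt_coe]; norm_num, LipschitzWith.of_dist_le_mul fun a b => ?_⟩
        have h1 := hlip W W a b hW (mem_closedBall_zero_iff.mp a.2) (mem_closedBall_zero_iff.mp b.2)
        rw [Subtype.dist_eq, Subtype.dist_eq, dist_eq_norm, dist_eq_norm]
        simpa using h1
      obtain ⟨w, hw, hfix, -⟩ := hcon.exists_fixedPoint' (x := 0)
        Metric.isClosed_closedBall.isComplete hmaps (by simpa using hr0.le) (edist_ne_top _ _)
      exact ⟨w, fun _ => ⟨mem_closedBall_zero_iff.mp hw, hfix.symm⟩⟩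
    · exact ⟨0, fun h => absurd h hW⟩
  choose w hw using hex
  refine ⟨w, fun W hW => ⟨?_, (hw W hW).2⟩, fun W W' hW hW' => ?_⟩
  · have h1 := hself W (w W) hW (hw W hW).1
    rw [← (hw W hW).2] at h1
    have h2 : 0 ≤ 2 * g * ε₁ * (‖q‖ + r) * |ε| := by positivity
    nlinarith
  · have h1 := hlip W W' (w W) (w W') hW' (hw W hW).1 (hw W' hW').1
    rw [← (hw W hW).2, ← (hw W' hW').2] at h1
    have h2 : 0 ≤ 2 * g * (M * ‖q‖) * ‖W - W'‖ := by positivity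
    nlinarith

end Contraction

/-! ### Exponential decay from convexity -/

section Decay

/-- A bounded function with `d d'' ≥ d²/2` on a half line decays exponentially. -/
theorem sq_le_exp_of_mul_deriv_ge {d d' d'' : ℝ → ℝ} {a B : ℝ}
    (hd : ∀ x, HasDerivAt d (d' x) x) (hd' : ∀ x, HasDerivAt d' (d'' x) x)
    (hB : ∀ x, |d x| ≤ B) (hc : ∀ x, a ≤ x → 1 / 2 * d x ^ 2 ≤ d x * d'' x) {x : ℝ} (hx : a ≤ x) :
    d x ^ 2 ≤ B ^ 2 * Real.exp (-(x - a)) := by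
  have hB0 : 0 ≤ B := (abs_nonneg _).trans (hB 0)
  have hsq : ∀ x, d x ^ 2 ≤ B ^ 2 := fun x => sq_le_sq' (abs_le.mp (hB x)).1 (abs_le.mp (hB x)).2
  -- The square `y = d²` satisfies `y'' ≥ y`. A bounded `y` must then follow the decaying branch `y'
  -- + y ≤ 0`, and `exp x * y` decreases.
  set y : ℝ → ℝ := fun x => d x ^ 2
  set y' : ℝ → ℝ := fun x => 2 * d x * d' x
  have hy : ∀ x, HasDerivAt y (y' x) x := fun x => ((hd x).pow 2).congr_deriv (by simp [y'])
  have hy' : ∀ x, HasDerivAt y' (2 * d' x ^ 2 + 2 * (d x * d'' x)) x := fun x =>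
    (((hd x).const_mul 2).mul (hd' x)).congr_deriv (by ring)
  -- `h = y' + y` satisfies `h' ≥ h`, hence `e^{-x} h` increases
  have hh : ∀ x, HasDerivAt (fun x => Real.exp (-x) * (y' x + y x))
      (Real.exp (-x) * (2 * d' x ^ 2 + 2 * (d x * d'' x) - y x)) x := fun x =>
    ((hasDerivAt_neg x).exp.mul ((hy' x).add (hy x))).congr_deriv (by
      rw [Pi.add_apply]; ring)
  have hmono : MonotoneOn (fun x => Real.exp (-x) * (y' x + y x)) (Ici a) := by
    refine monotoneOn_of_hasDerivWithinAt_nonneg (convex_Ici a)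
      (fun x _ => (hh x).continuousAt.continuousWithinAt)
      (fun x _ => (hh x).hasDerivWithinAt) fun x hx => ?_
    rw [interior_Ici] at hx
    have h1 := hc x (le_of_lt hx)
    have : 0 ≤ 2 * d' x ^ 2 + 2 * (d x * d'' x) - y x := by
      have := sq_nonneg (d' x)
      simp only [y]; linarith
    positivity
  have hmono' : MonotoneOn y' (Ici a) := by
    refine monotoneOn_of_hasDerivWithinAt_nonneg (convex_Ici a)
      (fun x _ => (hy' x).continuousAt.continuousWithinAt)
      (fun x _ => (hy' x).hasDerivWithinAt) fun x hx => ?_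
    rw [interior_Ici] at hx
    have h1 := hc x (le_of_lt hx)
    nlinarith [sq_nonneg (d' x), sq_nonneg (d x)]
  -- a function with derivative bounded below by a positive constant is unbounded
  have hgrow : ∀ (f f' : ℝ → ℝ) (c b K : ℝ), 0 < c → (∀ x, HasDerivAt f (f' x) x) →
      (∀ x, b ≤ x → c ≤ f' x) → (∀ x, b ≤ x → f x ≤ K) → False := by
    intro f f' c b K hc hf hf' hK
    have hm : MonotoneOn (fun x => f x - c * x) (Ici b) := by
      refine monotoneOn_of_hasDerivWithinAt_nonneg (convex_Ici b)
        (f' := fun x => f' x - c * 1)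
        (fun x _ => (((hf x).sub ((hasDerivAt_id x).const_mul c))).continuousAt.continuousWithinAt)
        (fun x _ => ((hf x).sub ((hasDerivAt_id x).const_mul c)).hasDerivWithinAt) fun x hx => ?_
      rw [interior_Ici] at hx
      have := hf' x (le_of_lt hx)
      linarith
    have h0 : 0 ≤ (K - f b) / c + 1 := by
      have := hK b le_rfl
      have : 0 ≤ K - f b := by linarith
      positivity
    have h1 := hm (mem_Ici.mpr le_rfl) (mem_Ici.mpr (by linarith : b ≤ b + ((K - f b) / c + 1)))
      (by linarith)
    have h2 := hK (b + ((K - f b) / c + 1)) (by linarith)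
    have h3 : c * ((K - f b) / c) = K - f b := by field_simp
    simp only at h1
    nlinarith
  have hneg : ∀ x, a ≤ x → y' x ≤ 0 := by
    intro x hx
    by_contra! hcon
    exact hgrow y y' (y' x) x (B ^ 2) hcon hy
      (fun z hz => hmono' (mem_Ici.mpr hx) (mem_Ici.mpr (hx.trans hz)) hz) fun z _ => hsq z
  have hneg2 : ∀ x, a ≤ x → y' x + y x ≤ 0 := by
    intro x hx
    by_contra! hcon
    set c := Real.exp (-x) * (y' x + y x) with hc
    have hc0 : 0 < c := by positivity
    -- At this `z` one has `c z ≥ B²`, while `c (z + 1) ≤ c exp z ≤ y' z + y z ≤ B²`: a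
    -- contradiction.
    have hz : x ≤ |x| + B ^ 2 / c := (le_abs_self x).trans (by
      have : 0 ≤ B ^ 2 / c := by positivity
      linarith)
    set z := |x| + B ^ 2 / c
    have h1 : c ≤ Real.exp (-z) * (y' z + y z) :=
      hmono (mem_Ici.mpr hx) (mem_Ici.mpr (hx.trans hz)) hz
    have h2 := hneg z (hx.trans hz)
    have h3 : Real.exp (-z) * Real.exp z = 1 := by rw [← Real.exp_add]; simp
    have h4 : c * Real.exp z ≤ y' z + y z := by
      calc c * Real.exp z ≤ Real.exp (-z) * (y' z + y z) * Real.exp z := by gcongr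
        _ = y' z + y z := by linear_combination (y' z + y z) * h3
    have h5 : B ^ 2 / c ≤ z := by have := abs_nonneg x; linarith
    rw [div_le_iff₀ hc0] at h5
    have h6 : y z ≤ B ^ 2 := hsq z
    have h7 := mul_le_mul_of_nonneg_left (Real.add_one_le_exp z) hc0.le
    linarith
  have hanti : AntitoneOn (fun x => Real.exp x * y x) (Ici a) := by
    refine antitoneOn_of_hasDerivWithinAt_nonpos (convex_Ici a)
      (f' := fun z => Real.exp z * (y' z + y z))
      (fun z _ => ((Real.hasDerivAt_exp z).mul (hy z)).continuousAt.continuousWithinAt)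
      (fun z _ => (((Real.hasDerivAt_exp z).mul (hy z)).congr_deriv (by ring)).hasDerivWithinAt)
      fun z hz => ?_
    rw [interior_Ici] at hz
    exact mul_nonpos_of_nonneg_of_nonpos (Real.exp_pos z).le (hneg2 z (le_of_lt hz))
  have h1 := hanti (mem_Ici.mpr le_rfl) (mem_Ici.mpr hx) hx
  have h2 : Real.exp x * y x ≤ Real.exp a * B ^ 2 :=
    h1.trans (mul_le_mul_of_nonneg_left (hsq a) (Real.exp_pos a).le)
  have h3 : Real.exp (-(x - a)) * Real.exp x = Real.exp a := by rw [← Real.exp_add]; ring_nf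
  have h4 : Real.exp x * (d x ^ 2 - B ^ 2 * Real.exp (-(x - a))) ≤ 0 := by
    have : Real.exp x * y x = Real.exp x * d x ^ 2 := rfl
    linear_combination h2 - B ^ 2 * h3
  have h5 := nonpos_of_mul_nonpos_right h4 (Real.exp_pos x)
  linarith

end Decay

/-! ### Stationary solutions near `2πm` and the periodic end states -/

section StationarySolutions

theorem isStationarySolution_of_hasDerivAt {ε : ℝ} {V u u' : ℝ → ℝ} (hV : Continuous V)
    (hu : ∀ x, HasDerivAt u (u' x) x)
    (hu' : ∀ x, HasDerivAt u' (Real.sin (u x) - ε * (V x * u x)) x) :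
    IsStationarySolution ε V u := by
  have h1 : deriv u = u' := funext fun x => (hu x).deriv
  have h2 : deriv u' = fun x => Real.sin (u x) - ε * (V x * u x) := funext fun x => (hu' x).deriv
  have hc : Continuous u := continuous_iff_continuousAt.mpr fun x => (hu x).continuousAt
  refine ⟨?_, fun x => ?_⟩
  · rw [show (2 : WithTop ℕ∞) = 1 + 1 from rfl, contDiff_succ_iff_deriv, h1, contDiff_one_iff_deriv,
      h2]
    refine ⟨fun x => (hu x).differentiableAt, by simp, fun x => (hu' x).differentiableAt, ?_⟩
    fun_prop
  · rw [h1, h2]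
    ring

/-- Within `1/2` of `2πm` the cosine is at least `1 - 1/8 ≥ 3/4`. -/
theorem mul_sin_sub_sin_ge {a b : ℝ} {m : ℤ} (ha : |a - 2 * Real.pi * m| ≤ 1 / 2)
    (hb : |b - 2 * Real.pi * m| ≤ 1 / 2) :
    3 / 4 * (a - b) ^ 2 ≤ (a - b) * (Real.sin a - Real.sin b) := by
  have hmono : MonotoneOn (fun t => Real.sin t - 3 / 4 * t)
      (Icc (2 * Real.pi * m - 1 / 2) (2 * Real.pi * m + 1 / 2)) := by
    have hd : ∀ t, HasDerivAt (fun t => Real.sin t - 3 / 4 * t) (Real.cos t - 3 / 4 * 1) t :=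
      fun t => (Real.hasDerivAt_sin t).sub ((hasDerivAt_id t).const_mul (3 / 4))
    refine monotoneOn_of_hasDerivWithinAt_nonneg (convex_Icc _ _)
      (fun t _ => (hd t).continuousAt.continuousWithinAt)
      (fun t _ => (hd t).hasDerivWithinAt) fun t ht => ?_
    rw [interior_Icc] at ht
    have h1 := Real.one_sub_sq_div_two_le_cos (x := t - m * (2 * Real.pi))
    rw [Real.cos_sub_int_mul_two_pi] at h1
    have h2 : (t - m * (2 * Real.pi)) ^ 2 ≤ (1 / 2) ^ 2 :=
      sq_le_sq' (by linarith [ht.1]) (by linarith [ht.2])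
    linarith
  rw [abs_le] at ha hb
  have ha' : a ∈ Icc (2 * Real.pi * m - 1 / 2) (2 * Real.pi * m + 1 / 2) :=
    ⟨by linarith, by linarith⟩
  have hb' : b ∈ Icc (2 * Real.pi * m - 1 / 2) (2 * Real.pi * m + 1 / 2) :=
    ⟨by linarith, by linarith⟩
  rcases le_total a b with h | h
  · have h1 := hmono ha' hb' h
    simp only at h1
    nlinarith
  · have h1 := hmono hb' ha' h
    simp only at h1
    nlinarith

/-- For the difference `d` of two solutions staying near `2πm`, with `e = ε V x`, this is `d²/2 ≤ d
d''`, the hypothesis of the decay estimate. -/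
theorem half_sq_le_mul_sub {a b e : ℝ} {m : ℤ} (ha : |a - 2 * Real.pi * m| ≤ 1 / 2)
    (hb : |b - 2 * Real.pi * m| ≤ 1 / 2) (he : |e| ≤ 1 / 4) :
    1 / 2 * (a - b) ^ 2 ≤ (a - b) * ((Real.sin a - e * a) - (Real.sin b - e * b)) := by
  have h1 := mul_sin_sub_sin_ge ha hb
  have h2 : e * (a - b) ^ 2 ≤ 1 / 4 * (a - b) ^ 2 :=
    mul_le_mul_of_nonneg_right (le_of_abs_le he) (sq_nonneg _)
  linarith

/-- Without a left end, the decay estimate can be started at `x - t` for every `t ≥ 0`; then `t →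
∞`. -/
theorem eq_zero_of_mul_deriv_ge {d d' d'' : ℝ → ℝ} {B : ℝ}
    (hd : ∀ x, HasDerivAt d (d' x) x) (hd' : ∀ x, HasDerivAt d' (d'' x) x)
    (hB : ∀ x, |d x| ≤ B) (hc : ∀ x, 1 / 2 * d x ^ 2 ≤ d x * d'' x) (x : ℝ) : d x = 0 := by
  have h1 : ∀ᶠ t : ℝ in atTop, d x ^ 2 ≤ B ^ 2 * Real.exp (-t) := by
    filter_upwards [eventually_ge_atTop 0] with t ht
    have := sq_le_exp_of_mul_deriv_ge (a := x - t) hd hd' hB (fun y _ => hc y) (x := x)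
      (by linarith)
    rwa [sub_sub_cancel] at this
  have h2 := (Real.tendsto_exp_neg_atTop_nhds_zero).const_mul (B ^ 2)
  rw [mul_zero] at h2
  have h3 := ge_of_tendsto h2 h1
  exact pow_eq_zero_iff two_ne_zero |>.mp (le_antisymm h3 (sq_nonneg _))

theorem exists_boundedContinuous_of_periodic {V : ℝ → ℝ} (hV : Continuous V) {T : ℝ} (hT : T ≠ 0)
    (hper : Function.Periodic V T) : ∃ W : ℝ →ᵇ ℝ, ∀ x, W x = V x := by
  obtain ⟨M, hM⟩ := isBounded_iff_forall_norm_le.mp (hper.isBounded_of_continuous hT hV)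
  exact ⟨BoundedContinuousFunction.ofNormedAddCommGroup V hV M fun x => hM _ ⟨x, rfl⟩,
    fun x => rfl⟩

theorem h2PerNorm_le {T : ℝ} (hT : 0 ≤ T) {v v' v'' : ℝ → ℝ} {B : ℝ}
    (hv : ∀ x, HasDerivAt v (v' x) x) (hv' : ∀ x, HasDerivAt v' (v'' x) x)
    (h0 : ∀ x, |v x| ≤ B) (h1 : ∀ x, |v' x| ≤ B) (h2 : ∀ x, |v'' x| ≤ B) :
    h2PerNorm T v ≤ √(3 * T) * B := by
  have hB : 0 ≤ B := (abs_nonneg _).trans (h0 0)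
  have e1 : deriv v = v' := funext fun x => (hv x).deriv
  have e2 : deriv v' = v'' := funext fun x => (hv' x).deriv
  rw [h2PerNorm, e1, e2, ← Real.sqrt_sq hB, ← Real.sqrt_mul (by positivity)]
  refine Real.sqrt_le_sqrt ?_
  have h := intervalIntegral.norm_integral_le_of_norm_le_const (a := 0) (b := T)
    (f := fun x => v x ^ 2 + v' x ^ 2 + v'' x ^ 2) (C := 3 * B ^ 2) fun x _ => by
      have a0 := sq_le_sq' (abs_le.mp (h0 x)).1 (abs_le.mp (h0 x)).2
      have a1 := sq_le_sq' (abs_le.mp (h1 x)).1 (abs_le.mp (h1 x)).2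
      have a2 := sq_le_sq' (abs_le.mp (h2 x)).1 (abs_le.mp (h2 x)).2
      rw [Real.norm_of_nonneg (by positivity)]
      linarith
  rw [sub_zero, abs_of_nonneg hT] at h
  refine (le_abs_self _).trans (h.trans (le_of_eq (by ring)))

/-- The periodic end state near `2πm`. -/
theorem exists_endState {V : ℝ → ℝ} (hV : Continuous V) {T : ℝ} (hT : 0 < T)
    (hper : Function.Periodic V T) (m : ℤ) :
    ∃ ε₁ C : ℝ, 0 < ε₁ ∧ 0 < C ∧ ∀ ε, |ε| < ε₁ → ∃ v v' : ℝ → ℝ,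
      (∀ x, HasDerivAt v (v' x) x) ∧
      (∀ x, HasDerivAt v' (Real.sin (v x) - ε * (V x * v x)) x) ∧
      Function.Periodic v T ∧ (∀ x, |v x - 2 * Real.pi * m| ≤ C * |ε|) ∧
      (∀ x, |v' x| ≤ C * |ε|) ∧
      h2PerNorm T (fun x => v x - 2 * Real.pi * m) ≤ C * |ε| := by
  obtain ⟨W, hW⟩ := exists_boundedContinuous_of_periodic hV hT.ne' hper
  obtain ⟨G, hG⟩ := exists_bounded_inverse_sub_one
  set q : ℝ →ᵇ ℝ := BoundedContinuousFunction.const ℝ (2 * Real.pi * m) with hq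
  obtain ⟨ε₀, C₀, hε₀, hC₀, H⟩ := exists_perturbation G q (norm_nonneg W)
  have hM := norm_nonneg W
  have hqn := norm_nonneg q
  set C₁ := ‖W‖ * (‖q‖ + C₀) + C₀ ^ 2 with hC₁
  have hC₁0 : 0 ≤ C₁ := by positivity
  -- `|ε| ≤ 1` absorbs quadratic terms into linear ones. The other two bounds give `|ε V| ≤ 1/4` and
  -- distance at most `1/2` from `2πm`, as `half_sq_le_mul_sub` requires. The factor `√(3 * T)`
  -- comes from the `H²` norm over one period.
  refine ⟨min (min ε₀ 1) (min (1 / (4 * (‖W‖ + 1))) (1 / (2 * C₀))),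
    (C₀ + C₁) * (1 + √(3 * T)), by positivity, by positivity, fun ε hε => ?_⟩
  simp only [lt_min_iff] at hε
  obtain ⟨⟨h0, h1⟩, h2, h3⟩ := hε
  rw [lt_div_iff₀ (by positivity)] at h2 h3
  obtain ⟨w, hw, -⟩ := H ε h0
  obtain ⟨hwn, hwf⟩ := hw W le_rfl
  set f := sourceTerm ε q W (w W) with hf
  set w := w W
  obtain ⟨w', hd, hd', hb⟩ := hG f
  rw [← hwf] at hd hd'
  have hε0 := abs_nonneg ε
  have hfn : ‖f‖ ≤ C₁ * |ε| := by
    refine (norm_sourceTerm_le (ε := ε) (q := q) le_rfl hwn).trans ?_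
    have e1 : |ε| * (‖W‖ * (‖q‖ + C₀ * |ε|)) ≤ |ε| * (‖W‖ * (‖q‖ + C₀ * 1)) := by gcongr
    have e2 : (C₀ * |ε|) ^ 2 ≤ C₀ ^ 2 * |ε| := by
      rw [mul_pow]
      refine mul_le_mul_of_nonneg_left ?_ (sq_nonneg _)
      nlinarith
    rw [hC₁]
    linarith
  have hwx : ∀ x, |w x| ≤ C₀ * |ε| := fun x => (w.norm_coe_le_norm x).trans hwn
  have hw2 : ∀ x, w x + f x =
      Real.sin (2 * Real.pi * m + w x) - ε * (V x * (2 * Real.pi * m + w x)) := by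
    intro x
    have hs : Real.sin (2 * Real.pi * m) = 0 := by
      rw [show 2 * Real.pi * (m : ℝ) = (m : ℝ) * (2 * Real.pi) by ring]
      simpa using Real.sin_add_int_mul_two_pi 0 m
    have hc : Real.cos (2 * Real.pi * m) = 1 := by
      rw [show 2 * Real.pi * (m : ℝ) = (m : ℝ) * (2 * Real.pi) by ring]
      exact Real.cos_int_mul_two_pi m
    rw [hf, sourceTerm_apply, sinRemainder, hW, hq]
    simp only [BoundedContinuousFunction.const_apply, hs, hc]
    ring
  have hv : ∀ x, HasDerivAt (fun x => 2 * Real.pi * m + w x) (w' x) x :=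
    fun x => (hd x).const_add _
  have hv' : ∀ x, HasDerivAt w' (Real.sin (2 * Real.pi * m + w x) -
      ε * (V x * (2 * Real.pi * m + w x))) x := fun x => hw2 x ▸ hd' x
  have hlarge : ∀ c, 0 ≤ c → c ≤ C₀ + C₁ → c * |ε| ≤ (C₀ + C₁) * (1 + √(3 * T)) * |ε| := by
    intro c hc0 hc
    have := Real.sqrt_nonneg (3 * T)
    refine mul_le_mul_of_nonneg_right ?_ hε0
    nlinarith
  have hclose : ∀ x, |2 * Real.pi * m + w x - 2 * Real.pi * m| ≤ 1 / 2 := by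
    intro x
    rw [add_sub_cancel_left]
    have := hwx x
    linarith
  refine ⟨_, w', hv, hv', fun x => ?_, fun x => ?_, fun x => ?_, ?_⟩
  -- Periodicity is not built into the fixed point. It follows from uniqueness: the solution and its
  -- translate by `T` both solve the equation near `2πm`.
  · have hdd : ∀ x, HasDerivAt (fun x => w (x + T) - w x) (w' (x + T) - w' x) x := fun x =>
      ((hd (x + T)).comp_add_const x T).sub (hd x)
    have hdd' : ∀ x, HasDerivAt (fun x => w' (x + T) - w' x)
        ((Real.sin (2 * Real.pi * m + w (x + T)) -
          ε * (V (x + T) * (2 * Real.pi * m + w (x + T)))) - (Real.sin (2 * Real.pi * m + w x) -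
          ε * (V x * (2 * Real.pi * m + w x)))) x := fun x =>
      ((hv' (x + T)).comp_add_const x T).sub (hv' x)
    have hz := eq_zero_of_mul_deriv_ge hdd hdd' (B := C₀ * |ε| + C₀ * |ε|)
      (fun x => (abs_sub _ _).trans (add_le_add (hwx _) (hwx _))) (fun x => ?_) x
    · simp only at hz ⊢
      linarith
    · have he : |ε * V x| ≤ 1 / 4 := by
        rw [abs_mul, ← hW]
        have : |ε| * |W x| ≤ |ε| * ‖W‖ := mul_le_mul_of_nonneg_left (W.norm_coe_le_norm x) hε0
        linarith
      have := half_sq_le_mul_sub (hclose (x + T)) (hclose x) he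
      rw [hper x]
      simp only [add_sub_add_left_eq_sub] at this
      linarith
  · rw [add_sub_cancel_left]
    exact (hwx x).trans (hlarge _ hC₀.le (by linarith))
  · exact ((hb x).trans hfn).trans (hlarge _ hC₁0 (by linarith))
  · have e1 : C₁ * |ε| ≤ (C₀ + C₁) * |ε| := mul_le_mul_of_nonneg_right (by linarith) hε0
    have e2 : C₀ * |ε| ≤ (C₀ + C₁) * |ε| := mul_le_mul_of_nonneg_right (by linarith) hε0
    have h := h2PerNorm_le hT.le (v := fun x => w x) hd hd'
      (fun x => (hwx x).trans e2) (fun x => ((hb x).trans hfn).trans e1) (fun x => by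
        refine (abs_add_le _ _).trans ?_
        have := (f.norm_coe_le_norm x).trans hfn
        have h4 := hwx x
        rw [Real.norm_eq_abs] at this
        linarith)
    simp only [add_sub_cancel_left]
    refine h.trans ?_
    have : 0 ≤ (C₀ + C₁) * |ε| := by positivity
    linarith

end StationarySolutions

/-! ### Cut-off tails in `H²` -/

section Tails

theorem exists_bound_of_bound_off_compact {g : ℝ → ℝ} (hg : Continuous g) {b K : ℝ}
    (h : ∀ x, b ≤ |x| → |g x| ≤ K) : ∃ K', ∀ x, |g x| ≤ K' := by
  obtain ⟨C, hC⟩ := (isCompact_Icc (a := -b) (b := b)).exists_bound_of_continuousOn hg.continuousOn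
  refine ⟨max C K, fun x => ?_⟩
  rcases le_or_gt b |x| with hx | hx
  · exact (h x hx).trans (le_max_right _ _)
  · exact (hC x (abs_le.mp hx.le)).trans (le_max_left _ _)

theorem memLp_two_of_sq_le_sech {g : ℝ → ℝ} (hg : Continuous g) {b K : ℝ}
    (h : ∀ x, b ≤ |x| → g x ^ 2 ≤ K * sech x) : MemLp (fun x => (g x : ℂ)) 2 volume := by
  have hK : ∀ x, b ≤ |x| → |g x ^ 2 * Real.cosh x| ≤ K := by
    intro x hx
    have h1 := Real.cosh_pos x
    rw [abs_of_nonneg (by positivity)]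
    calc g x ^ 2 * Real.cosh x ≤ K * sech x * Real.cosh x :=
          mul_le_mul_of_nonneg_right (h x hx) h1.le
      _ = K := by rw [mul_assoc, sech_mul_cosh, mul_one]
  obtain ⟨K', hK'⟩ := exists_bound_of_bound_off_compact ((hg.pow 2).mul Real.continuous_cosh) hK
  have hi : Integrable fun x => g x ^ 2 := by
    refine (integrable_sech.const_mul K').mono' (hg.pow 2).aestronglyMeasurable
      (Eventually.of_forall fun x => ?_)
    have h1 := mul_le_mul_of_nonneg_right ((le_abs_self _).trans (hK' x)) (sech_pos x).le
    rw [Real.norm_of_nonneg (sq_nonneg _)]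
    simpa [mul_assoc, mul_comm (Real.cosh x), sech_mul_cosh] using h1
  exact ((memLp_two_iff_integrable_sq hg.aestronglyMeasurable).mpr hi).ofReal

/-- `sech` is the integrable majorant. Bounds far out suffice, because continuity takes care of the
compact part. -/
theorem memH2_of_sq_le_sech {f f' f'' : ℝ → ℝ} (hf : ∀ x, HasDerivAt f (f' x) x)
    (hf' : ∀ x, HasDerivAt f' (f'' x) x) (hc : Continuous f'') {b K : ℝ}
    (h0 : ∀ x, b ≤ |x| → f x ^ 2 ≤ K * sech x) (h1 : ∀ x, b ≤ |x| → |f' x| ≤ K)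
    (h2 : ∀ x, b ≤ |x| → f'' x ^ 2 ≤ K * sech x) : MemH2 f := by
  have hc0 : Continuous f := continuous_iff_continuousAt.mpr fun x => (hf x).continuousAt
  have hc1 : Continuous f' := continuous_iff_continuousAt.mpr fun x => (hf' x).continuousAt
  obtain ⟨M, hM⟩ := exists_bound_of_bound_off_compact hc1 h1
  have m0 := memLp_two_of_sq_le_sech hc0 h0
  refine ⟨m0.toLp _, toLp_mem_H2_of_hasDerivAt (f' := fun x => (f' x : ℂ))
    (f'' := fun x => (f'' x : ℂ)) (fun x => (hf x).ofReal_comp) (fun x => (hf' x).ofReal_comp)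
    m0 (memLp_two_of_sq_le_sech hc h2) (M := M) fun x => ?_, m0.coeFn_toLp⟩
  rw [Complex.norm_real]
  exact hM x

theorem exp_neg_abs_le_sech (x : ℝ) : Real.exp (-|x|) ≤ sech x := by
  have h1 : Real.cosh x ≤ Real.exp |x| := by
    rw [← Real.cosh_abs, Real.cosh_eq]
    have : Real.exp (-|x|) ≤ Real.exp |x| := Real.exp_le_exp.mpr (by linarith [abs_nonneg x])
    linarith
  rw [Real.exp_neg, sech]
  exact inv_anti₀ (Real.cosh_pos x) h1

/-- A cut-off right tail belongs to `H²`. -/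
theorem memH2_mul_tail {χ d d' d'' : ℝ → ℝ} (hχ : ContDiff ℝ (⊤ : ℕ∞) χ)
    (hd : ∀ x, HasDerivAt d (d' x) x) (hd' : ∀ x, HasDerivAt d' (d'' x) x)
    (hc : Continuous d'') {s : ℝ} (hs : s = 1 ∨ s = -1)
    (hone : ∀ x, 1 < s * x → χ x = 1) (hzero : ∀ x, s * x < -1 → χ x = 0) {a B K : ℝ}
    (hB : ∀ x, |d x| ≤ B) (hB' : ∀ x, |d' x| ≤ B) (hK : ∀ x, |d'' x| ≤ K * |d x|)
    (hge : ∀ x, a ≤ s * x → 1 / 2 * d x ^ 2 ≤ d x * d'' x) : MemH2 fun x => χ x * d x := by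
  have hss : s * s = 1 := by rcases hs with h | h <;> rw [h] <;> norm_num
  have hχ1 : ∀ x, HasDerivAt χ (deriv χ x) x := fun x =>
    ((hχ.differentiable (by simp)) x).hasDerivAt
  have hχ' : ContDiff ℝ (⊤ : ℕ∞) (deriv χ) := (contDiff_infty_iff_deriv.mp hχ).2
  have hχ2 : ∀ x, HasDerivAt (deriv χ) (deriv (deriv χ) x) x := fun x =>
    ((hχ'.differentiable (by simp)) x).hasDerivAt
  have hχ'' : Continuous (deriv (deriv χ)) := (contDiff_infty_iff_deriv.mp hχ').2.continuous
  have hc0 : Continuous d := continuous_iff_continuousAt.mpr fun x => (hd x).continuousAt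
  have hc1 : Continuous d' := continuous_iff_continuousAt.mpr fun x => (hd' x).continuousAt
  have hconst : ∀ x c, (∀ᶠ y in 𝓝 x, χ y = c) → deriv χ x = 0 ∧ deriv (deriv χ) x = 0 := by
    intro x c hx
    have e1 : χ =ᶠ[𝓝 x] fun _ => c := hx
    have e2 : deriv χ =ᶠ[𝓝 x] fun _ => 0 := by simpa using e1.deriv
    exact ⟨e2.self_of_nhds, by simpa using e2.deriv_eq⟩
  have hcs : Continuous fun x : ℝ => s * x := continuous_const.mul continuous_id
  have hR : ∀ x, 1 < s * x → χ x = 1 ∧ deriv χ x = 0 ∧ deriv (deriv χ) x = 0 := fun x hx =>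
    ⟨hone x hx, hconst x 1 (((isOpen_lt continuous_const hcs).eventually_mem hx).mono hone)⟩
  have hL : ∀ x, s * x < -1 → χ x = 0 ∧ deriv χ x = 0 ∧ deriv (deriv χ) x = 0 := fun x hx =>
    ⟨hzero x hx, hconst x 0 (((isOpen_lt hcs continuous_const).eventually_mem hx).mono hzero)⟩
  have hB0 : 0 ≤ B := (abs_nonneg _).trans (hB 0)
  -- decay of `d` in the direction `s`
  have hdec : ∀ x, a ≤ s * x → d x ^ 2 ≤ B ^ 2 * Real.exp (-(s * x - a)) := by
    intro x hx
    have e1 : ∀ y, HasDerivAt (fun y => d (s * y)) (s * d' (s * y)) y := fun y =>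
      ((hd (s * y)).comp y ((hasDerivAt_id y).const_mul s)).congr_deriv (by ring)
    have e2 : ∀ y, HasDerivAt (fun y => s * d' (s * y)) (d'' (s * y)) y := fun y =>
      (((hd' (s * y)).comp y ((hasDerivAt_id y).const_mul s)).const_mul s).congr_deriv
        (by linear_combination d'' (s * y) * hss)
    have := sq_le_exp_of_mul_deriv_ge e1 e2 (fun y => hB _) (a := a) (fun y hy => hge (s * y)
      (by rwa [← mul_assoc, hss, one_mul])) (x := s * x) hx
    rwa [← mul_assoc, hss, one_mul] at this
  have habs : ∀ x, |x| = s * x ∨ |x| = -(s * x) := by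
    intro x
    rcases hs with h | h <;> rcases abs_choice x with h' | h' <;> rw [h, h'] <;> simp
  have hsq : ∀ x, max a 2 ≤ s * x → d x ^ 2 ≤ B ^ 2 * Real.exp a * sech x := by
    intro x hx
    have h1 := hdec x ((le_max_left _ _).trans hx)
    have h2 : |x| = s * x := by
      have := (le_max_right a 2).trans hx
      rcases habs x with h | h
      · exact h
      · have := abs_nonneg x; linarith
    have h3 := exp_neg_abs_le_sech x
    rw [h2] at h3
    have h4 : Real.exp (-(s * x - a)) = Real.exp a * Real.exp (-(s * x)) := by
      rw [← Real.exp_add]; ring_nf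
    rw [h4, ← mul_assoc] at h1
    exact h1.trans (mul_le_mul_of_nonneg_left h3 (by positivity))
  -- The three entries bound, in this order, the function, its first derivative and its second
  -- derivative. For `|x| ≥ max a 2` the cut-off is constant, so no term with `deriv χ` contributes.
  set K₀ := max (B ^ 2 * Real.exp a) (max B (K ^ 2 * (B ^ 2 * Real.exp a)))
  have hK₀ : 0 ≤ K₀ := hB0.trans ((le_max_left _ _).trans (le_max_right _ _))
  refine memH2_of_sq_le_sech (b := max a 2) (K := K₀)
    (f' := fun x => deriv χ x * d x + χ x * d' x)
    (f'' := fun x => deriv (deriv χ) x * d x + deriv χ x * d' x +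
      (deriv χ x * d' x + χ x * d'' x))
    (fun x => (hχ1 x).mul (hd x))
    (fun x => ((hχ2 x).mul (hd x)).add ((hχ1 x).mul (hd' x)))
    (((hχ''.mul hc0).add (hχ'.continuous.mul hc1)).add
      ((hχ'.continuous.mul hc1).add (hχ.continuous.mul hc)))
    (fun x hx => ?_) (fun x hx => ?_) (fun x hx => ?_) <;>
  · have hp := (sech_pos x).le
    rcases habs x with h | h
    · have hx' : max a 2 ≤ s * x := h ▸ hx
      obtain ⟨e0, e1, e2⟩ := hR x (by have := (le_max_right a 2).trans hx'; linarith)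
      simp only [e0, e1, e2, zero_mul, one_mul, zero_add, add_zero]
      first
        | exact (hsq x hx').trans (mul_le_mul_of_nonneg_right (le_max_left _ _) hp)
        | exact (hB' x).trans ((le_max_left _ _).trans (le_max_right _ _))
        | refine le_trans ?_ (mul_le_mul_of_nonneg_right
            ((le_max_right _ _).trans (le_max_right _ _)) hp)
          have h1 := sq_le_sq' ((neg_le_neg (hK x)).trans (neg_abs_le _))
            ((le_abs_self _).trans (hK x))
          rw [mul_pow, sq_abs] at h1
          refine h1.trans ?_
          rw [mul_assoc]
          exact mul_le_mul_of_nonneg_left (hsq x hx') (sq_nonneg K)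
    · have hx' : s * x < -1 := by
        have := (le_max_right a 2).trans hx
        linarith
      obtain ⟨e0, e1, e2⟩ := hL x hx'
      simp only [e0, e1, e2, zero_mul, add_zero, abs_zero]
      first
        | exact hK₀
        | (rw [zero_pow two_ne_zero]; positivity)

end Tails

/-! ### Zeros of the reduced scalar equation -/

section Reduction

/-- A perturbation of size `ε²` of `-ε E` vanishes near every simple zero of `E`. -/
theorem exists_zero_near {E : ℝ → ℝ} {a s₀ C : ℝ} (hE : HasDerivAt E a s₀) (h0 : E s₀ = 0)
    (ha : a ≠ 0) (hC : 0 ≤ C) : ∃ ε₁ K : ℝ, 0 < ε₁ ∧ 0 < K ∧ ∀ (ε : ℝ) (g : ℝ → ℝ), |ε| < ε₁ →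
      Continuous g → (∀ s, |g s + ε * E s| ≤ C * ε ^ 2) → ∃ s, |s - s₀| ≤ K * |ε| ∧ g s = 0 := by
  have ha0 : 0 < |a| := abs_pos.mpr ha
  obtain ⟨η, hη, hball⟩ := Metric.eventually_nhds_iff_ball.mp (hE.isLittleO.def (half_pos ha0))
  -- At distance `K |ε|` the linear part of `ε E` has size `|a| K ε²`. Half of it may be lost to the
  -- differentiability error, and `K` is large enough for the other half to exceed `C ε²`.
  set K := 4 * C / |a| + 1 with hK
  have hK0 : 0 < K := by positivity
  have hKa : 4 * C ≤ |a| * K := by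
    rw [hK, mul_add, mul_div_cancel₀ _ ha0.ne']
    linarith
  refine ⟨η / K, K, by positivity, hK0, fun ε g hε hg hgE => ?_⟩
  rw [lt_div_iff₀ hK0] at hε
  rcases eq_or_ne ε 0 with rfl | hne
  · have := hgE s₀
    simp only [zero_mul, add_zero] at this
    exact ⟨s₀, by simp, abs_nonpos_iff.mp (this.trans (by simp))⟩
  have hε0 := abs_nonneg ε
  -- The factor `-(a ε)` normalizes signs: the product with `g (s₀ + t)` is approximately `ε² a² t`,
  -- so it has the sign of `t` at both ends.
  have hest : ∀ t, |t| ≤ K * |ε| →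
      |(-(a * ε)) * g (s₀ + t) - ε ^ 2 * (a ^ 2 * t)| ≤
        ε ^ 2 * (|a| ^ 2 / 2 * |t|) + |a| * |ε| * (C * ε ^ 2) := by
    intro t ht
    have h1 := hball (s₀ + t) (by
      rw [Metric.mem_ball, Real.dist_eq, add_sub_cancel_left]
      linarith)
    rw [add_sub_cancel_left, h0, sub_zero, smul_eq_mul, Real.norm_eq_abs, Real.norm_eq_abs] at h1
    have h2 := hgE (s₀ + t)
    have h3 : (-(a * ε)) * g (s₀ + t) - ε ^ 2 * (a ^ 2 * t) =
        ε ^ 2 * (a * (E (s₀ + t) - t * a)) - a * ε * (g (s₀ + t) + ε * E (s₀ + t)) := by ring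
    rw [h3]
    refine (abs_sub _ _).trans (add_le_add ?_ ?_)
    · rw [abs_mul, abs_mul, abs_of_nonneg (sq_nonneg ε)]
      refine mul_le_mul_of_nonneg_left ?_ (sq_nonneg ε)
      calc |a| * |E (s₀ + t) - t * a| ≤ |a| * (|a| / 2 * |t|) :=
            mul_le_mul_of_nonneg_left h1 ha0.le
        _ = |a| ^ 2 / 2 * |t| := by ring
    · rw [abs_mul, abs_mul]
      exact mul_le_mul_of_nonneg_left h2 (by positivity)
  have hKε : 0 ≤ K * |ε| := by positivity
  have hmain : |a| * |ε| * (C * ε ^ 2) ≤ ε ^ 2 * (|a| ^ 2 / 2 * (K * |ε|)) := by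
    have : 0 ≤ ε ^ 2 * |ε| * |a| * (|a| * K / 2 - C) := by
      have : 0 ≤ |a| * K / 2 - C := by linarith
      positivity
    linarith
  have hp := hest (K * |ε|) (by rw [abs_of_nonneg hKε])
  have hm := hest (-(K * |ε|)) (by rw [abs_neg, abs_of_nonneg hKε])
  rw [abs_neg] at hm
  rw [abs_of_nonneg hKε, abs_le, ← sq_abs a] at hp hm
  have hivt := intermediate_value_Icc (f := fun s => (-(a * ε)) * g s)
    (a := s₀ + -(K * |ε|)) (b := s₀ + K * |ε|) (by linarith)
    (continuous_const.mul hg).continuousOn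
  obtain ⟨s, hs, hgs⟩ := hivt (show (0 : ℝ) ∈ _ from ⟨by linarith [hm.2], by linarith [hp.1]⟩)
  refine ⟨s, abs_le.mpr ⟨by linarith [hs.1], by linarith [hs.2]⟩, ?_⟩
  exact (mul_eq_zero.mp hgs).resolve_left (neg_ne_zero.mpr (mul_ne_zero ha hne))

end Reduction

/-! ### Derivative of the effective potential -/

section EffectivePotential

/-- Translation of a bounded continuous function. -/
noncomputable def translateB (W : ℝ →ᵇ ℝ) (s : ℝ) : ℝ →ᵇ ℝ :=
  W.compContinuous ⟨fun x => x + s, by fun_prop⟩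

theorem translateB_apply (W : ℝ →ᵇ ℝ) (s x : ℝ) : translateB W s x = W (x + s) := rfl

theorem norm_translateB_le (W : ℝ →ᵇ ℝ) (s : ℝ) : ‖translateB W s‖ ≤ ‖W‖ :=
  (BoundedContinuousFunction.norm_le (norm_nonneg _)).mpr fun x => W.norm_coe_le_norm (x + s)

theorem norm_translateB_sub_le {W W' : ℝ →ᵇ ℝ} (hW : ∀ x, HasDerivAt W (W' x) x) (s t : ℝ) :
    ‖translateB W s - translateB W t‖ ≤ ‖W'‖ * |s - t| := by
  refine (BoundedContinuousFunction.norm_le (by positivity)).mpr fun x => ?_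
  have h := Convex.norm_image_sub_le_of_norm_hasDerivWithin_le (s := univ) (x := x + t)
    (y := x + s) (fun y _ => (hW y).hasDerivWithinAt) (fun y _ => W'.norm_coe_le_norm y)
    convex_univ (mem_univ _) (mem_univ _)
  rwa [add_sub_add_left_eq_sub, Real.norm_eq_abs (s - t)] at h

variable {k l : ℤ}

/-- The kink as a bounded continuous function. -/
noncomputable def kinkB (k : ℤ) (hl : l = 1 ∨ l = -1) : ℝ →ᵇ ℝ :=
  BoundedContinuousFunction.ofNormedAddCommGroup (kink k l) (continuous_kink hl) _ (kink_bound k l)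

theorem kinkB_apply (hl : l = 1 ∨ l = -1) (x : ℝ) : kinkB k hl x = kink k l x := rfl

/-- The bounded continuous function `tanh`. -/
noncomputable def tanhB : ℝ →ᵇ ℝ :=
  BoundedContinuousFunction.ofNormedAddCommGroup Real.tanh continuous_tanh 1 abs_tanh_le_one

theorem tanhB_apply (x : ℝ) : tanhB x = Real.tanh x := rfl

theorem sechPairing_sub (f g : ℝ →ᵇ ℝ) : sechPairing (f - g) = sechPairing f - sechPairing g := by
  have h : f - g = f + (-1 : ℝ) • g := by module
  rw [h, sechPairing_add, sechPairing_smul]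
  ring

theorem effectivePotential_eq (W : ℝ →ᵇ ℝ) (hl : l = 1 ∨ l = -1) (s : ℝ) :
    effectivePotential W k l s = 2 * l * sechPairing (translateB W s * kinkB k hl) := by
  rw [effectivePotential, sechPairing, ← integral_const_mul]
  refine integral_congr_ae (Eventually.of_forall fun x => ?_)
  simp only [BoundedContinuousFunction.coe_mul, Pi.mul_apply, translateB_apply, kinkB_apply,
    deriv_kink hl]
  ring

/-- The derivative of `q q'`, for the kink `q`, divided by `sech`. -/
noncomputable def kinkSqDerivB (k : ℤ) (hl : l = 1 ∨ l = -1) : ℝ →ᵇ ℝ :=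
  (4 : ℝ) • sechB - (2 * l : ℝ) • (tanhB * kinkB k hl)

theorem tendsto_mul_sech {f : ℝ → ℝ} {M : ℝ} (hM : ∀ x, |f x| ≤ M) :
    Tendsto (fun x => f x * sech x) atTop (𝓝 0) ∧ Tendsto (fun x => f x * sech x) atBot (𝓝 0) := by
  have h : ∀ x, |f x * sech x| ≤ M * sech x := fun x => by
    rw [abs_mul, abs_of_pos (sech_pos x)]
    exact mul_le_mul_of_nonneg_right (hM x) (sech_pos x).le
  constructor
  · exact squeeze_zero_norm h (by simpa using tendsto_sech_atTop.const_mul M)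
  · exact squeeze_zero_norm h (by simpa using tendsto_sech_atBot.const_mul M)

/-- Integration by parts for a derivative which is bounded by `sech`. -/
theorem sechPairing_eq_zero_of_hasDerivAt {F : ℝ → ℝ} {f : ℝ →ᵇ ℝ} {M : ℝ}
    (hF : ∀ x, HasDerivAt (fun x => F x * sech x) (f x * sech x) x) (hM : ∀ x, |F x| ≤ M) :
    sechPairing f = 0 := by
  have h := integral_of_hasDerivAt_of_tendsto hF (integrable_mul_sech f)
    (tendsto_mul_sech hM).2 (tendsto_mul_sech hM).1
  rw [sechPairing, h, sub_zero]

/-- Differentiation under the integral puts the derivative on `W`; integration by parts moves it to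
`q q'`. In this form the derivative contains `W` itself and can be matched with the eigenvalue
expansion. -/
theorem hasDerivAt_effectivePotential {W W' : ℝ →ᵇ ℝ} (hW : ∀ x, HasDerivAt W (W' x) x)
    (hl : l = 1 ∨ l = -1) (s : ℝ) : HasDerivAt (effectivePotential W k l)
      (-sechPairing (translateB W s * kinkSqDerivB k hl)) s := by
  have h1 : HasDerivAt (fun s => ∫ x, W (x + s) * (kink k l x * (2 * l * sech x)))
      (∫ x, W' (x + s) * (kink k l x * (2 * l * sech x))) s := by
    have hi : Integrable fun x => kink k l x * (2 * l * sech x) := by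
      refine ((integrable_mul_sech (kinkB k hl)).const_mul (2 * l : ℝ)).congr
        (Eventually.of_forall fun x => ?_)
      simp only [kinkB_apply]
      ring
    refine (hasDerivAt_integral_of_dominated_loc_of_deriv_le (s := univ)
      (F := fun s x => W (x + s) * (kink k l x * (2 * l * sech x)))
      (F' := fun s x => W' (x + s) * (kink k l x * (2 * l * sech x)))
      (bound := fun x => ‖W'‖ * |kink k l x * (2 * l * sech x)|) univ_mem
      (Eventually.of_forall fun t => ?_) ?_ ?_ (Eventually.of_forall fun x t _ => ?_) ?_
      (Eventually.of_forall fun x t _ => ?_)).2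
    · exact (W.continuous.comp (continuous_add_const t)).aestronglyMeasurable.mul hi.1
    · exact hi.bdd_mul (c := ‖W‖) (W.continuous.comp (continuous_add_const s)).aestronglyMeasurable
        (Eventually.of_forall fun x => W.norm_coe_le_norm _)
    · exact (W'.continuous.comp (continuous_add_const s)).aestronglyMeasurable.mul hi.1
    · rw [norm_mul]
      exact mul_le_mul_of_nonneg_right (W'.norm_coe_le_norm _) (abs_nonneg _)
    · exact hi.abs.const_mul _
    · exact ((hW (x + t)).comp_const_add x t).mul_const _
  have h2 : effectivePotential W k l =
      fun s => ∫ x, W (x + s) * (kink k l x * (2 * l * sech x)) := by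
    funext s
    rw [effectivePotential]
    simp only [deriv_kink hl, mul_assoc]
  have h3 : ∫ x, W' (x + s) * (kink k l x * (2 * l * sech x)) =
      sechPairing ((2 * l : ℝ) • (translateB W' s * kinkB k hl)) := by
    rw [sechPairing]
    refine integral_congr_ae (Eventually.of_forall fun x => ?_)
    simp only [BoundedContinuousFunction.coe_smul, BoundedContinuousFunction.coe_mul, Pi.mul_apply,
      translateB_apply, kinkB_apply, smul_eq_mul]
    ring
  have h4 : sechPairing ((2 * l : ℝ) • (translateB W' s * kinkB k hl) +
      translateB W s * kinkSqDerivB k hl) = 0 := by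
    refine sechPairing_eq_zero_of_hasDerivAt
      (F := fun x => ((2 * l : ℝ) • (translateB W s * kinkB k hl)) x) (fun x => ?_)
      (((2 * l : ℝ) • (translateB W s * kinkB k hl)).norm_coe_le_norm)
    have hw := (hW (x + s)).comp_add_const x s
    have h := (((hw.mul (hasDerivAt_kink (k := k) hl x)).const_mul (2 * l : ℝ)).mul
      (hasDerivAt_sech x))
    refine h.congr_deriv ?_
    simp only [kinkSqDerivB, BoundedContinuousFunction.coe_smul, BoundedContinuousFunction.coe_mul,
      BoundedContinuousFunction.coe_add, BoundedContinuousFunction.coe_sub, Pi.mul_apply,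
      Pi.add_apply, Pi.sub_apply, translateB_apply, kinkB_apply, smul_eq_mul, sechB_apply,
      tanhB_apply]
    linear_combination (4 * W (x + s) * sech x ^ 2) * sign_mul_self hl
  rw [sechPairing_add] at h4
  rw [h2]
  exact h1.congr_deriv (by rw [h3]; linarith)

end EffectivePotential

/-! ### Lyapunov–Schmidt reduction for the front -/

section Front

variable {k l : ℤ}

/-- The reduced problem: a perturbation of the translated kink solving the stationary equation. -/
theorem exists_front {W W' : ℝ →ᵇ ℝ} (hW : ∀ x, HasDerivAt W (W' x) x) (hl : l = 1 ∨ l = -1)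
    {s₀ : ℝ} (h0 : effectivePotential W k l s₀ = 0)
    (h1 : deriv (effectivePotential W k l) s₀ ≠ 0) :
    ∃ ε₁ C : ℝ, 0 < ε₁ ∧ 0 < C ∧ ∀ ε, |ε| < ε₁ → ∃ (s : ℝ) (w : ℝ →ᵇ ℝ) (w' : ℝ → ℝ) (B : ℝ),
      |s - s₀| ≤ C * |ε| ∧ ‖w‖ ≤ C * |ε| ∧ (∀ x, HasDerivAt w (w' x) x) ∧
      (∀ x, HasDerivAt w' ((1 - 2 * sech x ^ 2) * w x +
        sourceTerm ε (kinkB k hl) (translateB W s) w x) x) ∧ ∀ x, |w' x| ≤ B := by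
  obtain ⟨G, hG⟩ := exists_bounded_inverse_kink
  set q := kinkB k hl with hq
  obtain ⟨ε₀, C₀, hε₀, hC₀, H⟩ := exists_perturbation G q (norm_nonneg W)
  set I := ∫ x, sech x
  have hI : 0 ≤ I := integral_nonneg fun x => (sech_pos x).le
  have hWn := norm_nonneg W
  obtain ⟨ε₂, K, hε₂, hK, HZ⟩ := exists_zero_near
    (differentiableAt_of_deriv_ne_zero h1).hasDerivAt h0 h1
    (C := 2 * (I * (‖W‖ * C₀ + C₀ ^ 2))) (by positivity)
  refine ⟨min ε₀ ε₂, max C₀ K, by positivity, by positivity, fun ε hε => ?_⟩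
  obtain ⟨w, hw, hwlip⟩ := H ε (hε.trans_le (min_le_left _ _))
  have hε0 := abs_nonneg ε
  have hsgn : |(2 * l : ℝ)| = 2 := by rw [abs_mul, abs_sign hl]; simp
  -- The bifurcation function of the shift. The correction depends on `s` only through the
  -- translated weight, and in a Lipschitz way, which gives the continuity needed for the
  -- intermediate value theorem.
  have hcont : Continuous (fun s : ℝ => 2 * l * sechPairing (sourceTerm ε q (translateB W s) (w (translateB W s)))) := by
    refine continuous_const.mul ?_
    have hlip : ∀ s t, |sechPairing (sourceTerm ε q (translateB W s) (w (translateB W s))) -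
        sechPairing (sourceTerm ε q (translateB W t) (w (translateB W t)))| ≤
        I * ((|ε| * (‖q‖ + C₀ * |ε|) + (|ε| * ‖W‖ + C₀ * |ε|) * C₀) * ‖W'‖) * |s - t| := by
      intro s t
      rw [← sechPairing_sub]
      refine (abs_sechPairing_le _).trans ?_
      have e1 := norm_sourceTerm_sub_le (ε := ε) (q := q) (W := translateB W s)
        (norm_translateB_le W t)
        (hw _ (norm_translateB_le W s)).1 (hw _ (norm_translateB_le W t)).1
      have e2 := hwlip _ _ (norm_translateB_le W s) (norm_translateB_le W t)
      have e3 := norm_translateB_sub_le hW s t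
      rw [mul_assoc I]
      refine mul_le_mul_of_nonneg_left (e1.trans ?_) hI
      calc _ ≤ |ε| * (‖q‖ + C₀ * |ε|) * ‖translateB W s - translateB W t‖ +
            (|ε| * ‖W‖ + C₀ * |ε|) * (C₀ * ‖translateB W s - translateB W t‖) := by gcongr
        _ = (|ε| * (‖q‖ + C₀ * |ε|) + (|ε| * ‖W‖ + C₀ * |ε|) * C₀) *
            ‖translateB W s - translateB W t‖ := by ring
        _ ≤ (|ε| * (‖q‖ + C₀ * |ε|) + (|ε| * ‖W‖ + C₀ * |ε|) * C₀) * (‖W'‖ * |s - t|) := by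
            gcongr
        _ = _ := by ring
    exact (LipschitzWith.of_dist_le' hlip).continuous
  have hexp : ∀ s : ℝ, |2 * l * sechPairing (sourceTerm ε q (translateB W s) (w (translateB W s))) +
      ε * effectivePotential W k l s| ≤ 2 * (I * (‖W‖ * C₀ + C₀ ^ 2)) * ε ^ 2 := by
    intro s
    set w₁ := w (translateB W s)
    have hwn : ‖w₁‖ ≤ C₀ * |ε| := (hw _ (norm_translateB_le W s)).1
    have e1 : sourceTerm ε q (translateB W s) w₁ = (-ε) • (translateB W s * q) +
        ((-ε) • (translateB W s * w₁) + sinRemainderB q w₁) := by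
      rw [sourceTerm, mul_add, smul_add, add_assoc]
    have e2 : ‖(-ε) • (translateB W s * w₁) + sinRemainderB q w₁‖ ≤
        (‖W‖ * C₀ + C₀ ^ 2) * ε ^ 2 := by
      refine (norm_add_le _ _).trans ?_
      rw [norm_smul, norm_neg, Real.norm_eq_abs]
      have a1 : ‖translateB W s * w₁‖ ≤ ‖W‖ * (C₀ * |ε|) := (norm_mul_le _ _).trans
        (mul_le_mul (norm_translateB_le W s) hwn (norm_nonneg _) hWn)
      have a2 := (norm_sinRemainderB_le q w₁).trans (pow_le_pow_left₀ (norm_nonneg _) hwn 2)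
      have a3 := mul_le_mul_of_nonneg_left a1 hε0
      rw [mul_pow, sq_abs] at a2
      have a4 : |ε| * (‖W‖ * (C₀ * |ε|)) = ‖W‖ * C₀ * ε ^ 2 := by rw [← sq_abs ε]; ring
      linarith
    rw [effectivePotential_eq W hl, e1, sechPairing_add, sechPairing_smul]
    have e3 : 2 * l * (-ε * sechPairing (translateB W s * q) +
        sechPairing ((-ε) • (translateB W s * w₁) + sinRemainderB q w₁)) +
        ε * (2 * l * sechPairing (translateB W s * kinkB k hl)) =
        2 * l * sechPairing ((-ε) • (translateB W s * w₁) + sinRemainderB q w₁) := by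
      rw [hq]; ring
    rw [e3, abs_mul, hsgn, mul_assoc, mul_assoc]
    refine mul_le_mul_of_nonneg_left ((abs_sechPairing_le _).trans ?_) zero_le_two
    exact mul_le_mul_of_nonneg_left e2 hI
  obtain ⟨s, hs, hgs⟩ := HZ ε _ (hε.trans_le (min_le_right _ _)) hcont hexp
  -- At this `s` the solvability condition holds, so the projected equation solved by the
  -- contraction is the full equation.
  have hg0 : sechPairing (sourceTerm ε q (translateB W s) (w (translateB W s))) = 0 := by
    refine (mul_eq_zero.mp hgs).resolve_left fun h => ?_
    rw [h, abs_zero] at hsgn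
    norm_num at hsgn
  obtain ⟨hwn, hwf⟩ := hw _ (norm_translateB_le W s)
  obtain ⟨w', hd, hd', B, hB⟩ := hG (sourceTerm ε q (translateB W s) (w (translateB W s)))
  rw [← hwf] at hd hd'
  refine ⟨s, w (translateB W s), w', B, hs.trans ?_, hwn.trans ?_, hd, fun x => ?_, hB⟩
  · exact mul_le_mul_of_nonneg_right (le_max_right _ _) hε0
  · exact mul_le_mul_of_nonneg_right (le_max_left _ _) hε0
  · refine (hd' x).congr_deriv ?_
    rw [hg0]
    ring

end Front

/-! ### Expansion of the critical eigenvalue -/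

section EigenvalueExpansion

variable {k l : ℤ}

/-- The linear identity behind the expansion of the critical eigenvalue: `tanh sech` is tested
against the equation for the perturbation. -/
theorem sechPairing_tanh_identity {w f : ℝ →ᵇ ℝ} {w' : ℝ → ℝ} {B : ℝ}
    (hw : ∀ x, HasDerivAt w (w' x) x)
    (hw' : ∀ x, HasDerivAt w' ((1 - 2 * sech x ^ 2) * w x + f x) x) (hB : ∀ x, |w' x| ≤ B) :
    sechPairing ((-4 : ℝ) • (tanhB * sechB * sechB * w) - tanhB * f) = 0 := by
  refine sechPairing_eq_zero_of_hasDerivAt (M := ‖w‖ + B)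
    -- With `ψ = sech' = -tanh sech`, the function `F sech` is the Wronskian `ψ w' - ψ' w`; its
    -- integrated derivative is Green's identity for `∂² - 1 + 2 sech²`.
    (F := fun x => (2 * sech x ^ 2 - 1) * w x - Real.tanh x * w' x) (fun x => ?_) fun x => ?_
  · have h := ((((((hasDerivAt_sech x).pow 2).const_mul 2).sub_const 1).mul (hw x)).sub
      ((hasDerivAt_tanh x).mul (hw' x))).mul (hasDerivAt_sech x)
    refine h.congr_deriv ?_
    simp only [BoundedContinuousFunction.coe_smul, BoundedContinuousFunction.coe_mul,
      BoundedContinuousFunction.coe_sub, Pi.mul_apply, Pi.sub_apply, Pi.pow_apply, smul_eq_mul,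
      sechB_apply, tanhB_apply]
    linear_combination (sech x * w' x) * tanh_sq x
  · have h1 : |2 * sech x ^ 2 - 1| ≤ 1 := by
      have e1 := sech_pos x
      have e2 := sech_le_one x
      rw [abs_le]
      constructor <;> nlinarith
    refine (abs_sub _ _).trans (add_le_add ?_ ?_)
    · rw [abs_mul]
      calc _ ≤ 1 * ‖w‖ := mul_le_mul h1 (w.norm_coe_le_norm x) (abs_nonneg _) zero_le_one
        _ = ‖w‖ := one_mul _
    · rw [abs_mul]
      calc _ ≤ 1 * B := mul_le_mul (abs_tanh_le_one x) (hB x) (abs_nonneg _) zero_le_one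
        _ = B := one_mul _

/-- The difference of the potentials of the linearizations about the perturbed and the exact
kink. -/
noncomputable def potentialDiffB (ε : ℝ) (q W w : ℝ →ᵇ ℝ) : ℝ →ᵇ ℝ :=
  ε • W - BoundedContinuousFunction.ofNormedAddCommGroup
    (fun x => Real.cos (q x + w x) - Real.cos (q x)) (by fun_prop) ‖w‖
    fun x => (abs_cos_add_sub_cos_le _ _).trans (w.norm_coe_le_norm x)

theorem potentialDiffB_apply (ε : ℝ) (q W w : ℝ →ᵇ ℝ) (x : ℝ) :
    potentialDiffB ε q W w x = ε * W x - (Real.cos (q x + w x) - Real.cos (q x)) := rfl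

theorem norm_potentialDiffB_le (ε : ℝ) (q W w : ℝ →ᵇ ℝ) :
    ‖potentialDiffB ε q W w‖ ≤ |ε| * ‖W‖ + ‖w‖ := by
  refine (norm_sub_le _ _).trans (add_le_add (by rw [norm_smul, Real.norm_eq_abs]) ?_)
  exact BoundedContinuousFunction.norm_ofNormedAddCommGroup_le _ (norm_nonneg _) _

theorem norm_tanhB_le : ‖tanhB‖ ≤ 1 :=
  (BoundedContinuousFunction.norm_le zero_le_one).mpr abs_tanh_le_one

theorem norm_sechB_le : ‖sechB‖ ≤ 1 :=
  (BoundedContinuousFunction.norm_le zero_le_one).mpr abs_sech_le_one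

/-- To first order the potential changes by `ε W + sin q w`, and `sin q = -2 l tanh sech`. Up to the
factor `l/2`, the `w` term is the one in `sechPairing_tanh_identity`, which trades it for the
source, that is, for `-ε W q` up to second order. Hence `w` is eliminated without being computed,
and `sech - (l/2) tanh q` is a quarter of `kinkSqDerivB`. -/
theorem abs_sechPairing_potentialDiff_le (hl : l = 1 ∨ l = -1) {ε B : ℝ} {W w : ℝ →ᵇ ℝ}
    {w' : ℝ → ℝ} (hw : ∀ x, HasDerivAt w (w' x) x)
    (hw' : ∀ x, HasDerivAt w' ((1 - 2 * sech x ^ 2) * w x + sourceTerm ε (kinkB k hl) W w x) x)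
    (hB : ∀ x, |w' x| ≤ B) :
    |sechPairing (potentialDiffB ε (kinkB k hl) W w * sechB) -
      ε / 4 * sechPairing (W * kinkSqDerivB k hl)| ≤
      (∫ x, sech x) * (|ε| * ‖W‖ * ‖w‖ + 2 * ‖w‖ ^ 2) := by
  set q := kinkB k hl with hq
  set H : ℝ →ᵇ ℝ := (-4 : ℝ) • (tanhB * sechB * sechB * w) - tanhB * sourceTerm ε q W w with hH
  -- The quadratic remainder of the cosine at `q` is that of the sine at `q + π/2`.
  set R := sinRemainderB (q + BoundedContinuousFunction.const ℝ (Real.pi / 2)) w with hR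
  set N := sinRemainderB q w with hN
  set Z : ℝ →ᵇ ℝ := (l / 2 : ℝ) • (tanhB * ((-ε) • (W * w) + N)) - R * sechB with hZ
  have hH0 : sechPairing H = 0 := sechPairing_tanh_identity hw hw' hB
  have hdec : potentialDiffB ε q W w * sechB =
      (ε / 4) • (W * kinkSqDerivB k hl) + ((l / 2 : ℝ) • H + Z) := by
    ext x
    have hs := (cos_kink (k := k) hl x).2
    have hRx : R x = Real.cos (q x + w x) - Real.cos (q x) + Real.sin (q x) * w x := by
      rw [hR, sinRemainderB_apply, sinRemainder]
      simp only [BoundedContinuousFunction.coe_add, Pi.add_apply,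
        BoundedContinuousFunction.const_apply]
      rw [add_right_comm, Real.sin_add_pi_div_two, Real.sin_add_pi_div_two,
        Real.cos_add_pi_div_two]
      ring
    have hNx : sourceTerm ε q W w x = -ε * (W x * (q x + w x)) + N x := rfl
    simp only [hZ, hH, kinkSqDerivB, BoundedContinuousFunction.coe_smul,
      BoundedContinuousFunction.coe_mul, BoundedContinuousFunction.coe_sub,
      BoundedContinuousFunction.coe_add, Pi.mul_apply, Pi.sub_apply, Pi.add_apply, smul_eq_mul,
      sechB_apply, tanhB_apply, potentialDiffB_apply, hNx, hRx, ← hq]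
    have hqx : q x = kink k l x := rfl
    rw [← hqx] at hs
    rw [hs]
    ring
  have hZn : ‖Z‖ ≤ |ε| * ‖W‖ * ‖w‖ + 2 * ‖w‖ ^ 2 := by
    refine (norm_sub_le _ _).trans ?_
    rw [norm_smul, Real.norm_eq_abs, abs_div, abs_sign hl, abs_two]
    have a1 : ‖tanhB * ((-ε) • (W * w) + N)‖ ≤ 1 * (|ε| * (‖W‖ * ‖w‖) + ‖w‖ ^ 2) := by
      refine (norm_mul_le _ _).trans (mul_le_mul norm_tanhB_le ((norm_add_le _ _).trans
        (add_le_add ?_ (norm_sinRemainderB_le q w))) (norm_nonneg _) zero_le_one)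
      rw [norm_smul, norm_neg, Real.norm_eq_abs]
      exact mul_le_mul_of_nonneg_left (norm_mul_le _ _) (abs_nonneg _)
    have a2 : ‖R * sechB‖ ≤ ‖w‖ ^ 2 * 1 := (norm_mul_le _ _).trans
      (mul_le_mul (norm_sinRemainderB_le _ _) norm_sechB_le (norm_nonneg _) (sq_nonneg _))
    have a3 : 0 ≤ |ε| * ‖W‖ * ‖w‖ := by positivity
    have a4 : 0 ≤ ‖w‖ ^ 2 := sq_nonneg _
    linarith
  rw [hdec, sechPairing_add, sechPairing_smul, sechPairing_add, sechPairing_smul, hH0, mul_zero,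
    zero_add, add_sub_cancel_left]
  exact (abs_sechPairing_le Z).trans (mul_le_mul_of_nonneg_left hZn
    (integral_nonneg fun x => (sech_pos x).le))

theorem abs_kink_sub_le (hl : l = 1 ∨ l = -1) (x y : ℝ) :
    |kink k l x - kink k l y| ≤ 2 * |x - y| := by
  refine Convex.norm_image_sub_le_of_norm_hasDerivWithin_le (s := univ) (C := 2)
    (fun z _ => (hasDerivAt_kink (k := k) hl z).hasDerivWithinAt) (fun z _ => ?_)
    convex_univ (mem_univ _) (mem_univ _)
  have := abs_sech_le_one z
  rw [Real.norm_eq_abs, abs_mul, abs_mul, abs_sign hl, abs_two]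
  linarith

/-- The perturbed front together with the spectrum of its linearization. -/
theorem exists_front_with_spectrum {W W' : ℝ →ᵇ ℝ} (hW : ∀ x, HasDerivAt W (W' x) x)
    (hl : l = 1 ∨ l = -1) {s₀ : ℝ} (h0 : effectivePotential W k l s₀ = 0)
    (h1 : deriv (effectivePotential W k l) s₀ ≠ 0) :
    ∃ ε₁ C : ℝ, 0 < ε₁ ∧ 0 < C ∧ ∀ ε, |ε| < ε₁ → ∃ (u u' : ℝ → ℝ) (ev a B : ℝ),
      (∀ x, HasDerivAt u (u' x) x) ∧
      (∀ x, HasDerivAt u' (Real.sin (u x) - ε * (W x * u x)) x) ∧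
      (∀ x, |u x| ≤ B) ∧ (∀ x, |u' x| ≤ B) ∧ (∀ x, |u x - kink k l (x - s₀)| ≤ C * |ε|) ∧
      (∀ x, x ≤ -a → |u x - 2 * Real.pi * k| ≤ 1 / 2) ∧
      (∀ x, a ≤ x → |u x - 2 * Real.pi * (k + l : ℤ)| ≤ 1 / 2) ∧
      opSpectrum (linearization ε W u) ⊆ {z | ∃ x : ℝ, x ≤ -(1 / 8) ∧ z = x} ∪ {(ev : ℂ)} ∧
      IsSimpleEigenvalue (linearization ε W u) (ev : ℂ) ∧
      |ev - (-ε * (deriv (effectivePotential W k l) s₀ / 8))| ≤ C * ε ^ 2 := by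
  obtain ⟨ε₀, C, hε₀, hC, H⟩ := exists_front hW hl h0 h1
  set I := ∫ x, sech x
  have hI : 0 ≤ I := integral_nonneg fun x => (sech_pos x).le
  have hM := norm_nonneg W
  have hM' := norm_nonneg W'
  set P := kinkSqDerivB k hl with hP
  have hPn := norm_nonneg P
  set C₁ := I * (‖W‖ * C + 2 * C ^ 2) with hC₁
  set C₂ := I * (‖W'‖ * C * ‖P‖) with hC₂
  have hC₁0 : 0 ≤ C₁ := by positivity
  have hC₂0 : 0 ≤ C₂ := by positivity
  -- The threshold keeps the perturbation of the potential below `1/200`. In the constant, `3 C`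
  -- covers the shift (twice `|s - s₀|`) and `w`, the term `8 (‖W‖ + C)²` is the eigenvalue error,
  -- `C₁` the expansion error and `C₂` the passage from `s` to `s₀`.
  refine ⟨min ε₀ (1 / (200 * (‖W‖ + C))), 3 * C + 8 * (‖W‖ + C) ^ 2 + C₁ + C₂, by positivity,
    by positivity, fun ε hε => ?_⟩
  obtain ⟨s, w, w', B, hs, hwn, hw, hw', hB⟩ := H ε (hε.trans_le (min_le_left _ _))
  have hε1 := hε.trans_le (min_le_right _ _)
  rw [lt_div_iff₀ (by positivity)] at hε1
  have hε0 := abs_nonneg ε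
  set q := kinkB k hl with hq
  set D := potentialDiffB ε q (translateB W s) w with hD
  have hwx : ∀ x, |w x| ≤ C * |ε| := fun x => (w.norm_coe_le_norm x).trans hwn
  have hw4 : C * |ε| ≤ 1 / 200 := by
    have : 0 ≤ ‖W‖ * |ε| := by positivity
    linarith
  have hDn : ‖D‖ ≤ (‖W‖ + C) * |ε| := by
    refine (norm_potentialDiffB_le _ _ _ _).trans ?_
    have := mul_le_mul_of_nonneg_left (norm_translateB_le W s) hε0
    linarith
  have hqd : ∀ x, HasDerivAt q (2 * l * sech x) x := fun x => hasDerivAt_kink hl x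
  have hqd' : ∀ x, HasDerivAt (fun x => 2 * l * sech x) (Real.sin (q x)) x := fun x => by
    have h := (hasDerivAt_sech x).const_mul (2 * l : ℝ)
    refine h.congr_deriv ?_
    rw [hq, kinkB_apply, (cos_kink hl x).2]
    ring
  have hu : ∀ x, HasDerivAt (fun x => q (x - s) + w (x - s))
      (2 * l * sech (x - s) + w' (x - s)) x := fun x =>
    ((hqd (x - s)).comp_sub_const x s).add ((hw (x - s)).comp_sub_const x s)
  have hu' : ∀ x, HasDerivAt (fun x => 2 * l * sech (x - s) + w' (x - s))
      (Real.sin (q (x - s) + w (x - s)) - ε * (W x * (q (x - s) + w (x - s)))) x := fun x => by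
    have h := ((hqd' (x - s)).comp_sub_const x s).add ((hw' (x - s)).comp_sub_const x s)
    refine h.congr_deriv ?_
    have hc := (cos_kink (k := k) hl (x - s)).1
    rw [sourceTerm_apply, sinRemainder, translateB_apply, sub_add_cancel, hq, kinkB_apply, hc]
    ring
  have hpot : ∀ x, ε * W x - Real.cos (q (x - s) + w (x - s)) - kinkPotential s x = D (x - s) := by
    intro x
    have hc := (cos_kink (k := k) hl (x - s)).1
    rw [hD, potentialDiffB_apply, translateB_apply, sub_add_cancel, hq, kinkB_apply, hc,
      kinkPotential]
    ring
  have hcu : Continuous fun x => q (x - s) + w (x - s) :=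
    continuous_iff_continuousAt.mpr fun x => (hu x).continuousAt
  obtain ⟨ev, hev, hsimple, hspec⟩ := exists_spectrum_near_kink
    (q := fun x => ε * W x - Real.cos (q (x - s) + w (x - s))) (by fun_prop) s
    ((‖W‖ + C) * |ε|) (by linarith) fun x => by
      rw [hpot]
      exact (D.norm_coe_le_norm _).trans hDn
  have hint : ∫ x, (ε * W x - Real.cos (q (x - s) + w (x - s)) - kinkPotential s x) *
      sech (x - s) ^ 2 = sechPairing (D * sechB) := by
    simp only [hpot]
    rw [integral_sub_right_eq_self (fun x => D x * sech x ^ 2) s, sechPairing]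
    refine integral_congr_ae (Eventually.of_forall fun x => ?_)
    simp only [BoundedContinuousFunction.coe_mul, Pi.mul_apply, sechB_apply]
    ring
  rw [hint] at hev
  have hexp := abs_sechPairing_potentialDiff_le (k := k) hl hw hw' hB
  have hder := (hasDerivAt_effectivePotential (k := k) hW hl s₀).deriv
  -- The expansion is obtained at the actual shift `s`. Since `s - s₀ = O(ε)` and the pairing
  -- carries a factor `ε`, evaluating at `s₀` costs only `O(ε²)`.
  have hPs : |sechPairing (translateB W s * P) - sechPairing (translateB W s₀ * P)| ≤ C₂ * |ε| := by
    rw [← sechPairing_sub, ← sub_mul, hC₂, mul_assoc]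
    refine (abs_sechPairing_le _).trans (mul_le_mul_of_nonneg_left ((norm_mul_le _ _).trans ?_) hI)
    calc _ ≤ ‖W'‖ * (C * |ε|) * ‖P‖ := by
          refine mul_le_mul_of_nonneg_right ((norm_translateB_sub_le hW s s₀).trans ?_) hPn
          exact mul_le_mul_of_nonneg_left hs hM'
      _ = _ := by ring
  have hkinkt : ∀ {F : Filter ℝ} {c : ℝ}, Tendsto (kink k l) F (𝓝 c) →
      ∀ᶠ x in F, |kink k l x - c| ≤ 1 / 4 := fun h => by
    filter_upwards [h (Metric.closedBall_mem_nhds _ (by norm_num : (0 : ℝ) < 1 / 4))] with x hx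
    exact hx
  obtain ⟨a₁, ha₁⟩ := eventually_atTop.mp (hkinkt (tendsto_kink_atTop (k := k) hl))
  obtain ⟨a₂, ha₂⟩ := eventually_atBot.mp (hkinkt (tendsto_kink_atBot (k := k) hl))
  refine ⟨_, _, ev, max (a₁ + s) (-(a₂ + s)), max (‖q‖ + C * |ε|) (2 + B), hu, hu', fun x => ?_,
    fun x => ?_, fun x => ?_, fun x hx => ?_, fun x hx => ?_, hspec, hsimple, ?_⟩
  · exact ((abs_add_le _ _).trans (add_le_add (q.norm_coe_le_norm _) (hwx _))).trans
      (le_max_left _ _)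
  · refine ((abs_add_le _ _).trans (add_le_add ?_ (hB _))).trans (le_max_right _ _)
    have := abs_sech_le_one (x - s)
    rw [abs_mul, abs_mul, abs_sign hl, abs_two]
    linarith
  · have e1 := abs_kink_sub_le (k := k) hl (x - s) (x - s₀)
    rw [sub_sub_sub_cancel_left, abs_sub_comm s₀ s] at e1
    have e2 : q (x - s) + w (x - s) - kink k l (x - s₀) =
        (kink k l (x - s) - kink k l (x - s₀)) + w (x - s) := by rw [hq, kinkB_apply]; ring
    rw [e2]
    refine (abs_add_le _ _).trans ?_
    have e3 := hwx (x - s)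
    have e4 : 0 ≤ (8 * (‖W‖ + C) ^ 2 + C₁ + C₂) * |ε| := by positivity
    linarith
  · have e1 := ha₂ (x - s) (by have := le_max_right (a₁ + s) (-(a₂ + s)); linarith)
    have e2 := hwx (x - s)
    have e3 : q (x - s) + w (x - s) - 2 * Real.pi * k =
        (kink k l (x - s) - 2 * Real.pi * k) + w (x - s) := by rw [hq, kinkB_apply]; ring
    rw [e3]
    refine (abs_add_le _ _).trans ?_
    linarith
  · have e1 := ha₁ (x - s) (by have := le_max_left (a₁ + s) (-(a₂ + s)); linarith)
    have e2 := hwx (x - s)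
    push_cast at e1 ⊢
    have e3 : q (x - s) + w (x - s) - 2 * Real.pi * (k + l) =
        (kink k l (x - s) - 2 * Real.pi * (k + l)) + w (x - s) := by rw [hq, kinkB_apply]; ring
    rw [e3]
    refine (abs_add_le _ _).trans ?_
    linarith
  · have e1 : I * (|ε| * ‖translateB W s‖ * ‖w‖ + 2 * ‖w‖ ^ 2) ≤ C₁ * ε ^ 2 := by
      rw [hC₁, mul_assoc I (‖W‖ * C + 2 * C ^ 2)]
      refine mul_le_mul_of_nonneg_left ?_ hI
      calc _ ≤ |ε| * ‖W‖ * (C * |ε|) + 2 * (C * |ε|) ^ 2 := by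
            have := norm_translateB_le W s
            gcongr
        _ = _ := by rw [← sq_abs ε]; ring
    have e2 := hexp.trans e1
    have e3 := mul_le_mul_of_nonneg_left hPs hε0
    rw [← abs_mul] at e3
    have e4 : |ε| * (C₂ * |ε|) = C₂ * ε ^ 2 := by rw [← sq_abs ε]; ring
    have e5 : 8 * ((‖W‖ + C) * |ε|) ^ 2 = 8 * (‖W‖ + C) ^ 2 * ε ^ 2 := by
      rw [← sq_abs ε]; ring
    rw [e4] at e3
    rw [e5] at hev
    rw [hder]
    have hε2 := sq_nonneg ε
    have e6 : 0 ≤ 3 * C * ε ^ 2 := by positivity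
    have e7 : 0 ≤ C₁ * ε ^ 2 := by positivity
    have e8 : 0 ≤ C₂ * ε ^ 2 := by positivity
    rw [abs_le] at hev e2 e3 ⊢
    constructor <;> linarith [hev.1, hev.2, e2.1, e2.2, e3.1, e3.2]

end EigenvalueExpansion

/-! ### The tails of the front, and the theorem -/

section Assembly

/-- The cut-off difference of two stationary solutions which are both close to `2πm` far out in
the direction `s = ±1`. -/
theorem memH2_mul_sub {ε a B : ℝ} {m : ℤ} {V : ℝ →ᵇ ℝ} {u u' v v' χ : ℝ → ℝ}
    (hε : |ε| * ‖V‖ ≤ 1 / 4) (hχ : ContDiff ℝ (⊤ : ℕ∞) χ)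
    (hu : ∀ x, HasDerivAt u (u' x) x)
    (hu' : ∀ x, HasDerivAt u' (Real.sin (u x) - ε * (V x * u x)) x)
    (hv : ∀ x, HasDerivAt v (v' x) x)
    (hv' : ∀ x, HasDerivAt v' (Real.sin (v x) - ε * (V x * v x)) x)
    (huB : ∀ x, |u x| ≤ B) (huB' : ∀ x, |u' x| ≤ B)
    (hvm : ∀ x, |v x - 2 * Real.pi * m| ≤ 1 / 2) (hvB' : ∀ x, |v' x| ≤ 1)
    {s : ℝ} (hs : s = 1 ∨ s = -1) (hum : ∀ x, a ≤ s * x → |u x - 2 * Real.pi * m| ≤ 1 / 2)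
    (hone : ∀ x, 1 < s * x → χ x = 1) (hzero : ∀ x, s * x < -1 → χ x = 0) :
    MemH2 fun x => χ x * (u x - v x) := by
  have hcu : Continuous u := continuous_iff_continuousAt.mpr fun x => (hu x).continuousAt
  have hcv : Continuous v := continuous_iff_continuousAt.mpr fun x => (hv x).continuousAt
  have hB : 0 ≤ B := (abs_nonneg _).trans (huB 0)
  have heV : ∀ x, |ε * V x| ≤ 1 / 4 := fun x => by
    rw [abs_mul]
    exact (mul_le_mul_of_nonneg_left (V.norm_coe_le_norm x) (abs_nonneg ε)).trans hε
  have hm := abs_nonneg (2 * Real.pi * (m : ℝ))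
  refine memH2_mul_tail (d := fun x => u x - v x) (a := a)
    (B := B + (|2 * Real.pi * m| + 1)) (K := 5 / 4) hχ
    (fun x => (hu x).sub (hv x)) (fun x => (hu' x).sub (hv' x)) (by fun_prop) hs hone hzero
    (fun x => ?_) (fun x => ?_) (fun x => ?_) (fun x hx => ?_)
  · refine (abs_sub _ _).trans (add_le_add (huB x) ?_)
    have := abs_add_le (v x - 2 * Real.pi * m) (2 * Real.pi * m)
    rw [sub_add_cancel] at this
    have := hvm x
    linarith
  · refine (abs_sub _ _).trans (add_le_add (huB' x) ?_)
    have := hvB' x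
    linarith
  · have e : Real.sin (u x) - ε * (V x * u x) - (Real.sin (v x) - ε * (V x * v x)) =
        (Real.sin (u x) - Real.sin (v x)) - ε * V x * (u x - v x) := by ring
    rw [e]
    refine (abs_sub _ _).trans ?_
    have e1 := Real.abs_sin_sub_sin_le (u x) (v x)
    have e2 := mul_le_mul_of_nonneg_right (heV x) (abs_nonneg (u x - v x))
    rw [abs_mul _ (u x - v x)]
    linarith
  · have := half_sq_le_mul_sub (hum x hx) (hvm x) (heV x)
    simp only [mul_assoc] at this
    exact this

end Assembly

end PeriodicFront

theorem mainTheorem11 (k l : ℤ) (hl : l = 1 ∨ l = -1) (T : ℝ) (hT : 0 < T)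
    (V : ℝ → ℝ) (hV : ContDiff ℝ 1 V) (hVper : Function.Periodic V T)
    (s₀ : ℝ) (hs₀ : PeriodicFront.effectivePotential V k l s₀ = 0)
    (hs₀' : deriv (PeriodicFront.effectivePotential V k l) s₀ ≠ 0) :
    ∃ C ε₀ ρ : ℝ, 0 < C ∧ 0 < ε₀ ∧ 0 < ρ ∧
      ∃ (u vm vp : ℝ → ℝ → ℝ) (ev : ℝ → ℝ), ∀ ε ∈ Set.Ioo (-ε₀) ε₀,
        -- the front, nondegenerate for nonzero `ε`
        PeriodicFront.IsStationarySolution ε V (u ε) ∧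
        (ε ≠ 0 → PeriodicFront.IsNondegenerate ε V (u ε)) ∧
        eLpNorm (fun x => u ε x - PeriodicFront.kink k l (x - s₀)) ∞ volume
          ≤ ENNReal.ofReal (C * |ε|) ∧
        -- the periodic end states
        PeriodicFront.IsStationarySolution ε V (vm ε) ∧ Function.Periodic (vm ε) T ∧
        PeriodicFront.IsStationarySolution ε V (vp ε) ∧ Function.Periodic (vp ε) T ∧
        PeriodicFront.h2PerNorm T (fun x => vm ε x - 2 * Real.pi * k) ≤ C * |ε| ∧
        PeriodicFront.h2PerNorm T (fun x => vp ε x - 2 * Real.pi * (k + l)) ≤ C * |ε| ∧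
        (∀ χm χp : ℝ → ℝ, PeriodicFront.IsFrontPartition χm χp →
          PeriodicFront.MemH2 (fun x => χm x * (u ε x - vm ε x)) ∧
          PeriodicFront.MemH2 (fun x => χp x * (u ε x - vp ε x))) ∧
        -- the spectrum
        PeriodicFront.opSpectrum (PeriodicFront.linearization ε V (u ε)) ⊆
          {z : ℂ | ∃ x : ℝ, x ≤ -ρ ∧ z = (x : ℂ)} ∪ {(ev ε : ℂ)} ∧
        PeriodicFront.IsSimpleEigenvalue (PeriodicFront.linearization ε V (u ε)) (ev ε : ℂ) ∧
        |ev ε - (-ε * (deriv (PeriodicFront.effectivePotential V k l) s₀ /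
            ∫ x, deriv (PeriodicFront.kink k l) x ^ 2))| ≤ C * ε ^ 2 := by
  have hVd : ∀ x, HasDerivAt V (deriv V x) x := fun x =>
    ((hV.differentiable one_ne_zero) x).hasDerivAt
  have hVper' : Function.Periodic (deriv V) T := fun x => by
    rw [← deriv_comp_add_const, show (fun x => V (x + T)) = V from funext hVper]
  obtain ⟨W, hW⟩ := PeriodicFront.exists_boundedContinuous_of_periodic hV.continuous hT.ne' hVper
  -- Beyond bounds on `V` and `V'`, the front needs nothing from periodicity; the end states use it
  -- directly.
  obtain ⟨W', hW'⟩ := PeriodicFront.exists_boundedContinuous_of_periodic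
    (hV.continuous_deriv le_rfl) hT.ne' hVper'
  obtain rfl : (W : ℝ → ℝ) = V := funext hW
  have hWd : ∀ x, HasDerivAt W (W' x) x := fun x => hW' x ▸ hVd x
  obtain ⟨ε₁, C₁, hε₁, hC₁, H₁⟩ := PeriodicFront.exists_front_with_spectrum hWd hl hs₀ hs₀'
  obtain ⟨ε₂, C₂, hε₂, hC₂, H₂⟩ := PeriodicFront.exists_endState W.continuous hT hVper k
  obtain ⟨ε₃, C₃, hε₃, hC₃, H₃⟩ := PeriodicFront.exists_endState W.continuous hT hVper (k + l)
  set α := deriv (PeriodicFront.effectivePotential W k l) s₀ with hα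
  have hα0 : 0 < |α| := abs_pos.mpr hs₀'
  have hWn := norm_nonneg W
  set C := max C₁ (max C₂ C₃) with hC
  have hC1 : C₁ ≤ C := le_max_left _ _
  have hC2 : C₂ ≤ C := (le_max_left _ _).trans (le_max_right _ _)
  have hC3 : C₃ ≤ C := (le_max_right _ _).trans (le_max_right _ _)
  have hC0 : 0 < C := hC₁.trans_le hC1
  -- The last entry ensures `C ε² < |ε| |α| / 8` for `ε ≠ 0`, so the critical eigenvalue cannot
  -- vanish. The two before it provide the smallness used for the tails.
  set ε₀ := min (min ε₁ (min ε₂ ε₃))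
    (min (1 / (4 * (‖W‖ + 1))) (min (1 / (2 * C)) (|α| / (8 * C)))) with hε₀
  have hex : ∀ ε : ℝ, ∃ (u vm vp : ℝ → ℝ) (ev : ℝ), |ε| < ε₀ →
      PeriodicFront.IsStationarySolution ε W u ∧
      (ε ≠ 0 → PeriodicFront.IsNondegenerate ε W u) ∧
      eLpNorm (fun x => u x - PeriodicFront.kink k l (x - s₀)) ∞ volume
        ≤ ENNReal.ofReal (C * |ε|) ∧
      PeriodicFront.IsStationarySolution ε W vm ∧ Function.Periodic vm T ∧
      PeriodicFront.IsStationarySolution ε W vp ∧ Function.Periodic vp T ∧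
      PeriodicFront.h2PerNorm T (fun x => vm x - 2 * Real.pi * k) ≤ C * |ε| ∧
      PeriodicFront.h2PerNorm T (fun x => vp x - 2 * Real.pi * (k + l)) ≤ C * |ε| ∧
      (∀ χm χp : ℝ → ℝ, PeriodicFront.IsFrontPartition χm χp →
        PeriodicFront.MemH2 (fun x => χm x * (u x - vm x)) ∧
        PeriodicFront.MemH2 (fun x => χp x * (u x - vp x))) ∧
      PeriodicFront.opSpectrum (PeriodicFront.linearization ε W u) ⊆
        {z : ℂ | ∃ x : ℝ, x ≤ -(1 / 8) ∧ z = (x : ℂ)} ∪ {(ev : ℂ)} ∧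
      PeriodicFront.IsSimpleEigenvalue (PeriodicFront.linearization ε W u) (ev : ℂ) ∧
      |ev - (-ε * (α / ∫ x, deriv (PeriodicFront.kink k l) x ^ 2))| ≤ C * ε ^ 2 := by
    intro ε
    by_cases hε : |ε| < ε₀
    swap
    -- Values outside the interval are irrelevant; they only make the families total functions of
    -- `ε`.
    · exact ⟨0, 0, 0, 0, fun h => absurd h hε⟩
    simp only [hε₀, lt_min_iff] at hε
    obtain ⟨⟨h1, h2, h3⟩, h4, h5, h6⟩ := hε
    rw [lt_div_iff₀ (by positivity)] at h4 h5 h6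
    have hε0 := abs_nonneg ε
    obtain ⟨u, u', ev, a, B, hu, hu', huB, huB', hclose, hum, hup, hspec, hsimple, hev⟩ := H₁ ε h1
    obtain ⟨vm, vm', hvm, hvm', hvmT, hvmB, hvmB', hvmn⟩ := H₂ ε h2
    obtain ⟨vp, vp', hvp, hvp', hvpT, hvpB, hvpB', hvpn⟩ := H₃ ε h3
    have hmono : ∀ {c : ℝ}, c ≤ C → c * |ε| ≤ C * |ε| := fun h =>
      mul_le_mul_of_nonneg_right h hε0
    have hεW : |ε| * ‖W‖ ≤ 1 / 4 := by linarith
    have hhalf : C * |ε| ≤ 1 / 2 := by linarith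
    refine ⟨u, vm, vp, ev, fun _ => ⟨?_, fun hne => ?_, ?_, ?_, hvmT, ?_, hvpT,
      hvmn.trans (hmono hC2), ?_, fun χm χp hχ => ⟨?_, ?_⟩, hspec, hsimple, ?_⟩⟩
    · exact PeriodicFront.isStationarySolution_of_hasDerivAt W.continuous hu hu'
    · refine PeriodicFront.isInvertible_of_notMem_opSpectrum fun hmem => ?_
      rcases hspec hmem with ⟨x, hx, h0⟩ | h0
      · have : x = 0 := by exact_mod_cast h0.symm
        linarith
      · have hev0 : ev = 0 := by
          have : (0 : ℂ) = (ev : ℂ) := h0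
          exact_mod_cast this.symm
        have e : ev - -ε * (α / 8) = ε * (α / 8) := by rw [hev0]; ring
        rw [e, abs_mul, abs_div, ← sq_abs ε, abs_of_pos (show (0 : ℝ) < 8 by norm_num)] at hev
        have hpos : 0 < |ε| := abs_pos.mpr hne
        have e1 : C₁ * |ε| ^ 2 ≤ C * |ε| ^ 2 := mul_le_mul_of_nonneg_right hC1 (sq_nonneg _)
        nlinarith
    · refine (eLpNorm_exponent_top (ε := ℝ)).trans_le ?_
      refine eLpNormEssSup_le_of_ae_bound (Filter.Eventually.of_forall fun x => ?_)
      exact (hclose x).trans (hmono hC1)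
    · exact PeriodicFront.isStationarySolution_of_hasDerivAt W.continuous hvm hvm'
    · exact PeriodicFront.isStationarySolution_of_hasDerivAt W.continuous hvp hvp'
    · push_cast at hvpn
      exact hvpn.trans (hmono hC3)
    · have hzero : ∀ x, 1 ≤ x → χm x = 0 := fun x hx =>
        Function.notMem_support.mp fun h => not_lt.mpr hx (hχ.support_minus h)
      have hone : ∀ x, x ≤ -1 → χm x = 1 := fun x hx => by
        have h := hχ.add_eq_one x
        rwa [Function.notMem_support.mp fun h => not_lt.mpr hx (hχ.support_plus h),
          add_zero] at h
      refine PeriodicFront.memH2_mul_sub (a := a) (s := -1) (m := k) hεW hχ.smooth_minus hu hu' hvm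
        hvm' huB huB' (fun x => (hvmB x).trans ((hmono hC2).trans hhalf))
        (fun x => (hvmB' x).trans ((hmono hC2).trans (by linarith))) (Or.inr rfl)
        (fun x hx => hum x (by linarith)) (fun x hx => hone x (by linarith))
        fun x hx => hzero x (by linarith)
    · have hzero : ∀ x, x ≤ -1 → χp x = 0 := fun x hx =>
        Function.notMem_support.mp fun h => not_lt.mpr hx (hχ.support_plus h)
      have hone : ∀ x, 1 ≤ x → χp x = 1 := fun x hx => by
        have h := hχ.add_eq_one x
        rwa [Function.notMem_support.mp fun h => not_lt.mpr hx (hχ.support_minus h),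
          zero_add] at h
      refine PeriodicFront.memH2_mul_sub (a := a) (s := 1) (m := k + l) hεW hχ.smooth_plus hu hu'
        hvp hvp' huB huB' (fun x => (hvpB x).trans ((hmono hC3).trans hhalf))
        (fun x => (hvpB' x).trans ((hmono hC3).trans (by linarith))) (Or.inl rfl)
        (fun x hx => hup x (by linarith)) (fun x hx => hone x (by linarith))
        fun x hx => hzero x (by linarith)
    · rw [PeriodicFront.integral_deriv_kink_sq hl]
      exact hev.trans (mul_le_mul_of_nonneg_right hC1 (sq_nonneg ε))
  choose u vm vp ev hall using hex
  refine ⟨C, ε₀, 1 / 8, hC0, by positivity, by norm_num, u, vm, vp, ev, fun ε hε => ?_⟩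
  exact hall ε (abs_lt.mpr hε)
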